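/- Let $M\in\mathbb N$, $m>0$, and let $\mathscr H=L^2(\mathbb R^{3M})\otimes\Gamma(L^2(\mathbb R^3))=\bigoplus_{n\ge 0}\mathscr H^{(n)}$, where $\Gamma$ is the bosonic Fock space and $\mathscr H^{(n)}$ consists of the functions $\psi(X,Y)$ in $L^2(\mathbb R^{3M}\times\mathbb R^{3n})$ that are symmetric in $Y=(y_1,\dots,y_n)$. Let $N$ be the number operator ($N=n$ on $\mathscr H^{(n)}$), with its maximal domain $D(N)$. Write $\hat\psi(P,K)$ for the unitary Fourier transform, with $P=(p_1,\dots,p_M)$ and $K=(k_1,\dots,k_n)$, and let $e_\mu:\mathbb R^3\to\mathbb R^{3M}$ be the inclusion of the $\mu$-th summand. A hat on $K$ or $P$ with an index denotes removal of that entry. Let $L=-\frac1{2m}\sum_{\mu=1}^M\Delta_{x_\mu}+\mathrm d\Gamma(-\Delta_y+1)$ be the free Hamiltonian, self-adjoint on its maximal domain $D(L)$; on $\mathscr H^{(n)}$ it is multiplication by $\frac1{2m}P^2+K^2+n$ in Fourier variables, and $L^s$ ($s\ge0$) is defined accordingly. Let $K=L+T$ (as an operator) with domain $D(K)=D(L)$,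 where $T=T_{\mathrm d}+T_{\mathrm{od}}$ acts on $\mathscr H^{(n)}$ by $$\widehat{T_{\mathrm d}\psi}(P,K)=\frac1{4\pi}\Big(\frac{2m}{2m+1}\Big)^{3/2}\sum_{\mu=1}^M\sqrt{n+1+\tfrac1{2m+1}p_\mu^2+\tfrac1{2m}\hat P_\mu^2+K^2}\;\hat\psi(P,K),$$ $$\widehat{T_{\mathrm{od}}\psi}(P,K)=-\frac1{(2\pi)^3}\Big(\sum_{\mu,\nu=1}^M\sum_{i=1}^n\int_{\mathbb R^3}\frac{\hat\psi(P-e_\mu\xi+e_\nu k_i,\hat K_i,\xi)}{n+1+\frac1{2m}(P-e_\mu\xi)^2+K^2+\xi^2}\,d\xi+\sum_{\mu\ne\nu}\int_{\mathbb R^3}\frac{\hat\psi(P-e_\mu\xi+e_\nu\xi,K)}{n+1+\frac1{2m}(P-e_\mu\xi)^2+K^2+\xi^2}\,d\xi\Big).$$ The operator $K$ is self-adjoint and bounded from below. Let $c_0\in\mathbb R$ with $c_0>-\min\sigma(K)$. For $\psi\in\mathscr H$ let $a^*(\delta_{x_\mu})\psi$ be the distribution whose component on $\mathbb R^{3(M+n+1)}$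 is $\frac1{\sqrt{n+1}}\sum_{i=1}^{n+1}\delta_{x_\mu}(y_i)\psi^{(n)}(X,\hat Y_i)$, which has the Fourier transform $\frac{1}{(2\pi)^{3/2}\sqrt{n+1}}\sum_{i=1}^{n+1}\hat\psi^{(n)}(P+e_\mu k_i,\hat K_i)$, and whose component for zero bosons is $0$. Let $$G_T\psi=-\sum_{\mu=1}^M(K+c_0)^{-1}a^*(\delta_{x_\mu})\psi,$$ where $(K+c_0)^{-1}$ is extended by duality to the anti-dual of $D(K)$; that is, $G_T\psi$ is the unique $\eta\in\mathscr H$ with $\langle (K+c_0)\varphi,\eta\rangle=-\sum_{\mu}\langle\varphi,a^*(\delta_{x_\mu})\psi\rangle$ for all $\varphi\in D(K)$. Then $G_T$ is a well-defined bounded linear operator on $\mathscr H$, and: 1. For every $0\le s<\frac14$ there is a constant $C$ such that for all $\psi\in\mathscr H$ one has $G_T\psi\in D(L^s)$ and $\|L^sG_T\psi\|\le C\,\|(N+1)^{s-\frac14}\psi\|$. 2. The operator $1-G_T$ has a bounded inverse on $\mathscr H$, and both $1-G_T$ and $(1-G_T)^{-1}$ map $D(N)$ into itself. -/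

import Mathlib

open MeasureTheory
open scoped ENNReal ComplexConjugate

noncomputable section

namespace PointInteraction

/-- Three-dimensional Euclidean space. -/
abbrev R3 : Type := EuclideanSpace ℝ (Fin 3)

/-- Configurations `(X, Y)` of `M` `x`-particles and `n` `y`-particles: `ℝ^{3(M+n)}` with its
Euclidean structure and Lebesgue measure. The entry at `Sum.inl μ` is `x_μ`, the entry at
`Sum.inr i` is `y_i`. The same space serves as momentum space, with entries `p_μ` and `k_i`. -/
abbrev Conf (M n : ℕ) : Type := PiLp 2 (fun _ : Fin M ⊕ Fin n => R3)

/-- The configuration `(X, (y_{σ 1}, …, y_{σ n}))`. -/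
def permConf (M n : ℕ) (σ : Equiv.Perm (Fin n)) (x : Conf M n) : Conf M n :=
  WithLp.toLp 2 (fun a => x (Sum.map id σ a))

theorem measurePreserving_permConf (M n : ℕ) (σ : Equiv.Perm (Fin n)) :
    MeasurePreserving (permConf M n σ) := by
  let e : Conf M n ≃ₗᵢ[ℝ] Conf M n :=
    LinearIsometryEquiv.piLpCongrLeft 2 ℝ R3 (Equiv.sumCongr (Equiv.refl (Fin M)) σ.symm)
  have h : permConf M n σ = e := by
    funext x
    ext a j
    rcases a with a | a <;>
      simp [permConf, e, LinearIsometryEquiv.piLpCongrLeft_apply, Equiv.piCongrLeft'_apply]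
  rw [h]
  exact e.measurePreserving

/-- The sector of `n` `y`-particles: square-integrable functions on `ℝ^{3(M+n)}` (positions) that
are symmetric under permutations of the `y`-particles,
`L²(ℝ^{3M}) ⊗ L²(ℝ³)^{⊗_sym n}`. -/
def Sector (M n : ℕ) : Submodule ℂ (Lp ℂ 2 (volume : Measure (Conf M n))) where
  carrier := {f | ∀ σ : Equiv.Perm (Fin n), (fun x => f (permConf M n σ x)) =ᵐ[volume] f}
  add_mem' := by
    intro f g hf hg σ
    have hq := (measurePreserving_permConf M n σ).quasiMeasurePreserving
    filter_upwards [hf σ, hg σ, Lp.coeFn_add f g, hq.ae (Lp.coeFn_add f g)] with x h1 h2 h3 h4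
    rw [h4, h3, Pi.add_apply, Pi.add_apply, h1, h2]
  zero_mem' := by
    intro σ
    have hq := (measurePreserving_permConf M n σ).quasiMeasurePreserving
    have h0 := Lp.coeFn_zero ℂ 2 (volume : Measure (Conf M n))
    filter_upwards [h0, hq.ae h0] with x h1 h2
    rw [h1, h2]
    rfl
  smul_mem' := by
    intro c f hf σ
    have hq := (measurePreserving_permConf M n σ).quasiMeasurePreserving
    filter_upwards [hf σ, Lp.coeFn_smul c f, hq.ae (Lp.coeFn_smul c f)] with x h1 h2 h3
    rw [h3, h2, Pi.smul_apply, Pi.smul_apply, h1]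

/-- The Hilbert space `L²(ℝ^{3M}) ⊗ Γ(L²(ℝ³))`, as the Hilbert direct sum of its sectors. -/
abbrev Hilb (M : ℕ) : Type := lp (fun n : ℕ => Sector M n) 2

instance (M n : ℕ) : NormedAddCommGroup (Sector M n) := Submodule.normedAddCommGroup _

instance (M n : ℕ) : InnerProductSpace ℂ (Sector M n) := Submodule.innerProductSpace _

instance (M : ℕ) : NormedAddCommGroup (Hilb M) := lp.normedAddCommGroup

instance (M : ℕ) : InnerProductSpace ℂ (Hilb M) := lp.instInnerProductSpace

/-- The unitary Fourier transform
`ψ̂(k) = (2π)^{-3(M+n)/2} ∫ e^{-i k·x} ψ(x) dx` on the `n`-particle sector, obtained by rescaling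
from Mathlib's, which has the kernel `e^{-2πi k·x}`. It is determined almost everywhere. -/
def hat {M n : ℕ} (ψ : Sector M n) (k : Conf M n) : ℂ :=
  (((2 * Real.pi) ^ (-(3 * ((M : ℝ) + n) / 2)) : ℝ) : ℂ) *
    (Lp.fourierTransformₗᵢ (Conf M n) ℂ (ψ : Lp ℂ 2 (volume : Measure (Conf M n))))
      ((2 * Real.pi)⁻¹ • k)

/-- The Fourier symbol `L(P,K) = P²/(2m) + K² + n` of the free Hamiltonian
`L = -(1/2m) ∑ Δ_{x_μ} + dΓ(-Δ_y + 1)` on the `n`-particle sector. -/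
def freeSymbol {M n : ℕ} (m : ℝ) (k : Conf M n) : ℝ :=
  (1 / (2 * m)) * ∑ μ, ‖k (Sum.inl μ)‖ ^ 2 + ∑ i, ‖k (Sum.inr i)‖ ^ 2 + n

/-- `χ = L^s ψ`: the graph of the self-adjoint operator `L^s`, `s ≥ 0`, with its maximal domain. -/
def IsFreePow {M : ℕ} (m s : ℝ) (ψ χ : Hilb M) : Prop :=
  ∀ n : ℕ, hat (χ n) =ᵐ[volume] fun k => ((freeSymbol m k ^ s : ℝ) : ℂ) * hat (ψ n) k

/-- The domain `D(L)`. -/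
def freeDomain (M : ℕ) (m : ℝ) : Set (Hilb M) := {ψ | ∃ χ, IsFreePow m 1 ψ χ}

/-- The multiplier of the diagonal part `T_d` of the Skornyakov--Ter-Martirosyan operator:
`(1/4π) (2m/(2m+1))^{3/2} ∑_μ √(n + 1 + p_μ²/(2m+1) + P̂_μ²/(2m) + K²)`, where `P̂_μ` is `P`
without the entry `p_μ`. -/
def diagSymbol {M n : ℕ} (m : ℝ) (k : Conf M n) : ℝ :=
  (1 / (4 * Real.pi)) * (2 * m / (2 * m + 1)) ^ (3 / 2 : ℝ) *
    ∑ μ : Fin M, Real.sqrt ((n : ℝ) + 1 + (1 / (2 * m + 1)) * ‖k (Sum.inl μ)‖ ^ 2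
      + (1 / (2 * m)) * ∑ ν ∈ Finset.univ.erase μ, ‖k (Sum.inl ν)‖ ^ 2
      + ∑ i, ‖k (Sum.inr i)‖ ^ 2)

/-- `(P + e_μ q, K)`. -/
def shift {M n : ℕ} (μ : Fin M) (q : R3) (k : Conf M n) : Conf M n :=
  WithLp.toLp 2 (Function.update (fun a => k a) (Sum.inl μ) (k (Sum.inl μ) + q))

/-- `(P, K)` with the `i`-th boson momentum `k_i` replaced by `q`. -/
def replace {M n : ℕ} (i : Fin n) (q : R3) (k : Conf M n) : Conf M n :=
  WithLp.toLp 2 (Function.update (fun a => k a) (Sum.inr i) q)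

/-- `(P, K̂_i)`: the `i`-th boson momentum is removed. -/
def remove {M n : ℕ} (i : Fin (n + 1)) (k : Conf M (n + 1)) : Conf M n :=
  WithLp.toLp 2 (fun a => k (Sum.map id i.succAbove a))

/-- `n + 1 + (P - e_μ ξ)²/(2m) + K² + ξ²`. -/
def offDiagDenom {M n : ℕ} (m : ℝ) (μ : Fin M) (ξ : R3) (k : Conf M n) : ℝ :=
  freeSymbol m (shift μ (-ξ) k) + 1 + ‖ξ‖ ^ 2

/-- The off-diagonal part `T_od` in Fourier variables. The first integrand contains
`ψ̂(P - e_μ ξ + e_ν k_i, K̂_i, ξ)`; since `ψ̂` is symmetric in the bosons, `ξ` is put into the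
slot of the removed `k_i`. -/
def offDiag {M n : ℕ} (m : ℝ) (f : Conf M n → ℂ) (k : Conf M n) : ℂ :=
  -((((2 * Real.pi) ^ 3)⁻¹ : ℝ) : ℂ) *
    ((∑ μ : Fin M, ∑ ν : Fin M, ∑ i : Fin n,
        ∫ ξ : R3, f (replace i ξ (shift ν (k (Sum.inr i)) (shift μ (-ξ) k)))
          / ((offDiagDenom m μ ξ k : ℝ) : ℂ))
      + ∑ μ : Fin M, ∑ ν ∈ Finset.univ.erase μ,
        ∫ ξ : R3, f (shift ν ξ (shift μ (-ξ) k)) / ((offDiagDenom m μ ξ k : ℝ) : ℂ))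

/-- `χ = K ψ`, where `K = L + T`, `T = T_d + T_od`, with domain `D(K) = D(L)`. -/
def IsK {M : ℕ} (m : ℝ) (ψ χ : Hilb M) : Prop :=
  ψ ∈ freeDomain M m ∧ ∀ n : ℕ, hat (χ n) =ᵐ[volume] fun k =>
    (freeSymbol m k : ℂ) * hat (ψ n) k
      + ((diagSymbol m k : ℂ) * hat (ψ n) k + offDiag m (hat (ψ n)) k)

/-- The spectrum of the unbounded operator `K`: those `z` for which `K - z : D(K) → Hilb M` has no
everywhere defined bounded inverse. -/
def spectrumK (M : ℕ) (m : ℝ) : Set ℂ :=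
  {z | ¬ ∃ R : Hilb M →L[ℂ] Hilb M,
    (∀ ψ : Hilb M, IsK m (R ψ) (ψ + z • R ψ)) ∧ ∀ φ χ : Hilb M, IsK m φ χ → R (χ - z • φ) = φ}

/-- The Fourier transform of the distribution `∑_μ a*(δ_{x_μ}) ψ` in each sector. For
`ψ` in the `n`-particle sector, `a*(δ_{x_μ}) ψ` is the distribution
`(n+1)^{-1/2} ∑_i δ_{x_μ}(y_i) ψ(X, Ŷ_i)` on `ℝ^{3(M+n+1)}`, and the Fourier transform of
`δ_{x_μ}(y_i) ψ(X, Ŷ_i)` is the function `(2π)^{-3/2} ψ̂(P + e_μ k_i, K̂_i)`. -/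
def creationHat {M : ℕ} (ψ : Hilb M) : (n : ℕ) → Conf M n → ℂ
  | 0, _ => 0
  | n + 1, k => ∑ μ : Fin M,
      (((Real.sqrt ((n : ℝ) + 1))⁻¹ * (2 * Real.pi) ^ (-(3 / 2) : ℝ) : ℝ) : ℂ) *
        ∑ i : Fin (n + 1), hat (ψ n) (shift μ (k (Sum.inr i)) (remove i k))

/-- `η = G_T ψ = -∑_μ (K + c₀)⁻¹ a*(δ_{x_μ}) ψ`. The distribution `∑_μ a*(δ_{x_μ}) ψ` is an element
of the (anti-)dual space of `D(K)`, by the `L²`-pairing, and `(K + c₀)⁻¹` acts on it as the inverse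
of the extension of `K + c₀` to a map from the Hilbert space to the dual of `D(K)`. That is,
`⟨(K + c₀)φ, η⟩ = -⟨φ, ∑_μ a*(δ_{x_μ}) ψ⟩` for all `φ ∈ D(K)`. -/
def IsGT {M : ℕ} (m c₀ : ℝ) (ψ η : Hilb M) : Prop :=
  ∀ φ χ : Hilb M, IsK m φ χ →
    (∀ n, Integrable (fun k => conj (hat (φ n) k) * creationHat ψ n k) volume) ∧
    HasSum (fun n => ∫ k, conj (hat (φ n) k) * creationHat ψ n k)
      (-(inner ℂ (χ + (c₀ : ℂ) • φ) η))

/-- The domain `D(N)` of the number operator. -/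
def numberDomain (M : ℕ) : Set (Hilb M) :=
  {ψ | Memℓp (fun n : ℕ => (n : ℂ) • ψ n) 2}

theorem memℓp_numberPow {M : ℕ} (a : ℝ) (ha : a ≤ 0) (ψ : Hilb M) :
    Memℓp (fun n : ℕ => ((((n : ℝ) + 1) ^ a : ℝ) : ℂ) • ψ n) 2 := by
  refine Memℓp.mono' (lp.memℓp ψ) ?_
  intro n
  have h0 : (0 : ℝ) ≤ ((n : ℝ) + 1) ^ a := by positivity
  have h1 : ((n : ℝ) + 1) ^ a ≤ 1 := Real.rpow_le_one_of_one_le_of_nonpos (by simp) ha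
  have h2 : ‖((((n : ℝ) + 1) ^ a : ℝ) : ℂ)‖ ≤ 1 := by
    rw [Complex.norm_real, Real.norm_of_nonneg h0]
    exact h1
  calc ‖((((n : ℝ) + 1) ^ a : ℝ) : ℂ) • ψ n‖
      = ‖((((n : ℝ) + 1) ^ a : ℝ) : ℂ)‖ * ‖ψ n‖ := norm_smul _ _
    _ ≤ ‖ψ n‖ := mul_le_of_le_one_left (norm_nonneg _) h2

/-- `(N + 1)^a ψ` for `a ≤ 0`. -/
def numberPow {M : ℕ} (a : ℝ) (ha : a ≤ 0) (ψ : Hilb M) : Hilb M :=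
  ⟨fun n => ((((n : ℝ) + 1) ^ a : ℝ) : ℂ) • ψ n, memℓp_numberPow a ha ψ⟩

end PointInteraction

end

/-!
The operator `K = L + T` is compared with `L + 1`, where `L` is the free Hamiltonian. In Fourier
variables `L + 1` is multiplication by `energy m k ≥ 1`. The diagonal part of `T` is bounded by
`(L + 1)^{1/2}`, and the off-diagonal part by `(L + 1)^{3/4}`, uniformly in the number of bosons:
this is `exists_lintegral_offDiagAbs_sq_le`, a Schur test. The measure preserving changes of
variables that exchange a boson or a particle momentum with the integration variable turn the Schur
test into the convergence of `∫ (1 + ξ²)^{-7/4} dξ`. Consequently the operators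
`(T + c) (L + 1)^{s - 1}` are bounded for `s ≤ 1/4` (`exists_interaction`), and on `D(K) = D(L)`

  `K + c₀ = (1 + X) (L + 1)` with `X = (T + c₀ - 1) (L + 1)^{-1}` bounded (`isK_of_hat_eq`).

Since `-c₀` lies outside the spectrum of `K`, the operator `Y = 1 + X` is invertible
(`bijective_of_resolvent`). The pairing of `-∑_μ a*(δ_{x_μ}) ψ` with `(L + 1)^{-1} v` is the inner
product of `v` with `G ψ = -∑_μ (L + 1)^{-1} a*(δ_{x_μ}) ψ`, so `G_T = (Y⁻¹)† G` (`isGT_iff`).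

For the regularity of `G_T`, the creation operator satisfies
`‖(L + 1)^{s - 1} ∑_μ a*(δ_{x_μ}) ψ‖ ≤ C ‖(N + 1)^{s - 1/4} ψ‖` for `s < 1/4` (`exists_creation`),
by the Cauchy--Schwarz inequality in the sum over the created boson and the scaling of
`∫ (k² + n + 1)^{2 s - 2} dk`. The equation `G_T ψ = G ψ - X† G_T ψ` can be divided by
`(L + 1)^{-s}`, because both `G` and `X†` have that factor on the left (`adjoint_symm_eq`).

For the invertibility of `1 - G_T`, the operator `Y` preserves the number of bosons, so `G_T` raises
it by one and, by the bound above with `s = 0`, has norm at most `C (n + 1)^{-1/4}` on the `n`-boson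
sector. Hence `‖G_T ^ k‖ ≤ C ^ k (k!)^{-1/4}`, some power of `G_T` has norm less than one, and the
inverse exists (`RaisesWithDecay.isUnit_one_sub`). The decay also makes `N G_T` small compared to
`N` on high sectors, which gives the invariance of `D(N)`.
-/

namespace PointInteraction

/-! ### The sectors and the Fourier transform -/

/-- The permutation `permConf` of the `y`-particles as a linear isometry of configuration space. -/
noncomputable def permEquiv (M n : ℕ) (σ : Equiv.Perm (Fin n)) : Conf M n ≃ₗᵢ[ℝ] Conf M n :=
  LinearIsometryEquiv.piLpCongrLeft 2 ℝ R3 (Equiv.sumCongr (Equiv.refl (Fin M)) σ.symm)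

theorem coe_permEquiv (M n : ℕ) (σ : Equiv.Perm (Fin n)) :
    (permEquiv M n σ : Conf M n → Conf M n) = permConf M n σ := by
  funext x
  ext a j
  rcases a with a | a <;>
    simp [permConf, permEquiv, LinearIsometryEquiv.piLpCongrLeft_apply, Equiv.piCongrLeft'_apply]

@[simp] theorem permConf_inl {M n : ℕ} (σ : Equiv.Perm (Fin n)) (x : Conf M n) (μ : Fin M) :
    permConf M n σ x (Sum.inl μ) = x (Sum.inl μ) := rfl

@[simp] theorem permConf_inr {M n : ℕ} (σ : Equiv.Perm (Fin n)) (x : Conf M n) (i : Fin n) :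
    permConf M n σ x (Sum.inr i) = x (Sum.inr (σ i)) := rfl

theorem permConf_smul {M n : ℕ} (σ : Equiv.Perm (Fin n)) (r : ℝ) (x : Conf M n) :
    permConf M n σ (r • x) = r • permConf M n σ x := by
  rw [← coe_permEquiv, map_smul]

theorem mem_sector_iff {M n : ℕ} (f : Lp ℂ 2 (volume : Measure (Conf M n))) :
    f ∈ Sector M n ↔ ∀ σ : Equiv.Perm (Fin n),
      Lp.compMeasurePreservingₗᵢ ℂ (permConf M n σ) (measurePreserving_permConf M n σ) f = f := by
  refine forall_congr' fun σ => ?_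
  have h := Lp.coeFn_compMeasurePreserving f (measurePreserving_permConf M n σ)
  constructor
  · intro hf
    exact Lp.ext (h.trans hf)
  · intro hf
    have h2 : Lp.compMeasurePreserving (permConf M n σ) (measurePreserving_permConf M n σ) f = f :=
      hf
    rw [h2] at h
    exact h.symm

theorem isClosed_sector (M n : ℕ) :
    IsClosed (Sector M n : Set (Lp ℂ 2 (volume : Measure (Conf M n)))) := by
  have : (Sector M n : Set (Lp ℂ 2 (volume : Measure (Conf M n)))) = ⋂ σ : Equiv.Perm (Fin n),
      {f | Lp.compMeasurePreservingₗᵢ ℂ (permConf M n σ) (measurePreserving_permConf M n σ) f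
        = f} := by
    ext f
    simp only [SetLike.mem_coe, mem_sector_iff, Set.mem_iInter, Set.mem_ofPred_eq]
  rw [this]
  exact isClosed_iInter fun σ => isClosed_eq (LinearIsometry.continuous _) continuous_id

instance (M n : ℕ) : CompleteSpace (Sector M n) :=
  (isClosed_sector M n).completeSpace_coe

/-- The Fourier transform on `L²` commutes with linear isometries. -/
theorem fourierTransform_compMeasurePreserving {V : Type*} [NormedAddCommGroup V]
    [InnerProductSpace ℝ V] [FiniteDimensional ℝ V] [MeasurableSpace V] [BorelSpace V]
    (e : V ≃ₗᵢ[ℝ] V) (f : Lp ℂ 2 (volume : Measure V)) :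
    Lp.fourierTransformₗᵢ V ℂ (Lp.compMeasurePreservingₗᵢ ℂ e e.measurePreserving f) =
      Lp.compMeasurePreservingₗᵢ ℂ e e.measurePreserving (Lp.fourierTransformₗᵢ V ℂ f) := by
  apply DenseRange.induction_on (p := fun f : Lp ℂ 2 (volume : Measure V) =>
    Lp.fourierTransformₗᵢ V ℂ (Lp.compMeasurePreservingₗᵢ ℂ e e.measurePreserving f) =
      Lp.compMeasurePreservingₗᵢ ℂ e e.measurePreserving (Lp.fourierTransformₗᵢ V ℂ f))
    (SchwartzMap.denseRange_toLpCLM (p := 2) ENNReal.ofNat_ne_top) f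
  · exact isClosed_eq
      ((LinearIsometryEquiv.continuous _).comp (LinearIsometry.continuous _))
      ((LinearIsometry.continuous _).comp (LinearIsometryEquiv.continuous _))
  intro g
  have key : ∀ g : SchwartzMap V ℂ,
      Lp.compMeasurePreservingₗᵢ ℂ e e.measurePreserving (g.toLp 2) =
      (SchwartzMap.compCLMOfContinuousLinearEquiv ℂ e.toContinuousLinearEquiv g).toLp 2 := by
    intro g
    apply Lp.ext
    refine (Lp.coeFn_compMeasurePreserving _ e.measurePreserving).trans ?_
    have h1 := e.measurePreserving.quasiMeasurePreserving.ae_eq_comp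
      (SchwartzMap.coeFn_toLp g 2 (volume : Measure V))
    refine h1.trans ?_
    exact (SchwartzMap.coeFn_toLp (SchwartzMap.compCLMOfContinuousLinearEquiv ℂ
      e.toContinuousLinearEquiv g) 2 (volume : Measure V)).symm
  have hF : ∀ g : SchwartzMap V ℂ, Lp.fourierTransformₗᵢ V ℂ (g.toLp 2)
      = (FourierTransform.fourier g : SchwartzMap V ℂ).toLp 2 := SchwartzMap.toLp_fourier_eq
  change Lp.fourierTransformₗᵢ V ℂ (Lp.compMeasurePreservingₗᵢ ℂ e e.measurePreserving (g.toLp 2))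
    = Lp.compMeasurePreservingₗᵢ ℂ e e.measurePreserving (Lp.fourierTransformₗᵢ V ℂ (g.toLp 2))
  rw [key, hF, hF, key]
  congr 1
  ext w
  simp only [SchwartzMap.fourier_coe, SchwartzMap.compCLMOfContinuousLinearEquiv_apply]
  exact Real.fourier_comp_linearIsometry e g w

theorem fourierTransform_mem_sector {M n : ℕ} {f : Lp ℂ 2 (volume : Measure (Conf M n))} :
    Lp.fourierTransformₗᵢ (Conf M n) ℂ f ∈ Sector M n ↔ f ∈ Sector M n := by
  rw [mem_sector_iff, mem_sector_iff]
  refine forall_congr' fun σ => ?_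
  have h := fourierTransform_compMeasurePreserving (permEquiv M n σ) f
  simp only [coe_permEquiv] at h
  rw [← h]
  exact (LinearIsometryEquiv.injective _).eq_iff

theorem measurable_hat {M n : ℕ} (ψ : Sector M n) : Measurable (hat ψ) := by
  unfold hat
  exact ((Lp.stronglyMeasurable _).measurable.comp (measurable_const_smul _)).const_mul _

theorem quasiMeasurePreserving_const_smul (M n : ℕ) {r : ℝ} (hr : r ≠ 0) :
    Measure.QuasiMeasurePreserving (fun k : Conf M n => r • k) volume volume :=
  Measure.quasiMeasurePreserving_smul volume hr

theorem two_pi_inv_ne_zero : ((2 * Real.pi)⁻¹ : ℝ) ≠ 0 := by positivity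

theorem hat_add {M n : ℕ} (φ ψ : Sector M n) :
    hat (φ + ψ) =ᵐ[volume] fun k => hat φ k + hat ψ k := by
  have h := (quasiMeasurePreserving_const_smul M n two_pi_inv_ne_zero).ae
    (Lp.coeFn_add (Lp.fourierTransformₗᵢ (Conf M n) ℂ (φ : Lp ℂ 2 (volume : Measure (Conf M n))))
      (Lp.fourierTransformₗᵢ (Conf M n) ℂ (ψ : Lp ℂ 2 (volume : Measure (Conf M n)))))
  filter_upwards [h] with k hk
  simp only [hat, Submodule.coe_add, map_add]
  rw [hk, Pi.add_apply, mul_add]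

theorem hat_smul {M n : ℕ} (c : ℂ) (ψ : Sector M n) :
    hat (c • ψ) =ᵐ[volume] fun k => c * hat ψ k := by
  have h := (quasiMeasurePreserving_const_smul M n two_pi_inv_ne_zero).ae
    (Lp.coeFn_smul c
      (Lp.fourierTransformₗᵢ (Conf M n) ℂ (ψ : Lp ℂ 2 (volume : Measure (Conf M n)))))
  filter_upwards [h] with k hk
  simp only [hat, Submodule.coe_smul, map_smul]
  rw [hk, Pi.smul_apply, smul_eq_mul]
  ring

theorem hat_perm {M n : ℕ} (ψ : Sector M n) (σ : Equiv.Perm (Fin n)) :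
    (fun k => hat ψ (permConf M n σ k)) =ᵐ[volume] hat ψ := by
  have h := fourierTransform_mem_sector.2 ψ.2 σ
  filter_upwards [(quasiMeasurePreserving_const_smul M n two_pi_inv_ne_zero).ae h] with k hk
  simp only [hat, ← permConf_smul]
  rw [hk]

theorem finrank_conf (M n : ℕ) : Module.finrank ℝ (Conf M n) = 3 * (M + n) := by
  have : Module.finrank ℝ (Conf M n) = Module.finrank ℝ (∀ _ : Fin M ⊕ Fin n, R3) :=
    (WithLp.linearEquiv 2 ℝ (∀ _ : Fin M ⊕ Fin n, R3)).finrank_eq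
  rw [this, Module.finrank_pi_fintype]
  simp
  ring

/-- The constants in the definition of `hat` make it unitary. -/
theorem hat_scaling {M n : ℕ} {c : ℝ} (hc : c = (2 * Real.pi) ^ (-(3 * ((M : ℝ) + n) / 2))) :
    c ^ 2 *
      |(((2 * Real.pi)⁻¹ : ℝ) ^ Module.finrank ℝ (Conf M n))⁻¹| = 1 := by
  rw [hc, finrank_conf, inv_pow, inv_inv, abs_of_pos (by positivity), ← Real.rpow_natCast,
    ← Real.rpow_natCast, ← Real.rpow_mul (by positivity), ← Real.rpow_add (by positivity)]
  push_cast
  rw [show -(3 * ((M : ℝ) + n) / 2) * 2 + 3 * (M + n) = 0 by ring, Real.rpow_zero]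

/-- Parseval's identity for the Fourier transform with any unitary normalisation. -/
theorem integral_conj_fourierTransform_mul {V : Type*} [NormedAddCommGroup V]
    [InnerProductSpace ℝ V] [FiniteDimensional ℝ V] [MeasurableSpace V] [BorelSpace V]
    (f g : Lp ℂ 2 (volume : Measure V)) {c r : ℝ}
    (hcr : c ^ 2 * |(r ^ Module.finrank ℝ V)⁻¹| = 1) :
    ∫ k, conj ((c : ℂ) * Lp.fourierTransformₗᵢ V ℂ f (r • k)) *
      ((c : ℂ) * Lp.fourierTransformₗᵢ V ℂ g (r • k)) = inner ℂ f g := by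
  rw [← (Lp.fourierTransformₗᵢ V ℂ).inner_map_map f g]
  generalize Lp.fourierTransformₗᵢ V ℂ f = F
  generalize Lp.fourierTransformₗᵢ V ℂ g = G
  have h1 : ∀ k, conj ((c : ℂ) * F (r • k)) * ((c : ℂ) * G (r • k))
      = (c ^ 2 : ℝ) • (fun k => conj (F k) * G k) (r • k) := by
    intro k
    simp only [map_mul, Complex.conj_ofReal, Complex.real_smul]
    push_cast
    ring
  rw [integral_congr_ae (Filter.Eventually.of_forall h1), integral_smul,
    Measure.integral_comp_smul volume (fun k => conj (F k) * G k), smul_smul, hcr, one_smul,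
    L2.inner_def]
  refine integral_congr_ae (Filter.Eventually.of_forall fun k => ?_)
  exact mul_comm _ _

/-- Plancherel's identity for the Fourier transform with any unitary normalisation. -/
theorem lintegral_fourierTransform_sq {V : Type*} [NormedAddCommGroup V]
    [InnerProductSpace ℝ V] [FiniteDimensional ℝ V] [MeasurableSpace V] [BorelSpace V]
    (f : Lp ℂ 2 (volume : Measure V)) {c r : ℝ} (hr : r ≠ 0)
    (hcr : c ^ 2 * |(r ^ Module.finrank ℝ V)⁻¹| = 1) :
    ∫⁻ k, ‖(c : ℂ) * Lp.fourierTransformₗᵢ V ℂ f (r • k)‖ₑ ^ 2 = ‖f‖ₑ ^ 2 := by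
  have h0 : ‖f‖ₑ = ‖Lp.fourierTransformₗᵢ V ℂ f‖ₑ := by
    rw [← ofReal_norm, ← ofReal_norm, LinearIsometryEquiv.norm_map]
  rw [h0]
  generalize Lp.fourierTransformₗᵢ V ℂ f = F
  have h1 : ∀ k, ‖(c : ℂ) * F (r • k)‖ₑ ^ 2 = ENNReal.ofReal (c ^ 2) *
      (fun k => ‖F k‖ₑ ^ 2) (r • k) := by
    intro k
    simp only [enorm_mul, mul_pow]
    rw [← sq_abs c, ENNReal.ofReal_pow (abs_nonneg c), ← ofReal_norm (c : ℂ), Complex.norm_real,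
      Real.norm_eq_abs]
  have hm : Measurable fun k => ‖F k‖ₑ ^ 2 :=
    (Lp.stronglyMeasurable F).measurable.enorm.pow_const 2
  rw [lintegral_congr h1, lintegral_const_mul _
    (show Measurable fun k : V => (fun k => ‖F k‖ₑ ^ 2) (r • k) from
      hm.comp (measurable_const_smul _)), ← lintegral_map hm (measurable_const_smul _),
    Measure.map_addHaar_smul _ hr, lintegral_smul_measure, smul_eq_mul, ← mul_assoc,
    ← ENNReal.ofReal_mul (by positivity), hcr, ENNReal.ofReal_one, one_mul]
  have h2 := eLpNorm_nnreal_pow_eq_lintegral (f := F) (μ := volume) (p := 2) two_ne_zero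
  simp only [NNReal.coe_ofNat, ENNReal.rpow_ofNat, ENNReal.coe_ofNat] at h2
  rw [← h2, ← Lp.enorm_def]

theorem integral_conj_hat_mul_hat {M n : ℕ} (φ ψ : Sector M n) :
    ∫ k : Conf M n, conj (hat φ k) * hat ψ k = inner ℂ φ ψ := by
  have := integral_conj_fourierTransform_mul (V := Conf M n)
    (φ : Lp ℂ 2 (volume : Measure (Conf M n))) (ψ : Lp ℂ 2 (volume : Measure (Conf M n)))
    (hat_scaling rfl)
  rw [Submodule.coe_inner, ← this]
  unfold hat
  with_reducible rfl

theorem lintegral_hat_sq {M n : ℕ} (ψ : Sector M n) :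
    ∫⁻ k, ‖hat ψ k‖ₑ ^ 2 = ‖ψ‖ₑ ^ 2 := by
  have := lintegral_fourierTransform_sq (V := Conf M n)
    (ψ : Lp ℂ 2 (volume : Measure (Conf M n))) two_pi_inv_ne_zero (hat_scaling rfl)
  have h : ‖ψ‖ₑ = ‖(ψ : Lp ℂ 2 (volume : Measure (Conf M n)))‖ₑ := by
    rw [← ofReal_norm, ← ofReal_norm, Submodule.coe_norm]
  rw [h, ← this]
  unfold hat
  with_reducible rfl

theorem sector_ext {M n : ℕ} {φ ψ : Sector M n} (h : hat φ =ᵐ[volume] hat ψ) : φ = ψ := by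
  rw [← sub_eq_zero, ← enorm_eq_zero, ← pow_eq_zero_iff two_ne_zero, ← lintegral_hat_sq,
    lintegral_eq_zero_iff ((measurable_hat _).enorm.pow_const 2)]
  have h1 : φ - ψ = φ + (-1 : ℂ) • ψ := by rw [neg_one_smul, sub_eq_add_neg]
  rw [h1]
  filter_upwards [hat_add φ ((-1 : ℂ) • ψ), hat_smul (-1) ψ, h] with k h2 h3 h4
  rw [h2, h3, h4, neg_one_mul, add_neg_cancel]
  simp

/-- Every symmetric `L²` function on momentum space is the transform of an element of the sector. -/
theorem exists_hat_eq {M n : ℕ} {f : Conf M n → ℂ} (hf : MemLp f 2 volume)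
    (hs : ∀ σ : Equiv.Perm (Fin n), (fun k => f (permConf M n σ k)) =ᵐ[volume] f) :
    ∃ ψ : Sector M n, hat ψ =ᵐ[volume] f := by
  obtain ⟨c, hc⟩ : ∃ c : ℝ, c = (2 * Real.pi) ^ (-(3 * ((M : ℝ) + n) / 2)) := ⟨_, rfl⟩
  have hc0 : 0 < c := by rw [hc]; positivity
  have h2π : (2 * Real.pi : ℝ) ≠ 0 := by positivity
  set g : Conf M n → ℂ := fun k => (c : ℂ)⁻¹ * f ((2 * Real.pi) • k) with hg
  have hgm : MemLp g 2 volume := by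
    apply MemLp.const_mul
    have h1 : MemLp f 2 (Measure.map (fun k : Conf M n => (2 * Real.pi) • k) volume) := by
      rw [Measure.map_addHaar_smul _ h2π]
      exact hf.smul_measure ENNReal.ofReal_ne_top
    exact h1.comp_of_map (measurable_const_smul _).aemeasurable
  have hgs : hgm.toLp g ∈ Sector M n := by
    intro σ
    have h1 := (measurePreserving_permConf M n σ).quasiMeasurePreserving.ae hgm.coeFn_toLp
    filter_upwards [h1, hgm.coeFn_toLp,
      (quasiMeasurePreserving_const_smul M n h2π).ae (hs σ)] with k h1 h2 h3
    rw [h1, h2]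
    simp only [hg, ← permConf_smul, h3]
  refine ⟨⟨(Lp.fourierTransformₗᵢ (Conf M n) ℂ).symm (hgm.toLp g), ?_⟩, ?_⟩
  · rw [← fourierTransform_mem_sector, LinearIsometryEquiv.apply_symm_apply]
    exact hgs
  · filter_upwards [(quasiMeasurePreserving_const_smul M n two_pi_inv_ne_zero).ae
      hgm.coeFn_toLp] with k hk
    simp only [hat, LinearIsometryEquiv.apply_symm_apply, ← hc]
    rw [hk]
    simp only [hg, smul_smul, mul_inv_cancel₀ h2π, one_smul]
    rw [mul_inv_cancel_left₀ (by exact_mod_cast hc0.ne')]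

/-! ### Operators given by their action on Fourier transforms -/

/-- Two elements of the Hilbert space with the same Fourier transforms are equal. -/
theorem hilb_ext {M : ℕ} {φ ψ : Hilb M} (h : ∀ n, hat (φ n) =ᵐ[volume] hat (ψ n)) : φ = ψ :=
  lp.ext (funext fun n => sector_ext (h n))

theorem tsum_enorm_sq {M : ℕ} (ψ : Hilb M) : ∑' n, ‖ψ n‖ₑ ^ 2 = ‖ψ‖ₑ ^ 2 := by
  have h := lp.norm_rpow_eq_tsum (p := 2) (by simp) ψ
  have hs := lp.hasSum_norm (p := 2) (by simp) ψ
  simp only [ENNReal.toReal_ofNat, Real.rpow_ofNat] at h hs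
  have h1 : ∀ n, ‖ψ n‖ₑ ^ 2 = ENNReal.ofReal (‖ψ n‖ ^ 2) := fun n => by
    rw [ENNReal.ofReal_pow (norm_nonneg _), ofReal_norm]
  simp_rw [h1]
  rw [← ENNReal.ofReal_tsum_of_nonneg (fun n => by positivity) hs.summable, ← h,
    ENNReal.ofReal_pow (norm_nonneg _), ofReal_norm]

theorem tsum_lintegral_hat_sq {M : ℕ} (ψ : Hilb M) :
    ∑' n, ∫⁻ k, ‖hat (ψ n) k‖ₑ ^ 2 = ‖ψ‖ₑ ^ 2 := by
  simp_rw [lintegral_hat_sq]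
  exact tsum_enorm_sq ψ

theorem memLp_two_of_lintegral {α : Type*} [MeasurableSpace α] {μ : Measure α} {f : α → ℂ}
    (hf : AEStronglyMeasurable f μ) (h : ∫⁻ k, ‖f k‖ₑ ^ 2 ∂μ ≠ ∞) : MemLp f 2 μ := by
  refine ⟨hf, ?_⟩
  have h2 := eLpNorm_nnreal_pow_eq_lintegral (f := f) (μ := μ) (p := 2) two_ne_zero
  simp only [NNReal.coe_ofNat, ENNReal.rpow_ofNat, ENNReal.coe_ofNat] at h2
  rw [← h2] at h
  exact lt_top_iff_ne_top.2 fun h3 => h (by rw [h3]; simp)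

/-- A square-summable family of symmetric `L²` functions on momentum space is the family of
Fourier transforms of an element of the Hilbert space. -/
theorem exists_hilb_hat_eq {M : ℕ} (f : (n : ℕ) → Conf M n → ℂ)
    (hm : ∀ n, AEStronglyMeasurable (f n) volume)
    (hs : ∀ n, ∀ σ : Equiv.Perm (Fin n), (fun k => f n (permConf M n σ k)) =ᵐ[volume] f n)
    (hfin : ∑' n, ∫⁻ k, ‖f n k‖ₑ ^ 2 ≠ ∞) :
    ∃ ψ : Hilb M, ∀ n, hat (ψ n) =ᵐ[volume] f n := by
  have h1 : ∀ n, ∃ ψ : Sector M n, hat ψ =ᵐ[volume] f n := fun n =>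
    exists_hat_eq (memLp_two_of_lintegral (hm n) (ENNReal.ne_top_of_tsum_ne_top hfin n)) (hs n)
  choose ψ hψ using h1
  have h2 : ∀ n, ∫⁻ k, ‖f n k‖ₑ ^ 2 = ENNReal.ofReal (‖ψ n‖ ^ 2) := fun n => by
    rw [ENNReal.ofReal_pow (norm_nonneg _), ofReal_norm, ← lintegral_hat_sq]
    refine lintegral_congr_ae ?_
    filter_upwards [hψ n] with k hk
    rw [hk]
  simp_rw [h2] at hfin
  have hmem : Memℓp ψ 2 := by
    rw [memℓp_gen_iff (by simp)]
    simp only [ENNReal.toReal_ofNat, Real.rpow_ofNat]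
    have := ENNReal.summable_toReal hfin
    simpa [ENNReal.toReal_ofReal] using this
  exact ⟨⟨ψ, hmem⟩, hψ⟩

/-- A linear operation on families of momentum space functions that is bounded in `L²` and respects
the symmetry in the bosons defines a bounded operator. -/
theorem exists_operator {M : ℕ} (F : Hilb M → (n : ℕ) → Conf M n → ℂ) (C : ℝ)
    (hm : ∀ ψ n, AEStronglyMeasurable (F ψ n) volume)
    (hs : ∀ ψ n, ∀ σ : Equiv.Perm (Fin n),
      (fun k => F ψ n (permConf M n σ k)) =ᵐ[volume] F ψ n)
    (hadd : ∀ φ ψ n, F (φ + ψ) n =ᵐ[volume] fun k => F φ n k + F ψ n k)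
    (hsmul : ∀ (c : ℂ) ψ n, F (c • ψ) n =ᵐ[volume] fun k => c * F ψ n k)
    (hb : ∀ ψ, ∑' n, ∫⁻ k, ‖F ψ n k‖ₑ ^ 2 ≤ ENNReal.ofReal C * ‖ψ‖ₑ ^ 2) :
    ∃ T : Hilb M →L[ℂ] Hilb M, ∀ ψ n, hat (T ψ n) =ᵐ[volume] F ψ n := by
  have hfin : ∀ ψ, ∑' n, ∫⁻ k, ‖F ψ n k‖ₑ ^ 2 ≠ ∞ := fun ψ =>
    ((hb ψ).trans_lt (ENNReal.mul_lt_top ENNReal.ofReal_lt_top (by simp))).ne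
  choose T hT using fun ψ => exists_hilb_hat_eq (F ψ) (hm ψ) (hs ψ) (hfin ψ)
  have hnorm : ∀ ψ, ‖T ψ‖ ≤ Real.sqrt (max C 0) * ‖ψ‖ := by
    intro ψ
    have h1 : ‖T ψ‖ₑ ^ 2 ≤ ENNReal.ofReal C * ‖ψ‖ₑ ^ 2 := by
      rw [← tsum_lintegral_hat_sq]
      refine le_of_eq_of_le (tsum_congr fun n => lintegral_congr_ae ?_) (hb ψ)
      filter_upwards [hT ψ n] with k hk
      rw [hk]
    rw [← ofReal_norm, ← ofReal_norm, ← ENNReal.ofReal_pow (norm_nonneg _),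
      ← ENNReal.ofReal_pow (norm_nonneg _), ← ENNReal.ofReal_mul' (by positivity)] at h1
    refine le_of_sq_le_sq ?_ (by positivity)
    rw [mul_pow, Real.sq_sqrt (le_max_right _ _)]
    rcases le_total C 0 with hC | hC
    · rw [ENNReal.ofReal_eq_zero.2 (mul_nonpos_of_nonpos_of_nonneg hC (by positivity)),
        nonpos_iff_eq_zero, ENNReal.ofReal_eq_zero] at h1
      exact h1.trans (by positivity)
    · rw [max_eq_left hC]
      exact (ENNReal.ofReal_le_ofReal_iff (by positivity)).1 h1
  let TL : Hilb M →ₗ[ℂ] Hilb M :=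
    { toFun := T
      map_add' := fun φ ψ => hilb_ext fun n => by
        filter_upwards [hT (φ + ψ) n, hT φ n, hT ψ n, hadd φ ψ n,
          hat_add (T φ n) (T ψ n)] with k h1 h2 h3 h4 h5
        rw [h1, h4, ← h2, ← h3, ← h5]
        rfl
      map_smul' := fun c ψ => hilb_ext fun n => by
        filter_upwards [hT (c • ψ) n, hT ψ n, hsmul c ψ n, hat_smul c (T ψ n)] with k h1 h2 h3 h4
        rw [h1, h3, ← h2, ← h4]
        rfl }
  exact ⟨TL.mkContinuous _ hnorm, hT⟩

/-! ### A weighted Schur test -/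

theorem sum_lintegral_mul_sq_le {ι Ω : Type*} [Fintype ι] [MeasurableSpace Ω] {ω : Measure Ω}
    {u v : ι → Ω → ℝ≥0∞} (hu : ∀ i, Measurable (u i)) (hv : ∀ i, Measurable (v i)) :
    (∑ i, ∫⁻ w, u i w * v i w ∂ω) ^ 2 ≤
      (∑ i, ∫⁻ w, u i w ^ 2 ∂ω) * ∑ i, ∫⁻ w, v i w ^ 2 ∂ω := by
  have hp : Real.HolderConjugate 2 2 := Real.HolderConjugate.two_two
  have hsq : ∀ a : ℝ≥0∞, (a ^ (1 / 2 : ℝ)) ^ 2 = a := fun a => by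
    rw [← ENNReal.rpow_natCast, ← ENNReal.rpow_mul]
    norm_num
  have h1 : ∀ i, ∫⁻ w, u i w * v i w ∂ω ≤
      (∫⁻ w, u i w ^ 2 ∂ω) ^ (1 / 2 : ℝ) * (∫⁻ w, v i w ^ 2 ∂ω) ^ (1 / 2 : ℝ) := fun i => by
    have := ENNReal.lintegral_mul_le_Lp_mul_Lq ω hp (hu i).aemeasurable (hv i).aemeasurable
    simpa using this
  have h2 := ENNReal.inner_le_Lp_mul_Lq Finset.univ (fun i => (∫⁻ w, u i w ^ 2 ∂ω) ^ (1 / 2 : ℝ))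
    (fun i => (∫⁻ w, v i w ^ 2 ∂ω) ^ (1 / 2 : ℝ)) hp
  simp only [ENNReal.rpow_ofNat, hsq] at h2
  calc (∑ i, ∫⁻ w, u i w * v i w ∂ω) ^ 2
      ≤ ((∑ i, ∫⁻ w, u i w ^ 2 ∂ω) ^ (1 / 2 : ℝ) *
          (∑ i, ∫⁻ w, v i w ^ 2 ∂ω) ^ (1 / 2 : ℝ)) ^ 2 := by
        gcongr
        exact (Finset.sum_le_sum fun i _ => h1 i).trans h2
    _ = _ := by rw [mul_pow, hsq, hsq]

/-- A weighted Schur test for sums of integral operators whose kernels live on the graphs of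
measure preserving maps `Φ i`: the kernel `q i` is split into a factor `g i` controlled by the
target variables and a factor `r i` controlled by the source variables. -/
theorem lintegral_sum_lintegral_sq_le {ι X Ω X' Ω' : Type*} [Fintype ι] [MeasurableSpace X]
    [MeasurableSpace Ω] [MeasurableSpace X'] [MeasurableSpace Ω'] {μ : Measure X} {ω : Measure Ω}
    {μ' : Measure X'} {ω' : Measure Ω'} [SFinite μ] [SFinite ω] [SFinite μ'] [SFinite ω']
    {Φ : ι → X × Ω → X' × Ω'} (hΦ : ∀ i, MeasurePreserving (Φ i) (μ.prod ω) (μ'.prod ω'))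
    {F : X' → ℝ≥0∞} (hF : Measurable F) {q r : ι → X × Ω → ℝ≥0∞} {g : ι → X' × Ω' → ℝ≥0∞}
    (hg : ∀ i, Measurable (g i)) (hr : ∀ i, Measurable (r i))
    (hq : ∀ i z, q i z ≤ g i (Φ i z) * r i z) {C : ℝ≥0∞} {W : X' → ℝ≥0∞}
    (hrC : ∀ x, ∑ i, ∫⁻ w, r i (x, w) ^ 2 ∂ω ≤ C)
    (hgW : ∀ x', ∑ i, ∫⁻ w', g i (x', w') ^ 2 ∂ω' ≤ W x') :
    ∫⁻ x, (∑ i, ∫⁻ w, F (Φ i (x, w)).1 * q i (x, w) ∂ω) ^ 2 ∂μ ≤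
      C * ∫⁻ x', F x' ^ 2 * W x' ∂μ' := by
  have hG : ∀ i, Measurable fun z : X' × Ω' => (F z.1 * g i z) ^ 2 := fun i =>
    ((hF.comp measurable_fst).mul (hg i)).pow_const 2
  have hu : ∀ i, Measurable fun z => F (Φ i z).1 * g i (Φ i z) := fun i =>
    ((hF.comp measurable_fst).mul (hg i)).comp (hΦ i).measurable
  have h1 : ∀ x, (∑ i, ∫⁻ w, F (Φ i (x, w)).1 * q i (x, w) ∂ω) ^ 2 ≤
      (∑ i, ∫⁻ w, (F (Φ i (x, w)).1 * g i (Φ i (x, w))) ^ 2 ∂ω) * C := by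
    intro x
    calc (∑ i, ∫⁻ w, F (Φ i (x, w)).1 * q i (x, w) ∂ω) ^ 2
        ≤ (∑ i, ∫⁻ w, (F (Φ i (x, w)).1 * g i (Φ i (x, w))) * r i (x, w) ∂ω) ^ 2 := by
          refine pow_le_pow_left₀ (by positivity) (Finset.sum_le_sum fun i _ =>
            lintegral_mono fun w => ?_) 2
          rw [mul_assoc]
          exact mul_le_mul_right (hq i (x, w)) _
      _ ≤ (∑ i, ∫⁻ w, (F (Φ i (x, w)).1 * g i (Φ i (x, w))) ^ 2 ∂ω) *
            ∑ i, ∫⁻ w, r i (x, w) ^ 2 ∂ω :=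
          sum_lintegral_mul_sq_le (fun i => (hu i).comp measurable_prodMk_left)
            (fun i => (hr i).comp measurable_prodMk_left)
      _ ≤ _ := by gcongr; exact hrC x
  have hm : ∀ i, Measurable fun x => ∫⁻ w, (F (Φ i (x, w)).1 * g i (Φ i (x, w))) ^ 2 ∂ω :=
    fun i => ((hu i).pow_const 2).lintegral_prod_right'
  calc ∫⁻ x, (∑ i, ∫⁻ w, F (Φ i (x, w)).1 * q i (x, w) ∂ω) ^ 2 ∂μ
      ≤ ∫⁻ x, (∑ i, ∫⁻ w, (F (Φ i (x, w)).1 * g i (Φ i (x, w))) ^ 2 ∂ω) * C ∂μ :=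
        lintegral_mono h1
    _ = C * ∑ i, ∫⁻ x, ∫⁻ w, (F (Φ i (x, w)).1 * g i (Φ i (x, w))) ^ 2 ∂ω ∂μ := by
        rw [lintegral_mul_const _ (Finset.measurable_sum _ fun i _ => hm i), mul_comm,
          lintegral_finsetSum _ fun i _ => hm i]
    _ = C * ∑ i, ∫⁻ x', ∫⁻ w', (F x' * g i (x', w')) ^ 2 ∂ω' ∂μ' := by
        congr 1
        refine Finset.sum_congr rfl fun i _ => ?_
        rw [← lintegral_prod _ ((hu i).pow_const 2).aemeasurable,
          ← lintegral_prod _ (hG i).aemeasurable, ← (hΦ i).lintegral_comp (hG i)]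
    _ = C * ∫⁻ x', F x' ^ 2 * ∑ i, ∫⁻ w', g i (x', w') ^ 2 ∂ω' ∂μ' := by
        rw [← lintegral_finsetSum _ fun i _ => (hG i).lintegral_prod_right']
        congr 1
        refine lintegral_congr fun x' => ?_
        rw [Finset.mul_sum]
        refine Finset.sum_congr rfl fun i _ => ?_
        simp_rw [mul_pow]
        exact lintegral_const_mul _ (((hg i).comp measurable_prodMk_left).pow_const 2)
    _ ≤ _ := by
        gcongr with x'
        exact hgW x'

/-! ### Measure preserving changes of momentum variables -/

theorem measurePreserving_of_norm_sq_prod {U V W : Type*}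
    [NormedAddCommGroup U] [InnerProductSpace ℝ U] [FiniteDimensional ℝ U] [MeasurableSpace U]
    [BorelSpace U] [NormedAddCommGroup V] [InnerProductSpace ℝ V] [FiniteDimensional ℝ V]
    [MeasurableSpace V] [BorelSpace V] [NormedAddCommGroup W] [InnerProductSpace ℝ W]
    [FiniteDimensional ℝ W] [MeasurableSpace W] [BorelSpace W] (f : U →ₗ[ℝ] V × W)
    (hd : Module.finrank ℝ U = Module.finrank ℝ V + Module.finrank ℝ W)
    (hf : ∀ u, ‖(f u).1‖ ^ 2 + ‖(f u).2‖ ^ 2 = ‖u‖ ^ 2) :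
    MeasurePreserving f volume (volume.prod volume) := by
  let g : U →ₗᵢ[ℝ] WithLp 2 (V × W) :=
    { toLinearMap := (WithLp.linearEquiv 2 ℝ (V × W)).symm.toLinearMap ∘ₗ f
      norm_map' := fun u => by
        rw [← sq_eq_sq₀ (norm_nonneg _) (norm_nonneg _), WithLp.prod_norm_sq_eq_of_L2]
        exact hf u }
  have hd' : Module.finrank ℝ U = Module.finrank ℝ (WithLp 2 (V × W)) := by
    rw [hd, (WithLp.linearEquiv 2 ℝ (V × W)).finrank_eq, Module.finrank_prod]
  have h1 := (g.toLinearIsometryEquiv hd').measurePreserving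
  exact (WithLp.volume_preserving_ofLp V W).comp h1

theorem norm_sq_conf {M n : ℕ} (k : Conf M n) :
    ‖k‖ ^ 2 = ∑ μ, ‖k (Sum.inl μ)‖ ^ 2 + ∑ i, ‖k (Sum.inr i)‖ ^ 2 := by
  rw [PiLp.norm_sq_eq_of_L2, Fintype.sum_sum_type]

@[simp] theorem remove_inl {M n : ℕ} (i : Fin (n + 1)) (k : Conf M (n + 1)) (μ : Fin M) :
    remove i k (Sum.inl μ) = k (Sum.inl μ) := rfl

@[simp] theorem remove_inr {M n : ℕ} (i : Fin (n + 1)) (k : Conf M (n + 1)) (j : Fin n) :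
    remove i k (Sum.inr j) = k (Sum.inr (i.succAbove j)) := rfl

@[simp] theorem shift_inl {M n : ℕ} (μ : Fin M) (q : R3) (k : Conf M n) (ν : Fin M) :
    shift μ q k (Sum.inl ν) = if ν = μ then k (Sum.inl μ) + q else k (Sum.inl ν) := by
  simp [shift, Function.update_apply]

@[simp] theorem shift_inr {M n : ℕ} (μ : Fin M) (q : R3) (k : Conf M n) (i : Fin n) :
    shift μ q k (Sum.inr i) = k (Sum.inr i) := by
  simp [shift]

@[simp] theorem replace_inl {M n : ℕ} (i : Fin n) (q : R3) (k : Conf M n) (ν : Fin M) :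
    replace i q k (Sum.inl ν) = k (Sum.inl ν) := by
  simp [replace]

@[simp] theorem replace_inr {M n : ℕ} (i : Fin n) (q : R3) (k : Conf M n) (j : Fin n) :
    replace i q k (Sum.inr j) = if j = i then q else k (Sum.inr j) := by
  simp [replace, Function.update_apply]

theorem conf_ext {M n : ℕ} {k l : Conf M n} (h1 : ∀ μ, k (Sum.inl μ) = l (Sum.inl μ))
    (h2 : ∀ i, k (Sum.inr i) = l (Sum.inr i)) : k = l := by
  refine PiLp.ext fun a => ?_
  rcases a with a | a
  · exact h1 a
  · exact h2 a

theorem shift_eq_add {M n : ℕ} (μ : Fin M) (q : R3) (k : Conf M n) :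
    shift μ q k = k + shift μ q 0 := by
  refine conf_ext (fun ν => ?_) fun i => ?_
  · by_cases h : ν = μ <;> simp [h]
  · simp

theorem continuous_conf {M n : ℕ} {X : Type*} [TopologicalSpace X] {f : X → Conf M n}
    (h1 : ∀ μ, Continuous fun x => f x (Sum.inl μ))
    (h2 : ∀ i, Continuous fun x => f x (Sum.inr i)) : Continuous f := by
  have h : Continuous fun x => (f x).ofLp := by
    refine continuous_pi fun a => ?_
    rcases a with a | a
    · exact h1 a
    · exact h2 a
  exact (PiLp.continuous_toLp 2 _).comp h

theorem continuous_shift {M n : ℕ} (μ : Fin M) :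
    Continuous fun z : R3 × Conf M n => shift μ z.1 z.2 := by
  refine continuous_conf (fun ν => ?_) fun i => ?_
  · simp only [shift_inl]
    split_ifs <;> fun_prop
  · simp only [shift_inr]
    fun_prop

theorem measurePreserving_shear {M n : ℕ} (μ : Fin M) (c : ℝ) :
    MeasurePreserving (fun z : Conf M n × R3 => (shift μ (c • z.2) z.1, z.2))
      (volume.prod volume) (volume.prod volume) := by
  have h1 : MeasurePreserving (fun z : R3 × Conf M n => (z.1, shift μ (c • z.1) z.2))
      (volume.prod volume) (volume.prod volume) := by
    refine (MeasurePreserving.id _).skew_product (g := fun ξ k => shift μ (c • ξ) k) ?_ ?_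
    · exact ((continuous_shift μ).comp (by fun_prop :
        Continuous fun z : R3 × Conf M n => (c • z.1, z.2))).measurable
    · refine Filter.Eventually.of_forall fun ξ => ?_
      rw [show shift μ (c • ξ) = fun k : Conf M n => k + shift μ (c • ξ) 0 from
        funext fun k => shift_eq_add μ _ k]
      exact (measurePreserving_add_right volume _).map_eq
  exact (Measure.measurePreserving_swap.comp h1).comp Measure.measurePreserving_swap

theorem measurePreserving_remove {M n : ℕ} (i : Fin (n + 1)) :
    MeasurePreserving (fun k : Conf M (n + 1) => (remove i k, k (Sum.inr i)))
      volume (volume.prod volume) := by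
  let f : Conf M (n + 1) →ₗ[ℝ] Conf M n × R3 :=
    { toFun := fun k => (remove i k, k (Sum.inr i))
      map_add' := fun _ _ => rfl
      map_smul' := fun _ _ => rfl }
  refine measurePreserving_of_norm_sq_prod f ?_ fun k => ?_
  · rw [finrank_conf, finrank_conf, finrank_euclideanSpace, Fintype.card_fin]
    ring
  · change ‖remove i k‖ ^ 2 + ‖k (Sum.inr i)‖ ^ 2 = _
    rw [norm_sq_conf, norm_sq_conf, Fin.sum_univ_succAbove _ i]
    simp only [remove_inl, remove_inr]
    ring

theorem measurePreserving_exchange {M n : ℕ} (i : Fin n) :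
    MeasurePreserving (fun z : Conf M n × R3 => (replace i z.2 z.1, z.1 (Sum.inr i)))
      (volume.prod volume) (volume.prod volume) := by
  let f : WithLp 2 (Conf M n × R3) →ₗ[ℝ] Conf M n × R3 :=
    { toFun := fun z => (replace i z.snd z.fst, z.fst (Sum.inr i))
      map_add' := fun x y => by
        refine Prod.ext (conf_ext (fun ν => ?_) fun j => ?_) ?_
        · simp
        · by_cases h : j = i <;> simp [h]
        · simp
      map_smul' := fun c x => by
        refine Prod.ext (conf_ext (fun ν => ?_) fun j => ?_) ?_
        · simp
        · by_cases h : j = i <;> simp [h]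
        · simp }
  have hf : MeasurePreserving f volume (volume.prod volume) := by
    refine measurePreserving_of_norm_sq_prod f ?_ fun z => ?_
    · rw [(WithLp.linearEquiv 2 ℝ (Conf M n × R3)).finrank_eq, Module.finrank_prod]
    · change ‖replace i z.snd z.fst‖ ^ 2 + ‖z.fst (Sum.inr i)‖ ^ 2 = _
      rw [WithLp.prod_norm_sq_eq_of_L2, norm_sq_conf, norm_sq_conf,
        ← Finset.add_sum_erase _ _ (Finset.mem_univ i),
        ← Finset.add_sum_erase _ (fun j => ‖z.fst (Sum.inr j)‖ ^ 2) (Finset.mem_univ i)]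
      have h1 : ∑ j ∈ Finset.univ.erase i, ‖replace i z.snd z.fst (Sum.inr j)‖ ^ 2
          = ∑ j ∈ Finset.univ.erase i, ‖z.fst (Sum.inr j)‖ ^ 2 :=
        Finset.sum_congr rfl fun j hj => by simp [Finset.ne_of_mem_erase hj]
      rw [h1]
      simp only [replace_inl, replace_inr, if_true]
      ring
  exact hf.comp (WithLp.volume_preserving_toLp (Conf M n) R3)

/-- The change of variables in the first part of `offDiag`. -/
theorem measurePreserving_bosonExchange {M n : ℕ} (μ ν : Fin M) (i : Fin n) :
    MeasurePreserving (fun z : Conf M n × R3 =>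
        (replace i z.2 (shift ν (z.1 (Sum.inr i)) (shift μ (-z.2) z.1)), z.1 (Sum.inr i)))
      (volume.prod volume) (volume.prod volume) := by
  have h := (measurePreserving_shear (M := M) (n := n) ν 1).comp
    ((measurePreserving_exchange i).comp (measurePreserving_shear μ (-1)))
  convert h using 1
  funext z
  refine Prod.ext (conf_ext (fun κ => ?_) fun j => ?_) ?_
  · by_cases h : κ = ν <;> simp [h]
  · simp
  · simp

/-- The change of variables in the second part of `offDiag`. -/
theorem measurePreserving_particleExchange {M n : ℕ} (μ ν : Fin M) :
    MeasurePreserving (fun z : Conf M n × R3 => (shift ν z.2 (shift μ (-z.2) z.1), z.2))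
      (volume.prod volume) (volume.prod volume) := by
  have h := (measurePreserving_shear (M := M) (n := n) ν 1).comp (measurePreserving_shear μ (-1))
  convert h using 1
  funext z
  simp

/-- The change of variables in the creation operator. -/
theorem measurePreserving_creation {M n : ℕ} (μ : Fin M) (i : Fin (n + 1)) :
    MeasurePreserving (fun k : Conf M (n + 1) =>
      (shift μ (k (Sum.inr i)) (remove i k), k (Sum.inr i))) volume (volume.prod volume) := by
  have h := (measurePreserving_shear (M := M) (n := n) μ 1).comp (measurePreserving_remove i)
  convert h using 1
  funext z
  simp

/-! ### The off-diagonal operator -/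

/-- The symbol of `L + 1`. -/
noncomputable def energy {M n : ℕ} (m : ℝ) (k : Conf M n) : ℝ := freeSymbol m k + 1

theorem freeSymbol_nonneg {M n : ℕ} {m : ℝ} (hm : 0 < m) (k : Conf M n) : 0 ≤ freeSymbol m k := by
  unfold freeSymbol; positivity

theorem one_le_energy {M n : ℕ} {m : ℝ} (hm : 0 < m) (k : Conf M n) : 1 ≤ energy m k := by
  have := freeSymbol_nonneg hm k
  unfold energy; linarith

theorem energy_pos {M n : ℕ} {m : ℝ} (hm : 0 < m) (k : Conf M n) : 0 < energy m k :=
  one_pos.trans_le (one_le_energy hm k)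

theorem boson_le_energy {M n : ℕ} {m : ℝ} (hm : 0 < m) (k : Conf M n) :
    1 + n + ∑ i, ‖k (Sum.inr i)‖ ^ 2 ≤ energy m k := by
  have : 0 ≤ (1 / (2 * m)) * ∑ μ, ‖k (Sum.inl μ)‖ ^ 2 := by positivity
  unfold energy freeSymbol; linarith

theorem single_boson_le {M n : ℕ} (k : Conf M n) (i : Fin n) :
    ‖k (Sum.inr i)‖ ^ 2 ≤ ∑ i, ‖k (Sum.inr i)‖ ^ 2 :=
  Finset.single_le_sum (f := fun i => ‖k (Sum.inr i)‖ ^ 2) (fun _ _ => by positivity)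
    (Finset.mem_univ i)

theorem single_particle_le_energy {M n : ℕ} {m : ℝ} (hm : 0 < m) (k : Conf M n) (μ : Fin M) :
    1 + 1 / (2 * m) * ‖k (Sum.inl μ)‖ ^ 2 ≤ energy m k := by
  have h1 : ‖k (Sum.inl μ)‖ ^ 2 ≤ ∑ μ, ‖k (Sum.inl μ)‖ ^ 2 :=
    Finset.single_le_sum (f := fun i => ‖k (Sum.inl i)‖ ^ 2) (fun _ _ => by positivity)
      (Finset.mem_univ μ)
  have h2 : 1 / (2 * m) * ‖k (Sum.inl μ)‖ ^ 2 ≤ 1 / (2 * m) * ∑ μ, ‖k (Sum.inl μ)‖ ^ 2 := by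
    gcongr
  have h3 : (0 : ℝ) ≤ ∑ i, ‖k (Sum.inr i)‖ ^ 2 + n := by positivity
  unfold energy freeSymbol; linarith

theorem continuous_freeSymbol {M n : ℕ} (m : ℝ) :
    Continuous fun k : Conf M n => freeSymbol m k := by
  unfold freeSymbol; fun_prop

theorem measurable_energy {M n : ℕ} (m : ℝ) : Measurable fun k : Conf M n => energy m k :=
  ((continuous_freeSymbol m).add continuous_const).measurable

theorem energy_perm {M n : ℕ} (m : ℝ) (σ : Equiv.Perm (Fin n)) (k : Conf M n) :
    energy m (permConf M n σ k) = energy m k := by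
  unfold energy freeSymbol
  simp only [permConf_inl, permConf_inr]
  rw [Equiv.sum_comp σ fun i => ‖k (Sum.inr i)‖ ^ 2]

theorem offDiagDenom_eq {M n : ℕ} (m : ℝ) (μ : Fin M) (ξ : R3) (k : Conf M n) :
    offDiagDenom m μ ξ k = energy m (shift μ (-ξ) k) + ‖ξ‖ ^ 2 := by
  unfold offDiagDenom energy; ring

theorem continuous_offDiagDenom {M n : ℕ} (m : ℝ) (μ : Fin M) :
    Continuous fun z : Conf M n × R3 => offDiagDenom m μ z.2 z.1 := by
  have h : Continuous fun z : Conf M n × R3 => shift μ (-z.2) z.1 :=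
    (continuous_shift μ).comp (by fun_prop : Continuous fun z : Conf M n × R3 => (-z.2, z.1))
  have := (continuous_freeSymbol m).comp h
  simp only [Function.comp_def] at this
  unfold offDiagDenom; fun_prop

theorem boson_le_offDiagDenom {M n : ℕ} {m : ℝ} (hm : 0 < m) (μ : Fin M) (ξ : R3)
    (k : Conf M n) :
    1 + n + ∑ i, ‖k (Sum.inr i)‖ ^ 2 + ‖ξ‖ ^ 2 ≤ offDiagDenom m μ ξ k := by
  have := boson_le_energy hm (shift μ (-ξ) k)
  simp only [shift_inr] at this
  rw [offDiagDenom_eq]; linarith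

theorem offDiagDenom_pos {M n : ℕ} {m : ℝ} (hm : 0 < m) (μ : Fin M) (ξ : R3) (k : Conf M n) :
    0 < offDiagDenom m μ ξ k :=
  lt_of_lt_of_le (by positivity) (boson_le_offDiagDenom hm μ ξ k)

/-- The integral of `(1 + ξ²)^{-7/4}` over `ℝ³`. Convergence needs an exponent above `3/2`; the
exponent `7/4` is the largest for which the Schur test gives a bound by `(L + 1)^{3/4}`. -/
noncomputable def japaneseIntegral : ℝ≥0∞ :=
  ∫⁻ ξ : R3, ENNReal.ofReal ((1 + ‖ξ‖ ^ 2) ^ (-(7 / 4) : ℝ))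

theorem japaneseIntegral_ne_top : japaneseIntegral ≠ ∞ := by
  have h : Integrable (fun ξ : R3 => (1 + ‖ξ‖ ^ 2) ^ (-(7 / 2 : ℝ) / 2)) :=
    integrable_rpow_neg_one_add_norm_sq (by simp; norm_num)
  have h2 := h.lintegral_lt_top
  rw [show -(7 / 2 : ℝ) / 2 = -(7 / 4) by norm_num] at h2
  exact h2.ne

theorem ofReal_rpow_sq {a b : ℝ} (ha : 0 ≤ a) (s : ℝ) (hb : b = 2 * s) :
    ENNReal.ofReal (a ^ s) ^ 2 = ENNReal.ofReal (a ^ b) := by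
  rw [← ENNReal.ofReal_pow (by positivity), ← Real.rpow_natCast, ← Real.rpow_mul ha, hb, mul_comm]
  norm_num

/-- The splitting of the kernel `1 / d` of the boson exchange for the Schur test. Here `a` and `b`
stand for `1 + ξ²` and `1 + k_i²`, `D` for the energy of the bosons before the exchange, and `E`
for the energy after it. -/
theorem bosonKernel_le {a b D E d : ℝ} (ha : 1 ≤ a) (hb : 1 ≤ b) (hD : 1 ≤ D) (hE : a ≤ E)
    (hda : a ≤ d) (hdb : b ≤ d) (hdD : D ≤ d) :
    1 / d ≤ (E ^ (1 / 4 : ℝ) * a ^ (1 / 2 : ℝ) * b ^ (-(7 / 8) : ℝ)) *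
      ((b / D) ^ (1 / 2 : ℝ) * a ^ (-(7 / 8) : ℝ)) := by
  have ha0 : 0 < a := by linarith
  have hb0 : 0 < b := by linarith
  have hD0 : 0 < D := by linarith
  have hd0 : 0 < d := by linarith
  have h1 : d ^ (-(1 / 8) : ℝ) ≤ a ^ (-(1 / 8) : ℝ) :=
    Real.rpow_le_rpow_of_nonpos ha0 hda (by norm_num)
  have h2 : d ^ (-(3 / 8) : ℝ) ≤ b ^ (-(3 / 8) : ℝ) :=
    Real.rpow_le_rpow_of_nonpos hb0 hdb (by norm_num)
  have h3 : d ^ (-(1 / 2) : ℝ) ≤ D ^ (-(1 / 2) : ℝ) :=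
    Real.rpow_le_rpow_of_nonpos hD0 hdD (by norm_num)
  have h4 : a ^ (1 / 4 : ℝ) ≤ E ^ (1 / 4 : ℝ) := Real.rpow_le_rpow ha0.le hE (by norm_num)
  calc 1 / d = d ^ (-(1 / 8) : ℝ) * d ^ (-(3 / 8) : ℝ) * d ^ (-(1 / 2) : ℝ) := by
        rw [← Real.rpow_add hd0, ← Real.rpow_add hd0, one_div, ← Real.rpow_neg_one]
        norm_num
    _ ≤ a ^ (-(1 / 8) : ℝ) * b ^ (-(3 / 8) : ℝ) * D ^ (-(1 / 2) : ℝ) := by gcongr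
    _ = (a ^ (1 / 4 : ℝ) * a ^ (1 / 2 : ℝ) * b ^ (-(7 / 8) : ℝ)) *
          ((b / D) ^ (1 / 2 : ℝ) * a ^ (-(7 / 8) : ℝ)) := by
        rw [Real.div_rpow hb0.le hD0.le, Real.rpow_neg hD0.le,
          show (-(1 / 8) : ℝ) = 1 / 4 + 1 / 2 + -(7 / 8) by norm_num, Real.rpow_add ha0,
          Real.rpow_add ha0, show (-(3 / 8) : ℝ) = -(7 / 8) + 1 / 2 by norm_num,
          Real.rpow_add hb0]
        ring
    _ ≤ _ := by gcongr

/-- The splitting of the kernel `1 / d` of the particle exchange for the Schur test. Here `a` and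
`b` stand for `1 + (p_ν + ξ)²` and `1 + ξ²`, and `E` for the energy after the exchange. -/
theorem particleKernel_le {a b c E d : ℝ} (ha : 1 ≤ a) (hb : 1 ≤ b) (hc : 0 < c)
    (hE : c * a ≤ E) (hda : c * a ≤ d) (hdb : b ≤ d) :
    1 / d ≤ (E ^ (3 / 4 : ℝ) * b ^ (-(7 / 8) : ℝ)) *
      (c ^ (-(7 / 8) : ℝ) * a ^ (-(7 / 8) : ℝ)) := by
  have ha0 : 0 < a := by linarith
  have hb0 : 0 < b := by linarith
  have hd0 : 0 < d := by linarith
  have hca : 0 < c * a := by positivity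
  have h1 : d ^ (-(1 / 8) : ℝ) ≤ (c * a) ^ (-(1 / 8) : ℝ) :=
    Real.rpow_le_rpow_of_nonpos hca hda (by norm_num)
  have h2 : d ^ (-(7 / 8) : ℝ) ≤ b ^ (-(7 / 8) : ℝ) :=
    Real.rpow_le_rpow_of_nonpos hb0 hdb (by norm_num)
  have h4 : (c * a) ^ (3 / 4 : ℝ) ≤ E ^ (3 / 4 : ℝ) := Real.rpow_le_rpow hca.le hE (by norm_num)
  calc 1 / d = d ^ (-(1 / 8) : ℝ) * d ^ (-(7 / 8) : ℝ) := by
        rw [← Real.rpow_add hd0, one_div, ← Real.rpow_neg_one]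
        norm_num
    _ ≤ (c * a) ^ (-(1 / 8) : ℝ) * b ^ (-(7 / 8) : ℝ) := by gcongr
    _ = ((c * a) ^ (3 / 4 : ℝ) * b ^ (-(7 / 8) : ℝ)) *
          (c ^ (-(7 / 8) : ℝ) * a ^ (-(7 / 8) : ℝ)) := by
        rw [← Real.mul_rpow hc.le ha0.le, show (-(1 / 8) : ℝ) = 3 / 4 + -(7 / 8) by norm_num,
          Real.rpow_add hca]
        ring
    _ ≤ _ := by gcongr

/-- The boson exchange part of `offDiag` with absolute values inside, for a fixed pair of
particles. The weights `1 + k_i²` make the sum over the bosons bounded uniformly in `n`, because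
their sum is at most the energy. -/
theorem lintegral_bosonExchange_sq_le {M n : ℕ} {m : ℝ} (hm : 0 < m) (μ ν : Fin M)
    {f : Conf M n → ℂ} (hf : Measurable f) :
    ∫⁻ k, (∑ i : Fin n, ∫⁻ ξ : R3,
        ‖f (replace i ξ (shift ν (k (Sum.inr i)) (shift μ (-ξ) k)))‖ₑ *
          ENNReal.ofReal (1 / offDiagDenom m μ ξ k)) ^ 2 ≤
      japaneseIntegral * ∫⁻ k, ‖f k‖ₑ ^ 2 *
        (japaneseIntegral * ENNReal.ofReal (energy m k ^ (3 / 2 : ℝ))) := by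
  have hmi : ∀ i : Fin n, Measurable fun z : Conf M n × R3 => 1 + ‖z.1 (Sum.inr i)‖ ^ 2 :=
    fun i => (by fun_prop : Continuous fun z : Conf M n × R3 =>
      1 + ‖z.1 (Sum.inr i)‖ ^ 2).measurable
  have hm2 : Measurable fun z : Conf M n × R3 => 1 + ‖z.2‖ ^ 2 := by fun_prop
  have hmD : Measurable fun z : Conf M n × R3 => 1 + n + ∑ i, ‖z.1 (Sum.inr i)‖ ^ 2 :=
    (by fun_prop : Continuous fun z : Conf M n × R3 =>
      1 + (n : ℝ) + ∑ i, ‖z.1 (Sum.inr i)‖ ^ 2).measurable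
  have hmE : Measurable fun z : Conf M n × R3 => energy m z.1 :=
    (measurable_energy m).comp measurable_fst
  have hsum : ∀ k : Conf M n, ∑ i : Fin n, (1 + ‖k (Sum.inr i)‖ ^ 2)
      = n + ∑ i, ‖k (Sum.inr i)‖ ^ 2 := fun k => by simp [Finset.sum_add_distrib]
  refine lintegral_sum_lintegral_sq_le (fun i => measurePreserving_bosonExchange μ ν i)
    (F := fun k => ‖f k‖ₑ) hf.enorm
    (q := fun _ z => ENNReal.ofReal (1 / offDiagDenom m μ z.2 z.1))
    (g := fun i z => ENNReal.ofReal (energy m z.1 ^ (1 / 4 : ℝ) *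
      (1 + ‖z.1 (Sum.inr i)‖ ^ 2) ^ (1 / 2 : ℝ) * (1 + ‖z.2‖ ^ 2) ^ (-(7 / 8) : ℝ)))
    (r := fun i z => ENNReal.ofReal (((1 + ‖z.1 (Sum.inr i)‖ ^ 2) /
      (1 + n + ∑ i, ‖z.1 (Sum.inr i)‖ ^ 2)) ^ (1 / 2 : ℝ) * (1 + ‖z.2‖ ^ 2) ^ (-(7 / 8) : ℝ)))
    (fun i => by have := hmi i; fun_prop) (fun i => by have := hmi i; fun_prop) ?_ ?_ ?_
  · rintro i ⟨k, ξ⟩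
    have hE0 := energy_pos hm (replace i ξ (shift ν (k (Sum.inr i)) (shift μ (-ξ) k)))
    dsimp only
    rw [← ENNReal.ofReal_mul (by positivity)]
    refine ENNReal.ofReal_le_ofReal ?_
    have hd := boson_le_offDiagDenom hm μ ξ k
    have hi := single_boson_le k i
    have h0 : (0 : ℝ) ≤ ∑ i, ‖k (Sum.inr i)‖ ^ 2 := by positivity
    have hn : (0 : ℝ) ≤ n := by positivity
    have hE := boson_le_energy hm (replace i ξ (shift ν (k (Sum.inr i)) (shift μ (-ξ) k)))
    have hEi := single_boson_le (replace i ξ (shift ν (k (Sum.inr i)) (shift μ (-ξ) k))) i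
    rw [replace_inr, if_pos rfl] at hEi
    simp only [replace_inr, if_true]
    refine bosonKernel_le ?_ ?_ ?_ ?_ ?_ ?_ ?_ <;>
      nlinarith [sq_nonneg ‖ξ‖, sq_nonneg ‖k (Sum.inr i)‖]
  · intro k
    have hD : 0 < 1 + (n : ℝ) + ∑ i, ‖k (Sum.inr i)‖ ^ 2 := by positivity
    have h1 : ∀ i : Fin n, ∫⁻ ξ : R3, ENNReal.ofReal (((1 + ‖k (Sum.inr i)‖ ^ 2) /
        (1 + n + ∑ i, ‖k (Sum.inr i)‖ ^ 2)) ^ (1 / 2 : ℝ) *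
          (1 + ‖ξ‖ ^ 2) ^ (-(7 / 8) : ℝ)) ^ 2 =
        ENNReal.ofReal ((1 + ‖k (Sum.inr i)‖ ^ 2) / (1 + n + ∑ i, ‖k (Sum.inr i)‖ ^ 2)) *
          japaneseIntegral := by
      intro i
      rw [japaneseIntegral, ← lintegral_const_mul _ (by fun_prop)]
      refine lintegral_congr fun ξ => ?_
      rw [ENNReal.ofReal_mul (by positivity), mul_pow,
        ofReal_rpow_sq (b := 1) (by positivity) _ (by norm_num),
        ofReal_rpow_sq (b := -(7 / 4)) (by positivity) _ (by norm_num), Real.rpow_one]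
    simp only [h1]
    rw [← Finset.sum_mul, ← ENNReal.ofReal_sum_of_nonneg (fun i _ => by positivity),
      ← Finset.sum_div, hsum]
    refine mul_le_of_le_one_left (by positivity) ?_
    rw [← ENNReal.ofReal_one]
    refine ENNReal.ofReal_le_ofReal ?_
    rw [div_le_one hD]
    linarith
  · intro k
    have hE0 := energy_pos hm k
    have h1 : ∀ i : Fin n, ∫⁻ ξ : R3, ENNReal.ofReal (energy m k ^ (1 / 4 : ℝ) *
        (1 + ‖k (Sum.inr i)‖ ^ 2) ^ (1 / 2 : ℝ) * (1 + ‖ξ‖ ^ 2) ^ (-(7 / 8) : ℝ)) ^ 2 =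
        ENNReal.ofReal (energy m k ^ (1 / 2 : ℝ)) * ENNReal.ofReal (1 + ‖k (Sum.inr i)‖ ^ 2) *
          japaneseIntegral := by
      intro i
      rw [japaneseIntegral, ← lintegral_const_mul _ (by fun_prop)]
      refine lintegral_congr fun ξ => ?_
      rw [ENNReal.ofReal_mul (by positivity), ENNReal.ofReal_mul (by positivity), mul_pow, mul_pow,
        ofReal_rpow_sq (b := 1 / 2) hE0.le _ (by norm_num),
        ofReal_rpow_sq (b := 1) (by positivity) _ (by norm_num),
        ofReal_rpow_sq (b := -(7 / 4)) (by positivity) _ (by norm_num), Real.rpow_one]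
    simp only [h1]
    rw [← Finset.sum_mul, ← Finset.mul_sum,
      ← ENNReal.ofReal_sum_of_nonneg (fun i _ => by positivity), hsum,
      ← ENNReal.ofReal_mul (by positivity), mul_comm]
    gcongr
    have h2 := boson_le_energy hm k
    calc energy m k ^ (1 / 2 : ℝ) * (n + ∑ i, ‖k (Sum.inr i)‖ ^ 2)
        ≤ energy m k ^ (1 / 2 : ℝ) * energy m k ^ (1 : ℝ) := by
          rw [Real.rpow_one]
          gcongr
          linarith
      _ = _ := by
          rw [← Real.rpow_add hE0]
          norm_num

/-- The particle exchange part of `offDiag` with absolute values inside. -/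
theorem lintegral_particleExchange_sq_le {M n : ℕ} {m : ℝ} (hm : 0 < m) {μ ν : Fin M}
    (hμν : ν ≠ μ) {f : Conf M n → ℂ} (hf : Measurable f) :
    ∫⁻ k, (∫⁻ ξ : R3, ‖f (shift ν ξ (shift μ (-ξ) k))‖ₑ *
          ENNReal.ofReal (1 / offDiagDenom m μ ξ k)) ^ 2 ≤
      (ENNReal.ofReal (min (1 / 2) (1 / (4 * m)) ^ (-(7 / 4) : ℝ)) * japaneseIntegral) *
        ∫⁻ k, ‖f k‖ₑ ^ 2 *
          (japaneseIntegral * ENNReal.ofReal (energy m k ^ (3 / 2 : ℝ))) := by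
  -- This constant makes `c (1 + (p_ν + ξ)²)` a lower bound for the denominator, by the
  -- parallelogram law, and for the energy after the exchange.
  obtain ⟨c, hc⟩ : ∃ c : ℝ, c = min (1 / 2) (1 / (4 * m)) := ⟨_, rfl⟩
  have hc0 : 0 < c := by rw [hc]; positivity
  have hc1 : c ≤ 1 / 2 := hc ▸ min_le_left _ _
  have hc2 : c ≤ 1 / (4 * m) := hc ▸ min_le_right _ _
  rw [← hc]
  have hm2 : Measurable fun z : Conf M n × R3 => 1 + ‖z.2‖ ^ 2 := by fun_prop
  have hmr : Measurable fun z : Conf M n × R3 => 1 + ‖z.1 (Sum.inl ν) + z.2‖ ^ 2 :=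
    (by fun_prop : Continuous fun z : Conf M n × R3 =>
      1 + ‖z.1 (Sum.inl ν) + z.2‖ ^ 2).measurable
  have hmE : Measurable fun z : Conf M n × R3 => energy m z.1 :=
    (measurable_energy m).comp measurable_fst
  have h := lintegral_sum_lintegral_sq_le (ι := Unit)
    (fun _ => measurePreserving_particleExchange (M := M) (n := n) μ ν)
    (F := fun k => ‖f k‖ₑ) hf.enorm
    (q := fun _ z => ENNReal.ofReal (1 / offDiagDenom m μ z.2 z.1))
    (g := fun _ z => ENNReal.ofReal (energy m z.1 ^ (3 / 4 : ℝ) *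
      (1 + ‖z.2‖ ^ 2) ^ (-(7 / 8) : ℝ)))
    (r := fun _ z => ENNReal.ofReal (c ^ (-(7 / 8) : ℝ) *
      (1 + ‖z.1 (Sum.inl ν) + z.2‖ ^ 2) ^ (-(7 / 8) : ℝ)))
    (fun _ => by fun_prop) (fun _ => by fun_prop)
    (C := ENNReal.ofReal (c ^ (-(7 / 4) : ℝ)) * japaneseIntegral)
    (W := fun k => japaneseIntegral * ENNReal.ofReal (energy m k ^ (3 / 2 : ℝ))) ?_ ?_ ?_
  · simpa using h
  · rintro - ⟨k, ξ⟩
    dsimp only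
    have hE0 := energy_pos hm (shift ν ξ (shift μ (-ξ) k))
    rw [← ENNReal.ofReal_mul (by positivity)]
    refine ENNReal.ofReal_le_ofReal ?_
    have hE := single_particle_le_energy hm (shift ν ξ (shift μ (-ξ) k)) ν
    have hd := single_particle_le_energy hm (shift μ (-ξ) k) ν
    simp only [shift_inl, if_true, if_neg hμν] at hE hd
    have hd' := offDiagDenom_eq m μ ξ k
    have hpar := parallelogram_law_with_norm ℝ (k (Sum.inl ν)) ξ
    have hm4 : 1 / (2 * m) = 2 * (1 / (4 * m)) := by field_simp; norm_num
    have h4 : 0 < 1 / (4 * m) := by positivity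
    have hd3 := boson_le_offDiagDenom hm μ ξ k
    have h0 : (0 : ℝ) ≤ n + ∑ i, ‖k (Sum.inr i)‖ ^ 2 := by positivity
    have hp2 : ‖k (Sum.inl ν) + ξ‖ ^ 2 ≤ 2 * ‖k (Sum.inl ν)‖ ^ 2 + 2 * ‖ξ‖ ^ 2 := by
      nlinarith [sq_nonneg ‖k (Sum.inl ν) - ξ‖]
    refine particleKernel_le ?_ ?_ hc0 ?_ ?_ ?_
    · nlinarith [sq_nonneg ‖k (Sum.inl ν) + ξ‖]
    · nlinarith [sq_nonneg ‖ξ‖]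
    · rw [hm4] at hE
      nlinarith [sq_nonneg ‖k (Sum.inl ν) + ξ‖,
        mul_le_mul_of_nonneg_right hc2 (sq_nonneg ‖k (Sum.inl ν) + ξ‖)]
    · rw [hm4] at hd
      nlinarith [sq_nonneg ‖ξ‖, mul_le_mul_of_nonneg_right hc2 (sq_nonneg ‖k (Sum.inl ν)‖),
        mul_le_mul_of_nonneg_right hc1 (sq_nonneg ‖ξ‖), mul_le_mul_of_nonneg_left hp2 hc0.le]
    · linarith
  · intro k
    rw [Fintype.sum_unique]
    have h1 : ∀ ξ : R3, ENNReal.ofReal (c ^ (-(7 / 8) : ℝ) *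
        (1 + ‖k (Sum.inl ν) + ξ‖ ^ 2) ^ (-(7 / 8) : ℝ)) ^ 2 = ENNReal.ofReal (c ^ (-(7 / 4) : ℝ)) *
          ENNReal.ofReal ((1 + ‖k (Sum.inl ν) + ξ‖ ^ 2) ^ (-(7 / 4) : ℝ)) := fun ξ => by
      rw [ENNReal.ofReal_mul (by positivity), mul_pow,
        ofReal_rpow_sq (b := -(7 / 4)) hc0.le _ (by norm_num),
        ofReal_rpow_sq (b := -(7 / 4)) (by positivity) _ (by norm_num)]
    rw [lintegral_congr h1, lintegral_const_mul _ (by fun_prop),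
      lintegral_add_left_eq_self (fun ξ : R3 =>
        ENNReal.ofReal ((1 + ‖ξ‖ ^ 2) ^ (-(7 / 4) : ℝ))) (k (Sum.inl ν))]
    rfl
  · intro k
    rw [Fintype.sum_unique]
    have h1 : ∀ ξ : R3, ENNReal.ofReal (energy m k ^ (3 / 4 : ℝ) *
        (1 + ‖ξ‖ ^ 2) ^ (-(7 / 8) : ℝ)) ^ 2 = ENNReal.ofReal (energy m k ^ (3 / 2 : ℝ)) *
          ENNReal.ofReal ((1 + ‖ξ‖ ^ 2) ^ (-(7 / 4) : ℝ)) := fun ξ => by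
      have hE0 := energy_pos hm k
      rw [ENNReal.ofReal_mul (by positivity), mul_pow,
        ofReal_rpow_sq (b := 3 / 2) hE0.le _ (by norm_num),
        ofReal_rpow_sq (b := -(7 / 4)) (by positivity) _ (by norm_num)]
    rw [lintegral_congr h1, lintegral_const_mul _ (by fun_prop), mul_comm]
    rfl

theorem ennreal_sum_sq_le {ι : Type*} (s : Finset ι) (a : ι → ℝ≥0∞) :
    (∑ i ∈ s, a i) ^ 2 ≤ s.card * ∑ i ∈ s, a i ^ 2 := by
  have h := ENNReal.inner_le_Lp_mul_Lq s (fun _ => 1) a Real.HolderConjugate.two_two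
  have hsq : ∀ a : ℝ≥0∞, (a ^ (1 / 2 : ℝ)) ^ 2 = a := fun a => by
    rw [← ENNReal.rpow_natCast, ← ENNReal.rpow_mul]
    norm_num
  calc (∑ i ∈ s, a i) ^ 2 = (∑ i ∈ s, 1 * a i) ^ 2 := by simp
    _ ≤ _ := pow_le_pow_left₀ (by positivity) h 2
    _ = _ := by rw [mul_pow, hsq, hsq]; simp

/-- The first integrals in `offDiag` with absolute values inside. -/
noncomputable def bosonExchangeAbs {M n : ℕ} (m : ℝ) (f : Conf M n → ℂ) (μ ν : Fin M) (i : Fin n)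
    (k : Conf M n) : ℝ≥0∞ :=
  ∫⁻ ξ : R3, ‖f (replace i ξ (shift ν (k (Sum.inr i)) (shift μ (-ξ) k)))‖ₑ *
    ENNReal.ofReal (1 / offDiagDenom m μ ξ k)

/-- The second integrals in `offDiag` with absolute values inside. -/
noncomputable def particleExchangeAbs {M n : ℕ} (m : ℝ) (f : Conf M n → ℂ) (μ ν : Fin M)
    (k : Conf M n) : ℝ≥0∞ :=
  ∫⁻ ξ : R3, ‖f (shift ν ξ (shift μ (-ξ) k))‖ₑ * ENNReal.ofReal (1 / offDiagDenom m μ ξ k)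

/-- The integrals in `offDiag` with absolute values inside. -/
noncomputable def offDiagAbs {M n : ℕ} (m : ℝ) (f : Conf M n → ℂ) (k : Conf M n) : ℝ≥0∞ :=
  (∑ μ : Fin M, ∑ ν : Fin M, ∑ i : Fin n, bosonExchangeAbs m f μ ν i k) +
    ∑ μ : Fin M, ∑ ν ∈ Finset.univ.erase μ, particleExchangeAbs m f μ ν k

theorem measurable_bosonExchange {M n : ℕ} (μ ν : Fin M) (i : Fin n) :
    Measurable fun z : Conf M n × R3 =>
      replace i z.2 (shift ν (z.1 (Sum.inr i)) (shift μ (-z.2) z.1)) :=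
  measurable_fst.comp (measurePreserving_bosonExchange μ ν i).measurable

theorem measurable_particleExchange {M n : ℕ} (μ ν : Fin M) :
    Measurable fun z : Conf M n × R3 => shift ν z.2 (shift μ (-z.2) z.1) :=
  measurable_fst.comp (measurePreserving_particleExchange μ ν).measurable

theorem measurable_offDiagDenom {M n : ℕ} (m : ℝ) (μ : Fin M) :
    Measurable fun z : Conf M n × R3 => offDiagDenom m μ z.2 z.1 :=
  (continuous_offDiagDenom m μ).measurable

theorem measurable_bosonExchangeAbs {M n : ℕ} (m : ℝ) {f : Conf M n → ℂ} (hf : Measurable f)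
    (μ ν : Fin M) (i : Fin n) : Measurable (bosonExchangeAbs m f μ ν i) :=
  Measurable.lintegral_prod_right' (f := fun z : Conf M n × R3 =>
    ‖f (replace i z.2 (shift ν (z.1 (Sum.inr i)) (shift μ (-z.2) z.1)))‖ₑ *
    ENNReal.ofReal (1 / offDiagDenom m μ z.2 z.1))
    ((hf.comp (measurable_bosonExchange μ ν i)).enorm.mul
      ((measurable_offDiagDenom m μ).const_div 1).ennreal_ofReal)

theorem measurable_particleExchangeAbs {M n : ℕ} (m : ℝ) {f : Conf M n → ℂ} (hf : Measurable f)
    (μ ν : Fin M) : Measurable (particleExchangeAbs m f μ ν) :=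
  Measurable.lintegral_prod_right' (f := fun z : Conf M n × R3 =>
    ‖f (shift ν z.2 (shift μ (-z.2) z.1))‖ₑ * ENNReal.ofReal (1 / offDiagDenom m μ z.2 z.1))
    ((hf.comp (measurable_particleExchange μ ν)).enorm.mul
      ((measurable_offDiagDenom m μ).const_div 1).ennreal_ofReal)

/-- The off-diagonal part is bounded by `(L + 1)^{3/4}`, uniformly in the number of bosons. -/
theorem exists_lintegral_offDiagAbs_sq_le (M : ℕ) {m : ℝ} (hm : 0 < m) :
    ∃ C : ℝ≥0∞, C ≠ ∞ ∧ ∀ (n : ℕ) (f : Conf M n → ℂ), Measurable f →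
      ∫⁻ k, offDiagAbs m f k ^ 2 ≤
        C * ∫⁻ k, ‖f k‖ₑ ^ 2 * ENNReal.ofReal (energy m k ^ (3 / 2 : ℝ)) := by
  have hJ := japaneseIntegral_ne_top
  obtain ⟨c, hc⟩ : ∃ c, c = ENNReal.ofReal (min (1 / 2) (1 / (4 * m)) ^ (-(7 / 4) : ℝ)) :=
    ⟨_, rfl⟩
  have hc0 : c ≠ ∞ := hc ▸ ENNReal.ofReal_ne_top
  refine ⟨2 * (M * (M * (M * (M * (japaneseIntegral * japaneseIntegral)))) +
    M * (M * (M * (M * (c * japaneseIntegral * japaneseIntegral))))), ?_, ?_⟩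
  · finiteness
  intro n f hf
  set B := ∫⁻ k, ‖f k‖ₑ ^ 2 * ENNReal.ofReal (energy m k ^ (3 / 2 : ℝ)) with hB
  have hBJ : ∫⁻ k, ‖f k‖ₑ ^ 2 *
      (japaneseIntegral * ENNReal.ofReal (energy m k ^ (3 / 2 : ℝ))) = japaneseIntegral * B := by
    rw [hB, ← lintegral_const_mul' _ _ hJ]
    refine lintegral_congr fun k => ?_
    ring
  have hb : ∀ μ ν, ∫⁻ k, (∑ i : Fin n, bosonExchangeAbs m f μ ν i k) ^ 2 ≤
      japaneseIntegral * (japaneseIntegral * B) := fun μ ν => by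
    rw [← hBJ]
    exact lintegral_bosonExchange_sq_le hm μ ν hf
  have hp : ∀ μ ν, ν ≠ μ → ∫⁻ k, particleExchangeAbs m f μ ν k ^ 2 ≤
      c * japaneseIntegral * (japaneseIntegral * B) := fun μ ν h => by
    rw [← hBJ, hc]
    exact lintegral_particleExchange_sq_le hm h hf
  have hbm : ∀ μ ν, Measurable fun k => (∑ i : Fin n, bosonExchangeAbs m f μ ν i k) ^ 2 :=
    fun μ ν => (Finset.measurable_sum _ fun i _ =>
      measurable_bosonExchangeAbs m hf μ ν i).pow_const 2
  have hpm : ∀ μ ν, Measurable fun k => particleExchangeAbs m f μ ν k ^ 2 :=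
    fun μ ν => (measurable_particleExchangeAbs m hf μ ν).pow_const 2
  have h1 : ∀ k, offDiagAbs m f k ^ 2 ≤ 2 * (M * ∑ μ : Fin M, M * ∑ ν : Fin M,
      (∑ i : Fin n, bosonExchangeAbs m f μ ν i k) ^ 2 +
      M * ∑ μ : Fin M, M * ∑ ν ∈ Finset.univ.erase μ, particleExchangeAbs m f μ ν k ^ 2) := by
    intro k
    have hM : (M : ℝ≥0∞) = ((Finset.univ : Finset (Fin M)).card : ℝ≥0∞) := by simp
    have h2 := ennreal_sum_sq_le Finset.univ
      ![∑ μ : Fin M, ∑ ν : Fin M, ∑ i : Fin n, bosonExchangeAbs m f μ ν i k,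
        ∑ μ : Fin M, ∑ ν ∈ Finset.univ.erase μ, particleExchangeAbs m f μ ν k]
    simp only [Fin.sum_univ_two, Matrix.cons_val_zero, Matrix.cons_val_one, Finset.card_univ,
      Fintype.card_fin] at h2
    rw [show ((Nat.succ 0).succ : ℕ) = 2 from rfl, Nat.cast_ofNat] at h2
    refine h2.trans ?_
    gcongr
    · refine (ennreal_sum_sq_le _ _).trans ?_
      rw [← hM]
      gcongr with μ
      refine (ennreal_sum_sq_le _ _).trans ?_
      rw [← hM]
    · refine (ennreal_sum_sq_le _ _).trans ?_
      rw [← hM]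
      gcongr with μ
      refine (ennreal_sum_sq_le _ _).trans ?_
      gcongr
      refine (Finset.card_le_univ _).trans ?_
      simp
  refine (lintegral_mono h1).trans ?_
  have hMt : (M : ℝ≥0∞) ≠ ∞ := ENNReal.natCast_ne_top M
  have hbs : ∀ μ, Measurable fun k => (M : ℝ≥0∞) * ∑ ν : Fin M,
      (∑ i : Fin n, bosonExchangeAbs m f μ ν i k) ^ 2 := fun μ =>
    (Finset.measurable_sum _ fun ν _ => hbm μ ν).const_mul _
  have hps : ∀ μ, Measurable fun k => (M : ℝ≥0∞) * ∑ ν ∈ Finset.univ.erase μ,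
      particleExchangeAbs m f μ ν k ^ 2 := fun μ =>
    (Finset.measurable_sum _ fun ν _ => hpm μ ν).const_mul _
  rw [lintegral_const_mul' _ _ (by simp), mul_assoc, lintegral_add_left
    ((Finset.measurable_sum _ fun μ _ => hbs μ).const_mul _), lintegral_const_mul' _ _ hMt,
    lintegral_const_mul' _ _ hMt, lintegral_finsetSum _ fun μ _ => hbs μ,
    lintegral_finsetSum _ fun μ _ => hps μ]
  have h3 : ∀ μ, ∫⁻ k, (M : ℝ≥0∞) * ∑ ν : Fin M,
      (∑ i : Fin n, bosonExchangeAbs m f μ ν i k) ^ 2 ≤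
      M * (M * (japaneseIntegral * (japaneseIntegral * B))) := fun μ => by
    rw [lintegral_const_mul' _ _ hMt, lintegral_finsetSum _ fun ν _ => hbm μ ν]
    gcongr
    refine (Finset.sum_le_sum fun ν _ => hb μ ν).trans ?_
    simp
  have h4 : ∀ μ, ∫⁻ k, (M : ℝ≥0∞) * ∑ ν ∈ Finset.univ.erase μ,
      particleExchangeAbs m f μ ν k ^ 2 ≤
      M * (M * (c * japaneseIntegral * (japaneseIntegral * B))) := fun μ => by
    rw [lintegral_const_mul' _ _ hMt, lintegral_finsetSum _ fun ν _ => hpm μ ν]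
    gcongr
    refine (Finset.sum_le_sum fun ν hν => hp μ ν (Finset.ne_of_mem_erase hν)).trans ?_
    rw [Finset.sum_const, nsmul_eq_mul]
    gcongr
    refine (Finset.card_le_univ _).trans ?_
    simp
  have h5 := Finset.sum_le_sum fun μ (_ : μ ∈ (Finset.univ : Finset (Fin M))) => h3 μ
  have h6 := Finset.sum_le_sum fun μ (_ : μ ∈ (Finset.univ : Finset (Fin M))) => h4 μ
  simp only [Finset.sum_const, Finset.card_univ, Fintype.card_fin, nsmul_eq_mul] at h5 h6
  calc _ ≤ 2 * (M * (M * (M * (M * (japaneseIntegral * (japaneseIntegral * B))))) +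
        M * (M * (M * (M * (c * japaneseIntegral * (japaneseIntegral * B)))))) := by gcongr
    _ = _ := by ring

theorem enorm_div_ofReal {z : ℂ} {d : ℝ} (hd : 0 < d) :
    ‖z / (d : ℂ)‖ₑ = ‖z‖ₑ * ENNReal.ofReal (1 / d) := by
  rw [← ofReal_norm, ← ofReal_norm, ← ENNReal.ofReal_mul (norm_nonneg _), norm_div,
    Complex.norm_real, Real.norm_of_nonneg hd.le, mul_one_div]

theorem enorm_offDiag_le {M n : ℕ} {m : ℝ} (hm : 0 < m) (f : Conf M n → ℂ) (k : Conf M n) :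
    ‖offDiag m f k‖ₑ ≤ offDiagAbs m f k := by
  have h1 : ‖-((((2 * Real.pi) ^ 3)⁻¹ : ℝ) : ℂ)‖ₑ ≤ 1 := by
    rw [enorm_neg, ← ofReal_norm, Complex.norm_real, Real.norm_of_nonneg (by positivity),
      ← ENNReal.ofReal_one]
    refine ENNReal.ofReal_le_ofReal (inv_le_one_of_one_le₀ (one_le_pow₀ ?_))
    linarith [Real.pi_gt_three]
  unfold offDiag offDiagAbs
  rw [enorm_mul]
  refine (mul_le_of_le_one_left (by positivity) h1).trans ((enorm_add_le _ _).trans ?_)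
  gcongr
  · refine (enorm_sum_le _ _).trans (Finset.sum_le_sum fun μ _ => ?_)
    refine (enorm_sum_le _ _).trans (Finset.sum_le_sum fun ν _ => ?_)
    refine (enorm_sum_le _ _).trans (Finset.sum_le_sum fun i _ => ?_)
    refine (enorm_integral_le_lintegral_enorm _).trans (le_of_eq (lintegral_congr fun ξ => ?_))
    exact enorm_div_ofReal (offDiagDenom_pos hm μ ξ k)
  · refine (enorm_sum_le _ _).trans (Finset.sum_le_sum fun μ _ => ?_)
    refine (enorm_sum_le _ _).trans (Finset.sum_le_sum fun ν _ => ?_)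
    refine (enorm_integral_le_lintegral_enorm _).trans (le_of_eq (lintegral_congr fun ξ => ?_))
    exact enorm_div_ofReal (offDiagDenom_pos hm μ ξ k)

theorem measurable_offDiag {M n : ℕ} (m : ℝ) {f : Conf M n → ℂ} (hf : Measurable f) :
    Measurable (offDiag m f) := by
  have hd : ∀ μ : Fin M, Measurable fun z : Conf M n × R3 => ((offDiagDenom m μ z.2 z.1 : ℝ) : ℂ) :=
    fun μ => Complex.measurable_ofReal.comp (measurable_offDiagDenom m μ)
  unfold offDiag
  refine Measurable.const_mul (Measurable.add ?_ ?_) _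
  · refine Finset.measurable_sum _ fun μ _ => Finset.measurable_sum _ fun ν _ =>
      Finset.measurable_sum _ fun i _ => ?_
    exact (StronglyMeasurable.integral_prod_right' (f := fun z : Conf M n × R3 =>
      f (replace i z.2 (shift ν (z.1 (Sum.inr i)) (shift μ (-z.2) z.1))) /
        ((offDiagDenom m μ z.2 z.1 : ℝ) : ℂ))
      ((hf.comp (measurable_bosonExchange μ ν i)).div (hd μ)).stronglyMeasurable).measurable
  · refine Finset.measurable_sum _ fun μ _ => Finset.measurable_sum _ fun ν _ => ?_
    exact (StronglyMeasurable.integral_prod_right' (f := fun z : Conf M n × R3 =>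
      f (shift ν z.2 (shift μ (-z.2) z.1)) / ((offDiagDenom m μ z.2 z.1 : ℝ) : ℂ))
      ((hf.comp (measurable_particleExchange μ ν)).div (hd μ)).stronglyMeasurable).measurable

theorem offDiag_congr {M n : ℕ} (m : ℝ) {f g : Conf M n → ℂ} (h : f =ᵐ[volume] g) :
    offDiag m f =ᵐ[volume] offDiag m g := by
  have hb : ∀ (μ ν : Fin M) (i : Fin n), ∀ᵐ k : Conf M n, ∀ᵐ ξ : R3,
      f (replace i ξ (shift ν (k (Sum.inr i)) (shift μ (-ξ) k))) =
      g (replace i ξ (shift ν (k (Sum.inr i)) (shift μ (-ξ) k))) := fun μ ν i =>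
    Measure.ae_ae_of_ae_prod ((Measure.quasiMeasurePreserving_fst.comp
      (measurePreserving_bosonExchange μ ν i).quasiMeasurePreserving).ae h)
  have hp : ∀ (μ ν : Fin M), ∀ᵐ k : Conf M n, ∀ᵐ ξ : R3,
      f (shift ν ξ (shift μ (-ξ) k)) = g (shift ν ξ (shift μ (-ξ) k)) := fun μ ν =>
    Measure.ae_ae_of_ae_prod ((Measure.quasiMeasurePreserving_fst.comp
      (measurePreserving_particleExchange μ ν).quasiMeasurePreserving).ae h)
  have hb' := ae_all_iff.2 fun μ => ae_all_iff.2 fun ν => ae_all_iff.2 fun i => hb μ ν i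
  have hp' := ae_all_iff.2 fun μ => ae_all_iff.2 fun ν => hp μ ν
  filter_upwards [hb', hp'] with k h1 h2
  unfold offDiag
  congr 2
  · refine Finset.sum_congr rfl fun μ _ => Finset.sum_congr rfl fun ν _ =>
      Finset.sum_congr rfl fun i _ => integral_congr_ae ?_
    filter_upwards [h1 μ ν i] with ξ hξ
    rw [hξ]
  · refine Finset.sum_congr rfl fun μ _ => Finset.sum_congr rfl fun ν _ => integral_congr_ae ?_
    filter_upwards [h2 μ ν] with ξ hξ
    rw [hξ]

theorem offDiag_smul {M n : ℕ} (m : ℝ) (c : ℂ) (f : Conf M n → ℂ) (k : Conf M n) :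
    offDiag m (fun k => c * f k) k = c * offDiag m f k := by
  unfold offDiag
  simp only [mul_div_assoc, integral_const_mul, ← Finset.mul_sum]
  ring

theorem offDiag_perm {M n : ℕ} (m : ℝ) (σ : Equiv.Perm (Fin n)) (f : Conf M n → ℂ)
    (k : Conf M n) :
    offDiag m f (permConf M n σ k) = offDiag m (fun k => f (permConf M n σ k)) k := by
  have hs : ∀ (μ : Fin M) (q : R3) (k : Conf M n),
      shift μ q (permConf M n σ k) = permConf M n σ (shift μ q k) := fun μ q k =>
    conf_ext (fun ν => by simp) fun i => by simp
  have hr : ∀ (i : Fin n) (q : R3) (k : Conf M n),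
      replace i q (permConf M n σ k) = permConf M n σ (replace (σ i) q k) := fun i q k =>
    conf_ext (fun ν => by simp) fun j => by simp
  have hd : ∀ (μ : Fin M) (ξ : R3), offDiagDenom m μ ξ (permConf M n σ k) =
      offDiagDenom m μ ξ k := fun μ ξ => by
    rw [offDiagDenom_eq, offDiagDenom_eq, hs, energy_perm]
  unfold offDiag
  simp only [hs, hr, hd, permConf_inr]
  congr 2
  refine Finset.sum_congr rfl fun μ _ => Finset.sum_congr rfl fun ν _ => ?_
  exact Equiv.sum_comp σ fun i => ∫ ξ : R3,
    f (permConf M n σ (replace i ξ (shift ν (k (Sum.inr i)) (shift μ (-ξ) k)))) /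
      ((offDiagDenom m μ ξ k : ℝ) : ℂ)

theorem measurable_offDiagDenom_right {M n : ℕ} (m : ℝ) (μ : Fin M) (k : Conf M n) :
    Measurable fun ξ : R3 => ((offDiagDenom m μ ξ k : ℝ) : ℂ) := by
  have h : Measurable (fun ξ : R3 => offDiagDenom m μ ξ k) := by
    have := (measurable_offDiagDenom m μ).comp
      (measurable_prodMk_left : Measurable fun ξ : R3 => (k, ξ))
    exact this
  exact Complex.measurable_ofReal.comp h

theorem integrable_bosonExchange {M n : ℕ} {m : ℝ} (hm : 0 < m) {f : Conf M n → ℂ}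
    (hf : Measurable f) {μ ν : Fin M} {i : Fin n} {k : Conf M n}
    (h : bosonExchangeAbs m f μ ν i k ≠ ∞) :
    Integrable fun ξ : R3 => f (replace i ξ (shift ν (k (Sum.inr i)) (shift μ (-ξ) k))) /
      ((offDiagDenom m μ ξ k : ℝ) : ℂ) := by
  have h1 : Measurable fun ξ : R3 =>
      f (replace i ξ (shift ν (k (Sum.inr i)) (shift μ (-ξ) k))) := by
    have := (hf.comp (measurable_bosonExchange μ ν i)).comp
      (measurable_prodMk_left : Measurable fun ξ : R3 => (k, ξ))
    exact this
  refine ⟨(h1.div (measurable_offDiagDenom_right m μ k)).aestronglyMeasurable, ?_⟩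
  have h2 : ∀ ξ : R3, ‖f (replace i ξ (shift ν (k (Sum.inr i)) (shift μ (-ξ) k))) /
      ((offDiagDenom m μ ξ k : ℝ) : ℂ)‖ₑ = _ :=
    fun ξ => enorm_div_ofReal (offDiagDenom_pos hm μ ξ k)
  unfold HasFiniteIntegral
  rw [lintegral_congr h2]
  exact h.lt_top

theorem integrable_particleExchange {M n : ℕ} {m : ℝ} (hm : 0 < m) {f : Conf M n → ℂ}
    (hf : Measurable f) {μ ν : Fin M} {k : Conf M n} (h : particleExchangeAbs m f μ ν k ≠ ∞) :
    Integrable fun ξ : R3 => f (shift ν ξ (shift μ (-ξ) k)) /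
      ((offDiagDenom m μ ξ k : ℝ) : ℂ) := by
  have h1 : Measurable fun ξ : R3 => f (shift ν ξ (shift μ (-ξ) k)) := by
    have := (hf.comp (measurable_particleExchange μ ν)).comp
      (measurable_prodMk_left : Measurable fun ξ : R3 => (k, ξ))
    exact this
  refine ⟨(h1.div (measurable_offDiagDenom_right m μ k)).aestronglyMeasurable, ?_⟩
  have h2 : ∀ ξ : R3, ‖f (shift ν ξ (shift μ (-ξ) k)) /
      ((offDiagDenom m μ ξ k : ℝ) : ℂ)‖ₑ = _ :=
    fun ξ => enorm_div_ofReal (offDiagDenom_pos hm μ ξ k)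
  unfold HasFiniteIntegral
  rw [lintegral_congr h2]
  exact h.lt_top

theorem ae_offDiagAbs_ne_top {M n : ℕ} {m : ℝ} (hm : 0 < m) {f : Conf M n → ℂ}
    (hf : Measurable f)
    (hfin : ∫⁻ k, ‖f k‖ₑ ^ 2 * ENNReal.ofReal (energy m k ^ (3 / 2 : ℝ)) ≠ ∞) :
    ∀ᵐ k : Conf M n, (∀ (μ ν : Fin M) (i : Fin n), bosonExchangeAbs m f μ ν i k ≠ ∞) ∧
      ∀ μ : Fin M, ∀ ν ∈ Finset.univ.erase μ, particleExchangeAbs m f μ ν k ≠ ∞ := by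
  obtain ⟨C, hC, hb⟩ := exists_lintegral_offDiagAbs_sq_le M hm
  have hmeas : Measurable (offDiagAbs m f) :=
    (Finset.measurable_sum _ fun μ _ => Finset.measurable_sum _ fun ν _ =>
      Finset.measurable_sum _ fun i _ => measurable_bosonExchangeAbs m hf μ ν i).add
    (Finset.measurable_sum _ fun μ _ => Finset.measurable_sum _ fun ν _ =>
      measurable_particleExchangeAbs m hf μ ν)
  have h1 : ∫⁻ k, offDiagAbs m f k ^ 2 ≠ ∞ :=
    ((hb n f hf).trans_lt (ENNReal.mul_lt_top hC.lt_top hfin.lt_top)).ne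
  filter_upwards [ae_lt_top (hmeas.pow_const 2) h1] with k hk
  have hk' : offDiagAbs m f k ≠ ∞ := fun h => by simp [h] at hk
  obtain ⟨hk1, hk2⟩ := ENNReal.add_ne_top.1 hk'
  constructor
  · intro μ ν i
    have h2 := ENNReal.sum_ne_top.1 hk1 μ (Finset.mem_univ μ)
    have h3 := ENNReal.sum_ne_top.1 h2 ν (Finset.mem_univ ν)
    exact ENNReal.sum_ne_top.1 h3 i (Finset.mem_univ i)
  · intro μ ν hν
    have h2 := ENNReal.sum_ne_top.1 hk2 μ (Finset.mem_univ μ)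
    exact ENNReal.sum_ne_top.1 h2 ν hν

theorem offDiag_add {M n : ℕ} {m : ℝ} (hm : 0 < m) {f g : Conf M n → ℂ}
    (hf : Measurable f) (hg : Measurable g)
    (hfin : ∫⁻ k, ‖f k‖ₑ ^ 2 * ENNReal.ofReal (energy m k ^ (3 / 2 : ℝ)) ≠ ∞)
    (hgin : ∫⁻ k, ‖g k‖ₑ ^ 2 * ENNReal.ofReal (energy m k ^ (3 / 2 : ℝ)) ≠ ∞) :
    offDiag m (fun k => f k + g k) =ᵐ[volume] fun k => offDiag m f k + offDiag m g k := by
  filter_upwards [ae_offDiagAbs_ne_top hm hf hfin, ae_offDiagAbs_ne_top hm hg hgin]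
    with k h1 h2
  unfold offDiag
  rw [← mul_add, add_add_add_comm]
  simp only [← Finset.sum_add_distrib]
  congr 1
  refine Finset.sum_congr rfl fun μ _ => ?_
  congr 1
  · refine Finset.sum_congr rfl fun ν _ => Finset.sum_congr rfl fun i _ => ?_
    rw [← integral_add (integrable_bosonExchange hm hf (h1.1 μ ν i))
      (integrable_bosonExchange hm hg (h2.1 μ ν i))]
    simp only [add_div]
  · refine Finset.sum_congr rfl fun ν hν => ?_
    rw [← integral_add (integrable_particleExchange hm hf (h1.2 μ ν hν))
      (integrable_particleExchange hm hg (h2.2 μ ν hν))]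
    simp only [add_div]

/-! ### The creation operator -/

theorem integrable_rpow_sq_add {a : ℝ} (ha : a < -(1 / 2)) {N : ℝ} (hN : 1 ≤ N) :
    Integrable fun y : ℝ => (y ^ 2 + N) ^ a := by
  have h : Integrable (fun y : ℝ => (1 + ‖y‖ ^ 2) ^ (-(-2 * a) / 2)) :=
    integrable_rpow_neg_one_add_norm_sq (by simp; linarith)
  rw [show -(-2 * a) / 2 = a by ring] at h
  refine h.mono' (by fun_prop : Measurable fun y : ℝ => (y ^ 2 + N) ^ a).aestronglyMeasurable
     (Filter.Eventually.of_forall fun y => ?_)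
  rw [Real.norm_of_nonneg (by positivity), Real.norm_eq_abs, sq_abs]
  exact Real.rpow_le_rpow_of_nonpos (by positivity) (by linarith) (by linarith)

theorem integral_rpow_sq_add {a N : ℝ} (hN : 0 < N) :
    ∫ y in Set.Ioi (0 : ℝ), (y ^ 2 + N) ^ a =
      N ^ (a + 1 / 2) * ∫ y in Set.Ioi (0 : ℝ), (y ^ 2 + 1) ^ a := by
  have h := integral_comp_mul_left_Ioi (fun y : ℝ => (y ^ 2 + N) ^ a) 0 (Real.sqrt_pos.2 hN)
  have h1 : ∀ y : ℝ, ((Real.sqrt N * y) ^ 2 + N) ^ a = N ^ a * (y ^ 2 + 1) ^ a := fun y => by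
    rw [mul_pow, Real.sq_sqrt hN.le, ← Real.mul_rpow hN.le (by positivity)]
    ring_nf
  simp only [h1, mul_zero, smul_eq_mul, integral_const_mul] at h
  have hs : Real.sqrt N ≠ 0 := (Real.sqrt_pos.2 hN).ne'
  rw [Real.rpow_add hN, ← Real.sqrt_eq_rpow, mul_comm (N ^ a), mul_assoc, h,
    mul_inv_cancel_left₀ hs]

/-- The momentum integral of one created boson. In polar coordinates the volume factor cancels the
weight `1 + η²` and leaves a one-dimensional integral that scales in `N`. -/
theorem exists_lintegral_created_le {s : ℝ} (hs : s < 1 / 4) :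
    ∃ C : ℝ, 0 ≤ C ∧ ∀ N : ℝ, 1 ≤ N →
      ∫⁻ η : R3, ENNReal.ofReal ((‖η‖ ^ 2 + N) ^ (2 * s - 1) * (1 + ‖η‖ ^ 2)⁻¹) ≤
        ENNReal.ofReal (C * N ^ (2 * s - 1 / 2)) := by
  have hd : Module.finrank ℝ R3 = 3 := finrank_euclideanSpace_fin
  obtain ⟨b, hb⟩ : ∃ b : ℝ, b = (volume : Measure R3).real (Metric.ball 0 1) := ⟨_, rfl⟩
  have hb0 : 0 ≤ b := hb ▸ measureReal_nonneg
  have hI0 : 0 ≤ ∫ y in Set.Ioi (0 : ℝ), (y ^ 2 + 1) ^ (2 * s - 1) :=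
    integral_nonneg fun y => by positivity
  refine ⟨3 * (b * ∫ y in Set.Ioi (0 : ℝ), (y ^ 2 + 1) ^ (2 * s - 1)), by positivity, ?_⟩
  intro N hN
  have hN0 : 0 < N := by linarith
  have ha : 2 * s - 1 < -(1 / 2) := by linarith
  set f : ℝ → ℝ := fun y => (y ^ 2 + N) ^ (2 * s - 1) * (1 + y ^ 2)⁻¹ with hf
  have hle : ∀ y : ℝ, y ^ 2 * f y ≤ (y ^ 2 + N) ^ (2 * s - 1) := fun y => by
    have h1 : y ^ 2 * (1 + y ^ 2)⁻¹ ≤ 1 := by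
      rw [← div_eq_mul_inv, div_le_one (by positivity)]
      linarith
    calc y ^ 2 * f y = (y ^ 2 + N) ^ (2 * s - 1) * (y ^ 2 * (1 + y ^ 2)⁻¹) := by
          rw [hf]; ring
      _ ≤ _ := mul_le_of_le_one_right (by positivity) h1
  have hint1 := (integrable_rpow_sq_add ha hN).integrableOn (s := Set.Ioi (0 : ℝ))
  have hint : IntegrableOn (fun y : ℝ => y ^ 2 * f y) (Set.Ioi 0) := by
    refine hint1.mono' (by fun_prop) (Filter.Eventually.of_forall fun y => ?_)
    rw [Real.norm_of_nonneg (by positivity)]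
    exact hle y
  have hint3 : Integrable (fun η : R3 => f ‖η‖) := by
    rw [integrable_fun_norm_addHaar, hd]
    exact hint
  have hval := integral_fun_norm_addHaar (volume : Measure R3) f
  rw [hd] at hval
  rw [← ofReal_integral_eq_lintegral_ofReal hint3
    (Filter.Eventually.of_forall fun η => by positivity)]
  refine ENNReal.ofReal_le_ofReal ?_
  have h2 : ∫ y in Set.Ioi (0 : ℝ), y ^ 2 * f y ≤
      N ^ (2 * s - 1 / 2) * ∫ y in Set.Ioi (0 : ℝ), (y ^ 2 + 1) ^ (2 * s - 1) := by
    refine (integral_mono hint hint1 hle).trans ?_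
    rw [integral_rpow_sq_add hN0, show 2 * s - 1 + 1 / 2 = 2 * s - 1 / 2 by ring]
  rw [hval, ← hb]
  simp only [smul_eq_mul, nsmul_eq_mul, Nat.cast_ofNat, Nat.add_one_sub_one]
  calc 3 * (b * ∫ y in Set.Ioi (0 : ℝ), y ^ 2 * f y)
      ≤ 3 * (b * (N ^ (2 * s - 1 / 2) * ∫ y in Set.Ioi (0 : ℝ), (y ^ 2 + 1) ^ (2 * s - 1))) := by
        gcongr
    _ = _ := by ring

/-- The bound on the creation operator for a fixed particle, without the normalisation
`(n + 1)^{-1/2}`. As in `lintegral_bosonExchange_sq_le`, the weights `1 + k_i²` control the sum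
over the bosons. -/
theorem exists_lintegral_creation_le {s : ℝ} (hs : s < 1 / 4) :
    ∃ C : ℝ, 0 ≤ C ∧ ∀ (M n : ℕ) (m : ℝ), 0 < m → ∀ (μ : Fin M) (f : Conf M n → ℂ), Measurable f →
      ∫⁻ k : Conf M (n + 1), (∑ i : Fin (n + 1),
          ‖f (shift μ (k (Sum.inr i)) (remove i k))‖ₑ *
            ENNReal.ofReal (energy m k ^ (s - 1))) ^ 2 ≤
        ENNReal.ofReal (C * ((n : ℝ) + 1) * ((n : ℝ) + 1) ^ (2 * s - 1 / 2)) *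
          ∫⁻ k, ‖f k‖ₑ ^ 2 := by
  obtain ⟨C, hC, hI⟩ := exists_lintegral_created_le hs
  refine ⟨C, hC, ?_⟩
  intro M n m hm μ f hf
  have hmi : ∀ i : Fin (n + 1), Measurable fun z : Conf M (n + 1) × Unit =>
      1 + ‖z.1 (Sum.inr i)‖ ^ 2 :=
    fun i => (by fun_prop : Continuous fun z : Conf M (n + 1) × Unit =>
      1 + ‖z.1 (Sum.inr i)‖ ^ 2).measurable
  have hmE : Measurable fun z : Conf M (n + 1) × Unit => energy m z.1 :=
    (measurable_energy m).comp measurable_fst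
  have hn1 : (1 : ℝ) ≤ (n : ℝ) + 1 := by simp
  have h := lintegral_sum_lintegral_sq_le (ι := Fin (n + 1)) (μ := volume)
    (ω := Measure.dirac ()) (μ' := volume) (ω' := volume)
    (Φ := fun i (z : Conf M (n + 1) × Unit) =>
      (shift μ (z.1 (Sum.inr i)) (remove i z.1), z.1 (Sum.inr i)))
    (fun i => (measurePreserving_creation (M := M) μ i).comp measurePreserving_fst)
    (F := fun k => ‖f k‖ₑ) hf.enorm
    (q := fun _ z => ENNReal.ofReal (energy m z.1 ^ (s - 1)))
    (g := fun _ z => ENNReal.ofReal ((‖z.2‖ ^ 2 + ((n : ℝ) + 1)) ^ (s - 1 / 2) *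
      (1 + ‖z.2‖ ^ 2) ^ (-(1 / 2) : ℝ)))
    (r := fun i z => ENNReal.ofReal (((1 + ‖z.1 (Sum.inr i)‖ ^ 2) / energy m z.1) ^ (1 / 2 : ℝ)))
    (fun i => by fun_prop) (fun i => by have := hmi i; fun_prop)
    (C := 1) (W := fun _ => ENNReal.ofReal (C * ((n : ℝ) + 1) * ((n : ℝ) + 1) ^ (2 * s - 1 / 2)))
    ?_ ?_ ?_
  · simp only [lintegral_dirac, one_mul] at h
    refine h.trans (le_of_eq ?_)
    rw [lintegral_mul_const' _ _ ENNReal.ofReal_ne_top, mul_comm]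
  · rintro i ⟨k, -⟩
    dsimp only
    have hE0 := energy_pos hm k
    rw [← ENNReal.ofReal_mul (by positivity)]
    refine ENNReal.ofReal_le_ofReal ?_
    have hb : 0 < 1 + ‖k (Sum.inr i)‖ ^ 2 := by positivity
    have hE := boson_le_energy hm k
    have hi := single_boson_le k i
    push_cast at hE
    rw [Real.div_rpow hb.le hE0.le, mul_div_assoc', mul_assoc, ← Real.rpow_add hb]
    rw [show -(1 / 2) + 1 / 2 = (0 : ℝ) by norm_num, Real.rpow_zero, mul_one,
      show s - 1 = s - 1 / 2 - 1 / 2 by ring, Real.rpow_sub hE0]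
    refine div_le_div_of_nonneg_right ?_ (by positivity)
    exact Real.rpow_le_rpow_of_nonpos (by positivity) (by linarith) (by linarith)
  · intro k
    have hE0 := energy_pos hm k
    simp only [lintegral_dirac]
    have h1 : ∀ i : Fin (n + 1), ENNReal.ofReal
        (((1 + ‖k (Sum.inr i)‖ ^ 2) / energy m k) ^ (1 / 2 : ℝ)) ^ 2 =
        ENNReal.ofReal ((1 + ‖k (Sum.inr i)‖ ^ 2) / energy m k) := fun i => by
      rw [ofReal_rpow_sq (b := 1) (by positivity) _ (by norm_num), Real.rpow_one]
    simp only [h1]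
    rw [← ENNReal.ofReal_sum_of_nonneg (fun i _ => by positivity), ← Finset.sum_div,
      ← ENNReal.ofReal_one]
    refine ENNReal.ofReal_le_ofReal ?_
    rw [div_le_one hE0]
    have hE := boson_le_energy hm k
    simp only [Finset.sum_add_distrib, Finset.sum_const, Finset.card_univ, Fintype.card_fin,
      nsmul_eq_mul, mul_one]
    linarith
  · intro k
    have h1 : ∀ η : R3, ENNReal.ofReal ((‖η‖ ^ 2 + ((n : ℝ) + 1)) ^ (s - 1 / 2) *
        (1 + ‖η‖ ^ 2) ^ (-(1 / 2) : ℝ)) ^ 2 =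
        ENNReal.ofReal ((‖η‖ ^ 2 + ((n : ℝ) + 1)) ^ (2 * s - 1) * (1 + ‖η‖ ^ 2)⁻¹) := fun η => by
      rw [ENNReal.ofReal_mul (by positivity), mul_pow,
        ofReal_rpow_sq (b := 2 * s - 1) (by positivity) _ (by ring),
        ofReal_rpow_sq (b := -1) (by positivity) _ (by norm_num),
        ← ENNReal.ofReal_mul (by positivity), Real.rpow_neg_one]
    simp only [h1]
    rw [Finset.sum_const, Finset.card_univ, Fintype.card_fin, nsmul_eq_mul]
    calc _ ≤ ((n + 1 : ℕ) : ℝ≥0∞) *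
          ENNReal.ofReal (C * ((n : ℝ) + 1) ^ (2 * s - 1 / 2)) := by
          gcongr
          exact hI _ hn1
      _ = _ := by
        rw [← ENNReal.ofReal_natCast, ← ENNReal.ofReal_mul (by positivity)]
        push_cast
        ring_nf

theorem natCast_mul_ofReal_mul (M : ℕ) (y : ℝ) (x : ℝ≥0∞) :
    (M : ℝ≥0∞) * (ENNReal.ofReal y * x) = ENNReal.ofReal (M * y) * x := by
  rw [← mul_assoc, ENNReal.ofReal_mul (Nat.cast_nonneg M), ENNReal.ofReal_natCast]

theorem creationHat_succ {M : ℕ} (ψ : Hilb M) (n : ℕ) (k : Conf M (n + 1)) :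
    creationHat ψ (n + 1) k = ∑ μ : Fin M,
      (((Real.sqrt ((n : ℝ) + 1))⁻¹ * (2 * Real.pi) ^ (-(3 / 2) : ℝ) : ℝ) : ℂ) *
        ∑ i : Fin (n + 1), hat (ψ n) (shift μ (k (Sum.inr i)) (remove i k)) := rfl

/-- The form bound for `∑_μ a*(δ_{x_μ})`: it maps into `(L + 1)^{1 - s}` of the Hilbert space
for `s < 1/4`, and gains the power `s - 1/4` of the particle number. -/
theorem exists_lintegral_creationHat_le (M : ℕ) {m : ℝ} (hm : 0 < m) {s : ℝ} (hs : s < 1 / 4) :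
    ∃ C : ℝ, 0 ≤ C ∧ ∀ (n : ℕ) (ψ : Hilb M),
      ∫⁻ k, (ENNReal.ofReal (energy m k ^ (s - 1)) * ‖creationHat ψ (n + 1) k‖ₑ) ^ 2 ≤
        ENNReal.ofReal (C * ((n : ℝ) + 1) ^ (2 * s - 1 / 2)) * ‖ψ n‖ₑ ^ 2 := by
  obtain ⟨C, hC, h⟩ := exists_lintegral_creation_le hs
  refine ⟨M * (M * C), by positivity, ?_⟩
  intro n ψ
  have hn0 : (0 : ℝ) < (n : ℝ) + 1 := by positivity
  set A : Fin M → Conf M (n + 1) → ℝ≥0∞ := fun μ k => ∑ i : Fin (n + 1),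
    ‖hat (ψ n) (shift μ (k (Sum.inr i)) (remove i k))‖ₑ *
      ENNReal.ofReal (energy m k ^ (s - 1)) with hA
  have hAm : ∀ μ, Measurable (A μ) := fun μ => Finset.measurable_sum _ fun i _ =>
    (((measurable_hat (ψ n)).comp (measurable_fst.comp
      (measurePreserving_creation μ i).measurable)).enorm).mul
      ((measurable_energy m).pow_const _).ennreal_ofReal
  set c : ℝ := (Real.sqrt ((n : ℝ) + 1))⁻¹ * (2 * Real.pi) ^ (-(3 / 2) : ℝ) with hc
  have hc0 : 0 ≤ c := by positivity
  have hc2 : c ^ 2 ≤ ((n : ℝ) + 1)⁻¹ := by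
    have h1 : (2 * Real.pi) ^ (-(3 / 2) : ℝ) ≤ 1 :=
      Real.rpow_le_one_of_one_le_of_nonpos (by linarith [Real.pi_gt_three]) (by norm_num)
    rw [hc, mul_pow, inv_pow, Real.sq_sqrt hn0.le]
    exact mul_le_of_le_one_right (by positivity) (pow_le_one₀ (by positivity) h1)
  have hpt : ∀ k, (ENNReal.ofReal (energy m k ^ (s - 1)) * ‖creationHat ψ (n + 1) k‖ₑ) ^ 2 ≤
      M * ∑ μ, ENNReal.ofReal (((n : ℝ) + 1)⁻¹) * A μ k ^ 2 := by
    intro k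
    calc _ ≤ (∑ μ, ENNReal.ofReal c * A μ k) ^ 2 := by
          refine pow_le_pow_left₀ (by positivity) ?_ 2
          rw [creationHat_succ]
          refine (mul_le_mul_right (enorm_sum_le _ _) _).trans ?_
          rw [Finset.mul_sum]
          refine Finset.sum_le_sum fun μ _ => ?_
          rw [enorm_mul, ← ofReal_norm, Complex.norm_real, Real.norm_of_nonneg hc0,
            mul_left_comm]
          gcongr
          rw [hA]
          dsimp only
          rw [← Finset.sum_mul, mul_comm]
          gcongr
          exact enorm_sum_le _ _
      _ ≤ M * ∑ μ, (ENNReal.ofReal c * A μ k) ^ 2 := by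
          have := ennreal_sum_sq_le Finset.univ fun μ => ENNReal.ofReal c * A μ k
          simpa using this
      _ ≤ _ := by
          gcongr with μ
          rw [mul_pow, ← ENNReal.ofReal_pow hc0]
          gcongr
  refine (lintegral_mono hpt).trans ?_
  rw [lintegral_const_mul' _ _ (by simp),
    lintegral_finsetSum _ fun μ _ => ((hAm μ).pow_const 2).const_mul _]
  have h3 : ∀ μ, ∫⁻ k, ENNReal.ofReal (((n : ℝ) + 1)⁻¹) * A μ k ^ 2 ≤
      ENNReal.ofReal (C * ((n : ℝ) + 1) ^ (2 * s - 1 / 2)) * ‖ψ n‖ₑ ^ 2 := fun μ => by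
    rw [lintegral_const_mul' _ _ ENNReal.ofReal_ne_top, ← lintegral_hat_sq]
    calc _ ≤ ENNReal.ofReal (((n : ℝ) + 1)⁻¹) *
        (ENNReal.ofReal (C * ((n : ℝ) + 1) * ((n : ℝ) + 1) ^ (2 * s - 1 / 2)) *
          ∫⁻ k, ‖hat (ψ n) k‖ₑ ^ 2) := by
          gcongr
          exact h M n m hm μ _ (measurable_hat _)
      _ = _ := by
        rw [← mul_assoc, ← ENNReal.ofReal_mul (by positivity)]
        congr 2
        field_simp
  calc _ ≤ (M : ℝ≥0∞) * ∑ _μ : Fin M,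
        ENNReal.ofReal (C * ((n : ℝ) + 1) ^ (2 * s - 1 / 2)) * ‖ψ n‖ₑ ^ 2 := by
        gcongr with μ
        exact h3 μ
    _ = (M : ℝ≥0∞) * ((M : ℝ≥0∞) *
          (ENNReal.ofReal (C * ((n : ℝ) + 1) ^ (2 * s - 1 / 2)) * ‖ψ n‖ₑ ^ 2)) := by
        rw [Finset.sum_const, Finset.card_univ, Fintype.card_fin, nsmul_eq_mul]
    _ = (M : ℝ≥0∞) *
          (ENNReal.ofReal (M * (C * ((n : ℝ) + 1) ^ (2 * s - 1 / 2))) * ‖ψ n‖ₑ ^ 2) :=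
        congrArg _ (natCast_mul_ofReal_mul M _ _)
    _ = ENNReal.ofReal (M * (M * (C * ((n : ℝ) + 1) ^ (2 * s - 1 / 2)))) * ‖ψ n‖ₑ ^ 2 :=
        natCast_mul_ofReal_mul M _ _
    _ = ENNReal.ofReal (M * (M * C) * ((n : ℝ) + 1) ^ (2 * s - 1 / 2)) * ‖ψ n‖ₑ ^ 2 :=
        congrArg (fun t => ENNReal.ofReal t * ‖ψ n‖ₑ ^ 2) (by ring)

theorem quasiMeasurePreserving_creation {M n : ℕ} (μ : Fin M) (i : Fin (n + 1)) :
    Measure.QuasiMeasurePreserving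
      (fun k : Conf M (n + 1) => shift μ (k (Sum.inr i)) (remove i k)) volume volume :=
  Measure.quasiMeasurePreserving_fst.comp
    (measurePreserving_creation μ i).quasiMeasurePreserving

theorem measurable_creationHat {M : ℕ} (ψ : Hilb M) (n : ℕ) : Measurable (creationHat ψ n) := by
  cases n with
  | zero => exact measurable_const
  | succ n =>
    have h : ∀ (μ : Fin M) (i : Fin (n + 1)), Measurable fun k : Conf M (n + 1) =>
        hat (ψ n) (shift μ (k (Sum.inr i)) (remove i k)) := fun μ i =>
      (measurable_hat (ψ n)).comp (quasiMeasurePreserving_creation μ i).measurable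
    simp only [funext (creationHat_succ ψ n)]
    exact Finset.measurable_sum _ fun μ _ => (Finset.measurable_sum _ fun i _ => h μ i).const_mul _

theorem creationHat_add {M : ℕ} (φ ψ : Hilb M) (n : ℕ) :
    creationHat (φ + ψ) n =ᵐ[volume] fun k => creationHat φ n k + creationHat ψ n k := by
  cases n with
  | zero => exact Filter.Eventually.of_forall fun k => (add_zero _).symm
  | succ n =>
    have h := ae_all_iff.2 fun μ => ae_all_iff.2 fun i =>
      (quasiMeasurePreserving_creation (M := M) μ i).ae (hat_add (φ n) (ψ n))
    filter_upwards [h] with k hk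
    simp only [creationHat_succ, lp.coeFn_add, Pi.add_apply, hk, Finset.sum_add_distrib, mul_add]

theorem creationHat_smul {M : ℕ} (c : ℂ) (ψ : Hilb M) (n : ℕ) :
    creationHat (c • ψ) n =ᵐ[volume] fun k => c * creationHat ψ n k := by
  cases n with
  | zero => exact Filter.Eventually.of_forall fun k => (mul_zero _).symm
  | succ n =>
    have h := ae_all_iff.2 fun μ => ae_all_iff.2 fun i =>
      (quasiMeasurePreserving_creation (M := M) μ i).ae (hat_smul c (ψ n))
    filter_upwards [h] with k hk
    simp only [creationHat_succ, lp.coeFn_smul, Pi.smul_apply, hk, Finset.mul_sum]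
    refine Finset.sum_congr rfl fun μ _ => Finset.sum_congr rfl fun i _ => ?_
    ring

/-- The permutation that `σ` induces on the indices other than `i`. -/
theorem exists_perm_succAbove {n : ℕ} (σ : Equiv.Perm (Fin (n + 1))) (i : Fin (n + 1)) :
    ∃ τ : Equiv.Perm (Fin n), ∀ j, σ (i.succAbove j) = (σ i).succAbove (τ j) := by
  have h : ∀ j, ∃ l, (σ i).succAbove l = σ (i.succAbove j) := fun j =>
    Fin.exists_succAbove_eq fun h => Fin.succAbove_ne i j (σ.injective h)
  choose τ hτ using h
  have hinj : Function.Injective τ := fun a b hab => by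
    have := (hτ a).symm.trans ((congrArg _ hab).trans (hτ b))
    exact Fin.succAbove_right_injective (σ.injective this)
  exact ⟨Equiv.ofBijective τ (Finite.injective_iff_bijective.1 hinj), fun j => (hτ j).symm⟩

theorem creationHat_perm {M : ℕ} (ψ : Hilb M) (n : ℕ) (σ : Equiv.Perm (Fin n)) :
    (fun k => creationHat ψ n (permConf M n σ k)) =ᵐ[volume] creationHat ψ n := by
  cases n with
  | zero => exact Filter.Eventually.of_forall fun k => rfl
  | succ n =>
    choose τ hτ using exists_perm_succAbove σ
    have h := ae_all_iff.2 fun μ => ae_all_iff.2 fun i =>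
      (quasiMeasurePreserving_creation (M := M) μ (σ i)).ae (hat_perm (ψ n) (τ i))
    filter_upwards [h] with k hk
    have h1 : ∀ μ i, shift μ (permConf M (n + 1) σ k (Sum.inr i))
        (remove i (permConf M (n + 1) σ k)) =
        permConf M n (τ i) (shift μ (k (Sum.inr (σ i))) (remove (σ i) k)) := fun μ i =>
      conf_ext (fun ν => by simp) fun j => by simp [hτ]
    simp only [creationHat_succ, h1, hk]
    refine Finset.sum_congr rfl fun μ _ => ?_
    congr 1
    exact Equiv.sum_comp σ fun i => hat (ψ n) (shift μ (k (Sum.inr i)) (remove i k))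

/-! ### Operators that raise the boson number and decay with it -/

theorem summable_norm_sq {E : ℕ → Type*} [∀ n, NormedAddCommGroup (E n)] (ψ : lp E 2) :
    Summable fun n => ‖ψ n‖ ^ 2 := by
  have hs := lp.hasSum_norm (p := 2) (by simp) ψ
  simp only [ENNReal.toReal_ofNat, Real.rpow_ofNat] at hs
  exact hs.summable

theorem norm_sq_eq_tsum {E : ℕ → Type*} [∀ n, NormedAddCommGroup (E n)] (ψ : lp E 2) :
    ‖ψ‖ ^ 2 = ∑' n, ‖ψ n‖ ^ 2 := by
  have h := lp.norm_rpow_eq_tsum (p := 2) (by simp) ψ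
  simpa only [ENNReal.toReal_ofNat, Real.rpow_ofNat] using h

theorem norm_le_of_forall_shift {E : ℕ → Type*} [∀ n, NormedAddCommGroup (E n)] {ψ χ : lp E 2}
    {k : ℕ} {a : ℝ} (ha : 0 ≤ a) (h1 : ∀ j < k, χ j = 0) (h2 : ∀ n, ‖χ (n + k)‖ ≤ a * ‖ψ n‖) :
    ‖χ‖ ≤ a * ‖ψ‖ := by
  have hχ := summable_norm_sq χ
  have hψ := summable_norm_sq ψ
  have h3 : ∑ j ∈ Finset.range k, ‖χ j‖ ^ 2 = 0 := Finset.sum_eq_zero fun j hj => by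
    rw [h1 j (Finset.mem_range.1 hj), norm_zero, zero_pow two_ne_zero]
  have h4 : ∀ n, ‖χ (n + k)‖ ^ 2 ≤ a ^ 2 * ‖ψ n‖ ^ 2 := fun n => by
    rw [← mul_pow]
    exact pow_le_pow_left₀ (norm_nonneg _) (h2 n) 2
  refine le_of_sq_le_sq ?_ (by positivity)
  rw [mul_pow, norm_sq_eq_tsum χ, norm_sq_eq_tsum ψ]
  rw [← tsum_mul_left, ← hχ.sum_add_tsum_nat_add k, h3, zero_add]
  exact Summable.tsum_le_tsum h4 ((summable_nat_add_iff k).2 hχ) (hψ.mul_left _)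

section RaisesWithDecay

variable {E : ℕ → Type*} [∀ n, NormedAddCommGroup (E n)] [∀ n, InnerProductSpace ℂ (E n)]

theorem memℓp_natCast_smul_iff (ψ : lp E 2) :
    Memℓp (fun n : ℕ => (n : ℂ) • ψ n) 2 ↔ Summable fun n : ℕ => (n : ℝ) ^ 2 * ‖ψ n‖ ^ 2 := by
  rw [memℓp_gen_iff (by simp)]
  simp only [ENNReal.toReal_ofNat, Real.rpow_ofNat, norm_smul, mul_pow, Complex.norm_natCast]

/-- `T` maps the `n`-boson sector to the `(n+1)`-boson sector with norm at most
`C (n + 1)^{-1/4}`. -/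
def RaisesWithDecay (C : ℝ) (T : lp E 2 →L[ℂ] lp E 2) : Prop :=
  ∀ ψ, T ψ 0 = 0 ∧ ∀ n : ℕ, ‖T ψ (n + 1)‖ ≤ C * ((n : ℝ) + 1) ^ (-(1 / 4) : ℝ) * ‖ψ n‖

namespace RaisesWithDecay

variable {C : ℝ} {T : lp E 2 →L[ℂ] lp E 2}

theorem pow_apply (h : RaisesWithDecay C T) (hC : 0 ≤ C) (ψ : lp E 2) (k : ℕ) :
    (∀ j < k, (T ^ k) ψ j = 0) ∧
      ∀ n, ‖(T ^ k) ψ (n + k)‖ ≤ C ^ k * (k.factorial : ℝ) ^ (-(1 / 4) : ℝ) * ‖ψ n‖ := by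
  induction k with
  | zero => exact ⟨fun j hj => absurd hj (Nat.not_lt_zero j), fun n => by simp⟩
  | succ k ih =>
    have hT : (T ^ (k + 1)) ψ = T ((T ^ k) ψ) := by rw [pow_succ']; rfl
    obtain ⟨ih1, ih2⟩ := ih
    rw [hT]
    generalize (T ^ k) ψ = χ at ih1 ih2
    obtain ⟨h0, h1⟩ := h χ
    refine ⟨fun j hj => ?_, fun n => ?_⟩
    · rcases j with _ | j
      · exact h0
      · have h2 := h1 j
        rw [ih1 j (by omega), norm_zero, mul_zero] at h2
        exact norm_le_zero_iff.1 h2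
    · have h2 : (((n + k : ℕ) : ℝ) + 1) ^ (-(1 / 4) : ℝ) ≤ ((k : ℝ) + 1) ^ (-(1 / 4) : ℝ) :=
        Real.rpow_le_rpow_of_nonpos (by positivity)
          (by push_cast; linarith [n.cast_nonneg (α := ℝ)]) (by norm_num)
      have h3 : ‖T χ (n + (k + 1))‖ ≤ _ := h1 (n + k)
      have h4 := ih2 n
      have hy : 0 ≤ ‖χ (n + k)‖ := norm_nonneg _
      have h5 : ((k + 1).factorial : ℝ) ^ (-(1 / 4) : ℝ) =
          ((k : ℝ) + 1) ^ (-(1 / 4) : ℝ) * (k.factorial : ℝ) ^ (-(1 / 4) : ℝ) := by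
        rw [Nat.factorial_succ, Nat.cast_mul, Real.mul_rpow (by positivity) (by positivity)]
        push_cast
        rfl
      rw [h5]
      generalize ‖T χ (n + (k + 1))‖ = x at h3
      generalize ‖χ (n + k)‖ = y at h3 h4 hy
      calc x ≤ C * (((n + k : ℕ) : ℝ) + 1) ^ (-(1 / 4) : ℝ) * y := h3
        _ ≤ C * ((k : ℝ) + 1) ^ (-(1 / 4) : ℝ) *
            (C ^ k * (k.factorial : ℝ) ^ (-(1 / 4) : ℝ) * ‖ψ n‖) := by gcongr
        _ = _ := by rw [pow_succ]; ring

theorem norm_pow_le (h : RaisesWithDecay C T) (hC : 0 ≤ C) (k : ℕ) :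
    ‖T ^ k‖ ≤ C ^ k * (k.factorial : ℝ) ^ (-(1 / 4) : ℝ) := by
  refine ContinuousLinearMap.opNorm_le_bound _ (by positivity) fun ψ => ?_
  obtain ⟨h1, h2⟩ := h.pow_apply hC ψ k
  exact norm_le_of_forall_shift (by positivity) h1 h2

/-- The factorial decay of the powers makes the Neumann series converge whatever the size of `C`. -/
theorem isUnit_one_sub [∀ n, CompleteSpace (E n)] (h : RaisesWithDecay C T) (hC : 0 ≤ C) :
    IsUnit (1 - T) := by
  obtain ⟨k, hk⟩ : ∃ k : ℕ, ‖T ^ k‖ < 1 := by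
    have h1 := FloorSemiring.tendsto_pow_div_factorial_atTop (C ^ 4)
    obtain ⟨k, hk⟩ := (h1.eventually (gt_mem_nhds one_pos)).exists
    refine ⟨k, (h.norm_pow_le hC k).trans_lt ?_⟩
    rw [← pow_lt_one_iff_of_nonneg (by positivity) four_ne_zero, mul_pow, ← pow_mul, mul_comm k,
      pow_mul, ← Real.rpow_natCast ((k.factorial : ℝ) ^ (-(1 / 4) : ℝ)),
      ← Real.rpow_mul (by positivity)]
    norm_num
    rwa [Real.rpow_neg_one, ← div_eq_mul_inv]
  have h2 : IsUnit (1 - T ^ k) := isUnit_one_sub_of_norm_lt_one hk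
  rw [← mul_neg_geom_sum] at h2
  have hcomm : Commute (1 - T) (∑ i ∈ Finset.range k, T ^ i) :=
    Commute.sum_right _ _ _ fun i _ =>
      (Commute.one_left _).sub_left ((Commute.refl T).pow_right i)
  exact (hcomm.isUnit_mul_iff.1 h2).1

theorem sq_le (h : RaisesWithDecay C T) (ψ : lp E 2) (n : ℕ) :
    ((n : ℝ) + 1) ^ 2 * ‖T ψ (n + 1)‖ ^ 2 ≤
      C ^ 2 * ((n : ℝ) + 1) ^ (3 / 2 : ℝ) * ‖ψ n‖ ^ 2 := by
  have hn : (0 : ℝ) < (n : ℝ) + 1 := by positivity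
  calc ((n : ℝ) + 1) ^ 2 * ‖T ψ (n + 1)‖ ^ 2
      ≤ ((n : ℝ) + 1) ^ 2 * (C * ((n : ℝ) + 1) ^ (-(1 / 4) : ℝ) * ‖ψ n‖) ^ 2 := by
        gcongr
        exact (h ψ).2 n
    _ = C ^ 2 * (((n : ℝ) + 1) ^ (2 : ℝ) * ((n : ℝ) + 1) ^ (-(1 / 2) : ℝ)) * ‖ψ n‖ ^ 2 := by
        have : (((n : ℝ) + 1) ^ (-(1 / 4) : ℝ)) ^ 2 = ((n : ℝ) + 1) ^ (-(1 / 2) : ℝ) := by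
          rw [← Real.rpow_natCast, ← Real.rpow_mul hn.le]
          norm_num
        rw [mul_pow, mul_pow, this, Real.rpow_ofNat]
        ring
    _ = _ := by
        rw [← Real.rpow_add hn]
        norm_num

theorem memℓp_sub (h : RaisesWithDecay C T) {ψ : lp E 2}
    (hψ : Memℓp (fun n : ℕ => (n : ℂ) • ψ n) 2) : Memℓp (fun n : ℕ => (n : ℂ) • (ψ - T ψ) n) 2 := by
  have hT : Memℓp (fun n : ℕ => (n : ℂ) • T ψ n) 2 := by
    rw [memℓp_natCast_smul_iff, ← summable_nat_add_iff 1]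
    rw [memℓp_natCast_smul_iff] at hψ
    refine Summable.of_nonneg_of_le (fun n => by positivity) (fun n => ?_)
      (((hψ.add (summable_norm_sq ψ)).mul_left (2 * C ^ 2)))
    have hn : (1 : ℝ) ≤ (n : ℝ) + 1 := by simp
    have h1 : ((n : ℝ) + 1) ^ (3 / 2 : ℝ) ≤ ((n : ℝ) + 1) ^ (2 : ℝ) :=
      Real.rpow_le_rpow_of_exponent_le hn (by norm_num)
    rw [Real.rpow_ofNat] at h1
    push_cast
    calc ((n : ℝ) + 1) ^ 2 * ‖T ψ (n + 1)‖ ^ 2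
        ≤ C ^ 2 * ((n : ℝ) + 1) ^ (3 / 2 : ℝ) * ‖ψ n‖ ^ 2 := h.sq_le ψ n
      _ ≤ C ^ 2 * (2 * ((n : ℝ) ^ 2 + 1)) * ‖ψ n‖ ^ 2 := by
        gcongr
        nlinarith [sq_nonneg ((n : ℝ) - 1)]
      _ = _ := by ring
  refine (hψ.sub hT).mono' fun n => le_of_eq ?_
  simp [smul_sub]

/-- Since `3/2 < 2`, the weight `(n + 1)^{3/2}` is absorbed by `n² / 2` up to a constant. -/
theorem exists_rpow_le (C : ℝ) :
    ∃ D : ℝ, 0 ≤ D ∧ ∀ n : ℕ, 2 * C ^ 2 * ((n : ℝ) + 1) ^ (3 / 2 : ℝ) ≤ (n : ℝ) ^ 2 / 2 + D := by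
  refine ⟨2 * C ^ 2 * (16 * C ^ 2) ^ 3 + 1, by positivity, fun n => ?_⟩
  obtain ⟨y, hy⟩ : ∃ y, y = Real.sqrt ((n : ℝ) + 1) := ⟨_, rfl⟩
  have hy0 : 0 ≤ y := hy ▸ Real.sqrt_nonneg _
  have hy2 : y ^ 2 = (n : ℝ) + 1 := by rw [hy, Real.sq_sqrt (by positivity)]
  have hy3 : ((n : ℝ) + 1) ^ (3 / 2 : ℝ) = y ^ 3 := by
    rw [hy, Real.sqrt_eq_rpow, ← Real.rpow_natCast, ← Real.rpow_mul (by positivity)]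
    norm_num
  have hy4 : y ^ 4 ≤ 2 * (n : ℝ) ^ 2 + 2 := by
    rw [show y ^ 4 = (y ^ 2) ^ 2 by ring, hy2]
    nlinarith [sq_nonneg ((n : ℝ) - 1)]
  rw [hy3]
  rcases le_total (16 * C ^ 2) y with h | h
  · have h1 : 16 * C ^ 2 * y ^ 3 ≤ y * y ^ 3 := by gcongr
    have h2 : 0 ≤ 2 * C ^ 2 * (16 * C ^ 2) ^ 3 := by positivity
    nlinarith
  · have h1 : 2 * C ^ 2 * y ^ 3 ≤ 2 * C ^ 2 * (16 * C ^ 2) ^ 3 := by gcongr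
    nlinarith [sq_nonneg (n : ℝ)]

/-- A solution of `φ - T φ = ψ` inherits membership in `D(N)`: on the high sectors `N T` is small
compared to `N`, so the partial sums of `‖N φ‖²` can be absorbed. -/
theorem memℓp_of_sub (h : RaisesWithDecay C T) {φ ψ : lp E 2}
    (hφ : φ - T φ = ψ) (hψ : Memℓp (fun n : ℕ => (n : ℂ) • ψ n) 2) :
    Memℓp (fun n : ℕ => (n : ℂ) • φ n) 2 := by
  obtain ⟨D, hD, hDn⟩ := exists_rpow_le C
  rw [memℓp_natCast_smul_iff] at hψ ⊢
  set a : ℕ → ℝ := fun n => (n : ℝ) ^ 2 * ‖φ n‖ ^ 2 with ha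
  set b : ℕ → ℝ := fun n => (n : ℝ) ^ 2 * ‖ψ n‖ ^ 2 with hb
  have hstep : ∀ n : ℕ, a (n + 1) ≤ 2 * b (n + 1) + a n / 2 + D * ‖φ n‖ ^ 2 := by
    intro n
    have h1 : φ (n + 1) = ψ (n + 1) + T φ (n + 1) := by
      rw [← hφ]
      simp
    have h2 : ‖φ (n + 1)‖ ^ 2 ≤ 2 * ‖ψ (n + 1)‖ ^ 2 + 2 * ‖T φ (n + 1)‖ ^ 2 := by
      have h3 := norm_add_le (ψ (n + 1)) (T φ (n + 1))
      rw [← h1] at h3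
      nlinarith [norm_nonneg (φ (n + 1)), sq_nonneg (‖ψ (n + 1)‖ - ‖T φ (n + 1)‖)]
    have h4 := h.sq_le φ n
    have h5 := mul_le_mul_of_nonneg_right (hDn n) (sq_nonneg ‖φ n‖)
    have h6 := mul_le_mul_of_nonneg_left h2 (sq_nonneg ((n : ℝ) + 1))
    simp only [ha, hb]
    push_cast
    nlinarith
  have hbs : ∀ K, ∑ n ∈ Finset.range K, b (n + 1) ≤ ∑' n, b n := fun K => by
    have hb1 : Summable fun n => b (n + 1) := (summable_nat_add_iff 1).2 hψ
    refine (hb1.sum_le_tsum _ fun n _ => by positivity).trans ?_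
    rw [hψ.tsum_eq_zero_add]
    simp [hb]
  have hφs : ∀ K, ∑ n ∈ Finset.range K, ‖φ n‖ ^ 2 ≤ ‖φ‖ ^ 2 := fun K => by
    rw [norm_sq_eq_tsum]
    exact (summable_norm_sq φ).sum_le_tsum _ fun n _ => by positivity
  have hb0 : 0 ≤ ∑' n, b n := tsum_nonneg fun n => by positivity
  have hsum : ∀ K, ∑ n ∈ Finset.range K, a n ≤ 2 * (2 * ∑' n, b n + D * ‖φ‖ ^ 2) := by
    intro K
    induction K with
    | zero => simp only [Finset.range_zero, Finset.sum_empty]; positivity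
    | succ K ih =>
      rw [Finset.sum_range_succ']
      have h1 := Finset.sum_le_sum fun n (_ : n ∈ Finset.range K) => hstep n
      rw [Finset.sum_add_distrib, Finset.sum_add_distrib, ← Finset.mul_sum, ← Finset.mul_sum,
        ← Finset.sum_div] at h1
      have h2 : a 0 = 0 := by simp [ha]
      have h3 := mul_le_mul_of_nonneg_left (hφs K) hD
      linarith [hbs K]
  exact summable_of_sum_range_le (fun n => by positivity) hsum

end RaisesWithDecay

/-- If `Y` acts sector by sector, so does the adjoint of its inverse. -/
theorem norm_adjoint_symm_apply_le [∀ n, CompleteSpace (E n)] (Y : lp E 2 ≃L[ℂ] lp E 2)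
    (hY : ∀ v w n, v n = w n → Y v n = Y w n) (g : lp E 2) (j : ℕ) :
    ‖ContinuousLinearMap.adjoint (Y.symm : lp E 2 →L[ℂ] lp E 2) g j‖ ≤
      ‖(Y.symm : lp E 2 →L[ℂ] lp E 2)‖ * ‖g j‖ := by
  set B : lp E 2 →L[ℂ] lp E 2 := (Y.symm : lp E 2 →L[ℂ] lp E 2) with hB
  set h := ContinuousLinearMap.adjoint B g with hh
  set u : lp E 2 := lp.single 2 j (h j) with hu
  have hYB : Y (B u) = u := Y.apply_symm_apply u
  have hw : lp.single 2 j (B u j) = B u := by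
    apply Y.injective
    rw [hYB]
    refine lp.ext (funext fun n => ?_)
    by_cases hn : n = j
    · subst hn
      rw [hY _ (B u) n (by rw [lp.single_apply_self]), hYB]
    · rw [hY _ 0 n (by rw [lp.single_apply_ne _ _ _ hn]; rfl), map_zero, hu,
        lp.single_apply_ne _ _ _ hn]
      rfl
  have h1 : inner ℂ (h j) (h j) = inner ℂ (B u j) (g j) := by
    rw [← lp.inner_single_left j (h j) h, ← lp.inner_single_left j (B u j) g, hw, hh,
      ContinuousLinearMap.adjoint_inner_right]
  have h2 : ‖h j‖ ^ 2 ≤ ‖B‖ * ‖h j‖ * ‖g j‖ := by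
    calc ‖h j‖ ^ 2 = ‖inner ℂ (B u j) (g j)‖ := by
          rw [← h1, inner_self_eq_norm_sq_to_K]
          simp
      _ ≤ ‖B u j‖ * ‖g j‖ := norm_inner_le_norm _ _
      _ ≤ ‖B u‖ * ‖g j‖ := by
        gcongr
        exact lp.norm_apply_le_norm two_ne_zero _ _
      _ ≤ ‖B‖ * ‖u‖ * ‖g j‖ := by
        gcongr
        exact B.le_opNorm u
      _ = _ := by rw [hu, lp.norm_single (by norm_num)]
  rcases (norm_nonneg (h j)).eq_or_lt with h0 | h0
  · rw [← h0]
    positivity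
  · nlinarith

end RaisesWithDecay

/-! ### Multipliers, the interaction and the creation operator on the Hilbert space -/

theorem hat_hilb_add {M : ℕ} (φ ψ : Hilb M) (n : ℕ) :
    hat ((φ + ψ) n) =ᵐ[volume] fun k => hat (φ n) k + hat (ψ n) k :=
  hat_add (φ n) (ψ n)

theorem hat_hilb_smul {M : ℕ} (c : ℂ) (ψ : Hilb M) (n : ℕ) :
    hat ((c • ψ) n) =ᵐ[volume] fun k => c * hat (ψ n) k :=
  hat_smul c (ψ n)

theorem hat_hilb_sub {M : ℕ} (φ ψ : Hilb M) (n : ℕ) :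
    hat ((φ - ψ) n) =ᵐ[volume] fun k => hat (φ n) k - hat (ψ n) k := by
  have h : φ - ψ = φ + (-1 : ℂ) • ψ := by rw [neg_one_smul, sub_eq_add_neg]
  rw [h]
  filter_upwards [hat_hilb_add φ ((-1 : ℂ) • ψ) n, hat_hilb_smul (-1) ψ n] with k h1 h2
  rw [h1, h2, neg_one_mul, sub_eq_add_neg]

/-- The multiplication operator with a bounded symmetric real function in Fourier variables. -/
theorem exists_multiplier {M : ℕ} (w : (n : ℕ) → Conf M n → ℝ) (hm : ∀ n, Measurable (w n))
    (hs : ∀ n (σ : Equiv.Perm (Fin n)) k, w n (permConf M n σ k) = w n k)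
    (hb : ∀ n k, |w n k| ≤ 1) :
    ∃ T : Hilb M →L[ℂ] Hilb M, ∀ ψ n,
      hat (T ψ n) =ᵐ[volume] fun k => (w n k : ℂ) * hat (ψ n) k := by
  refine exists_operator (fun ψ n k => (w n k : ℂ) * hat (ψ n) k) 1 ?_ ?_ ?_ ?_ ?_
  · intro ψ n
    exact ((Complex.measurable_ofReal.comp (hm n)).mul
      (measurable_hat (ψ n))).aestronglyMeasurable
  · intro ψ n σ
    filter_upwards [hat_perm (ψ n) σ] with k hk
    rw [hk, hs]
  · intro φ ψ n
    filter_upwards [hat_hilb_add φ ψ n] with k hk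
    rw [hk, mul_add]
  · intro c ψ n
    filter_upwards [hat_hilb_smul c ψ n] with k hk
    rw [hk, mul_left_comm]
  · intro ψ
    rw [ENNReal.ofReal_one, one_mul, ← tsum_lintegral_hat_sq]
    refine ENNReal.tsum_le_tsum fun n => lintegral_mono fun k => ?_
    refine pow_le_pow_left₀ (by positivity) ?_ 2
    rw [enorm_mul]
    refine mul_le_of_le_one_left (by positivity) ?_
    rw [← ofReal_norm, Complex.norm_real, ← ENNReal.ofReal_one]
    exact ENNReal.ofReal_le_ofReal (hb n k)

/-- The operator `(L + 1)^{-s}`. -/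
theorem exists_energyPow {M : ℕ} {m : ℝ} (hm : 0 < m) {s : ℝ} (hs : 0 ≤ s) :
    ∃ J : Hilb M →L[ℂ] Hilb M, ∀ ψ n,
      hat (J ψ n) =ᵐ[volume] fun k => ((energy m k ^ (-s) : ℝ) : ℂ) * hat (ψ n) k := by
  refine exists_multiplier (fun n k => energy m k ^ (-s))
    (fun n => (measurable_energy m).pow_const _) (fun n σ k => by rw [energy_perm]) fun n k => ?_
  rw [abs_of_nonneg (Real.rpow_nonneg (energy_pos hm k).le _)]
  exact Real.rpow_le_one_of_one_le_of_nonpos (one_le_energy hm k) (by linarith)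

/-- The operator `L^s (L + 1)^{-s}`. -/
theorem exists_freePow_mul_energyPow {M : ℕ} {m : ℝ} (hm : 0 < m) {s : ℝ} (hs : 0 ≤ s) :
    ∃ J : Hilb M →L[ℂ] Hilb M, ∀ ψ n, hat (J ψ n) =ᵐ[volume] fun k =>
      ((freeSymbol m k ^ s * energy m k ^ (-s) : ℝ) : ℂ) * hat (ψ n) k := by
  refine exists_multiplier (fun n k => freeSymbol m k ^ s * energy m k ^ (-s))
    (fun n => ((continuous_freeSymbol m).measurable.pow_const _).mul
      ((measurable_energy m).pow_const _)) (fun n σ k => ?_) fun n k => ?_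
  · have h := energy_perm m σ k
    have h' : freeSymbol m (permConf M n σ k) = freeSymbol m k := by
      unfold energy at h
      linarith
    rw [h, h']
  · have h0 := freeSymbol_nonneg hm k
    have hE := energy_pos hm k
    rw [abs_of_nonneg (by positivity), Real.rpow_neg hE.le, ← div_eq_mul_inv,
      div_le_one (by positivity)]
    exact Real.rpow_le_rpow h0 (by unfold energy; linarith) hs

theorem enorm_add_sq_le (a b : ℂ) : ‖a + b‖ₑ ^ 2 ≤ 2 * (‖a‖ₑ ^ 2 + ‖b‖ₑ ^ 2) := by
  have h := ennreal_sum_sq_le Finset.univ ![‖a‖ₑ, ‖b‖ₑ]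
  simp only [Fin.sum_univ_two, Matrix.cons_val_zero, Matrix.cons_val_one, Finset.card_univ,
    Fintype.card_fin] at h
  rw [show ((Nat.succ 0).succ : ℕ) = 2 from rfl, Nat.cast_ofNat] at h
  exact (pow_le_pow_left₀ (by positivity) (enorm_add_le a b) 2).trans h

theorem measurable_diagSymbol {M n : ℕ} (m : ℝ) :
    Measurable fun k : Conf M n => diagSymbol m k := by
  unfold diagSymbol
  exact (by fun_prop : Continuous _).measurable

theorem diagSymbol_perm {M n : ℕ} (m : ℝ) (σ : Equiv.Perm (Fin n)) (k : Conf M n) :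
    diagSymbol m (permConf M n σ k) = diagSymbol m k := by
  unfold diagSymbol
  simp only [permConf_inl, permConf_inr]
  rw [Equiv.sum_comp σ fun i => ‖k (Sum.inr i)‖ ^ 2]

theorem diagSymbol_nonneg {M n : ℕ} {m : ℝ} (hm : 0 < m) (k : Conf M n) : 0 ≤ diagSymbol m k := by
  unfold diagSymbol
  have : 0 ≤ 2 * m / (2 * m + 1) := by positivity
  have := Real.pi_pos
  positivity

theorem diagSymbol_le {M n : ℕ} {m : ℝ} (hm : 0 < m) (k : Conf M n) :
    diagSymbol m k ≤ (1 / (4 * Real.pi) * (2 * m / (2 * m + 1)) ^ (3 / 2 : ℝ) * M) *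
      Real.sqrt (energy m k) := by
  have hπ := Real.pi_pos
  have h1 : ∀ μ : Fin M, Real.sqrt ((n : ℝ) + 1 + (1 / (2 * m + 1)) * ‖k (Sum.inl μ)‖ ^ 2
      + (1 / (2 * m)) * ∑ ν ∈ Finset.univ.erase μ, ‖k (Sum.inl ν)‖ ^ 2
      + ∑ i, ‖k (Sum.inr i)‖ ^ 2) ≤ Real.sqrt (energy m k) := fun μ => by
    refine Real.sqrt_le_sqrt ?_
    have h2 : 1 / (2 * m + 1) * ‖k (Sum.inl μ)‖ ^ 2 ≤ 1 / (2 * m) * ‖k (Sum.inl μ)‖ ^ 2 := by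
      gcongr
      linarith
    have h3 := Finset.add_sum_erase Finset.univ (fun ν : Fin M => ‖k (Sum.inl ν)‖ ^ 2)
      (Finset.mem_univ μ)
    unfold energy freeSymbol
    rw [← h3, mul_add]
    linarith
  have h2 := Finset.sum_le_sum fun μ (_ : μ ∈ (Finset.univ : Finset (Fin M))) => h1 μ
  rw [Finset.sum_const, Finset.card_univ, Fintype.card_fin, nsmul_eq_mul] at h2
  unfold diagSymbol
  rw [mul_assoc _ (M : ℝ)]
  have : 0 ≤ 2 * m / (2 * m + 1) := by positivity
  gcongr

theorem abs_diagSymbol_add_mul_le {M n : ℕ} {m : ℝ} (hm : 0 < m) {s : ℝ} (hs : s ≤ 1 / 2) (c : ℝ)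
    (k : Conf M n) :
    |diagSymbol m k + c| * energy m k ^ (s - 1) ≤
      1 / (4 * Real.pi) * (2 * m / (2 * m + 1)) ^ (3 / 2 : ℝ) * M + |c| := by
  have hE := one_le_energy hm k
  have hE0 := energy_pos hm k
  have h1 : Real.sqrt (energy m k) * energy m k ^ (s - 1) ≤ 1 := by
    rw [Real.sqrt_eq_rpow, ← Real.rpow_add hE0]
    exact Real.rpow_le_one_of_one_le_of_nonpos hE (by linarith)
  have h2 : energy m k ^ (s - 1) ≤ 1 := Real.rpow_le_one_of_one_le_of_nonpos hE (by linarith)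
  have h3 : 0 ≤ 1 / (4 * Real.pi) * (2 * m / (2 * m + 1)) ^ (3 / 2 : ℝ) * M := by
    have := Real.pi_pos
    have : 0 ≤ 2 * m / (2 * m + 1) := by positivity
    positivity
  have h4 : |diagSymbol m k + c| ≤
      1 / (4 * Real.pi) * (2 * m / (2 * m + 1)) ^ (3 / 2 : ℝ) * M * Real.sqrt (energy m k)
        + |c| :=
    (abs_add_le _ _).trans
      (by rw [abs_of_nonneg (diagSymbol_nonneg hm k)]; linarith [diagSymbol_le hm k])
  calc _ ≤ (1 / (4 * Real.pi) * (2 * m / (2 * m + 1)) ^ (3 / 2 : ℝ) * M * Real.sqrt (energy m k)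
        + |c|) * energy m k ^ (s - 1) := by gcongr
    _ = 1 / (4 * Real.pi) * (2 * m / (2 * m + 1)) ^ (3 / 2 : ℝ) * M *
          (Real.sqrt (energy m k) * energy m k ^ (s - 1)) + |c| * energy m k ^ (s - 1) := by ring
    _ ≤ _ := add_le_add (mul_le_of_le_one_right h3 h1)
      (mul_le_of_le_one_right (abs_nonneg _) h2)

/-- `(L + 1)^a` applied in Fourier variables. -/
noncomputable def weighted {M n : ℕ} (m a : ℝ) (f : Conf M n → ℂ) (k : Conf M n) : ℂ :=
  ((energy m k ^ a : ℝ) : ℂ) * f k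

theorem measurable_weighted {M n : ℕ} (m a : ℝ) {f : Conf M n → ℂ} (hf : Measurable f) :
    Measurable (weighted m a f) :=
  (Complex.measurable_ofReal.comp ((measurable_energy m).pow_const a)).mul hf

/-- The condition `s ≤ 1/4` is `2 (s - 1) + 3/2 ≤ 0`. -/
theorem lintegral_weighted_le {M n : ℕ} {m : ℝ} (hm : 0 < m) {s : ℝ} (hs : s ≤ 1 / 4)
    (f : Conf M n → ℂ) :
    ∫⁻ k, ‖weighted m (s - 1) f k‖ₑ ^ 2 * ENNReal.ofReal (energy m k ^ (3 / 2 : ℝ)) ≤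
      ∫⁻ k, ‖f k‖ₑ ^ 2 := by
  refine lintegral_mono fun k => ?_
  have hE0 := energy_pos hm k
  dsimp only
  rw [weighted, enorm_mul, mul_pow, ← ofReal_norm, Complex.norm_real,
    Real.norm_of_nonneg (by positivity), ofReal_rpow_sq (b := 2 * (s - 1)) hE0.le _ rfl,
    mul_right_comm, ← ENNReal.ofReal_mul (by positivity), ← Real.rpow_add hE0]
  refine mul_le_of_le_one_left (by positivity) ?_
  rw [← ENNReal.ofReal_one]
  exact ENNReal.ofReal_le_ofReal
    (Real.rpow_le_one_of_one_le_of_nonpos (one_le_energy hm k) (by linarith))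

/-- The Fourier variables expression of `(T + c) (L + 1)^{s - 1}`. -/
noncomputable def interaction {M n : ℕ} (m c s : ℝ) (f : Conf M n → ℂ) (k : Conf M n) : ℂ :=
  ((diagSymbol m k + c : ℝ) : ℂ) * weighted m (s - 1) f k + offDiag m (weighted m (s - 1) f) k

theorem weighted_congr {M n : ℕ} (m a : ℝ) {f g : Conf M n → ℂ} (h : f =ᵐ[volume] g) :
    weighted m a f =ᵐ[volume] weighted m a g := by
  filter_upwards [h] with k hk
  rw [weighted, weighted, hk]

theorem weighted_add_exponent {M n : ℕ} {m : ℝ} (hm : 0 < m) (a b : ℝ) (f : Conf M n → ℂ) :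
    weighted m a (weighted m b f) = weighted m (a + b) f := by
  funext k
  simp only [weighted]
  rw [Real.rpow_add (energy_pos hm k), Complex.ofReal_mul, mul_assoc]

theorem interaction_congr {M n : ℕ} (m c s : ℝ) {f g : Conf M n → ℂ} (h : f =ᵐ[volume] g) :
    interaction m c s f =ᵐ[volume] interaction m c s g := by
  filter_upwards [weighted_congr m (s - 1) h, offDiag_congr m (weighted_congr m (s - 1) h)]
    with k h1 h2
  rw [interaction, interaction, h1, h2]

theorem interaction_weighted {M n : ℕ} {m : ℝ} (hm : 0 < m) (c s : ℝ) (f : Conf M n → ℂ) :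
    interaction m c s (weighted m (-s) f) = interaction m c 0 f := by
  funext k
  rw [interaction, interaction, weighted_add_exponent hm, show s - 1 + -s = 0 - 1 by ring]

theorem measurable_interaction {M n : ℕ} (m c s : ℝ) {f : Conf M n → ℂ} (hf : Measurable f) :
    Measurable (interaction m c s f) :=
  ((Complex.measurable_ofReal.comp ((measurable_diagSymbol m).add_const c)).mul
    (measurable_weighted m _ hf)).add (measurable_offDiag m (measurable_weighted m _ hf))

theorem interaction_perm {M n : ℕ} (m c s : ℝ) {f : Conf M n → ℂ} (σ : Equiv.Perm (Fin n))
    (hf : (fun k => f (permConf M n σ k)) =ᵐ[volume] f) :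
    (fun k => interaction m c s f (permConf M n σ k)) =ᵐ[volume] interaction m c s f := by
  have h1 : (fun k => weighted m (s - 1) f (permConf M n σ k)) =ᵐ[volume]
      weighted m (s - 1) f := by
    filter_upwards [hf] with k hk
    simp only [weighted, energy_perm, hk]
  filter_upwards [h1, offDiag_congr m h1] with k h2 h3
  rw [interaction, interaction, h2, offDiag_perm, h3, diagSymbol_perm]

theorem interaction_smul {M n : ℕ} (m c s : ℝ) (a : ℂ) (f : Conf M n → ℂ) :
    interaction m c s (fun k => a * f k) = fun k => a * interaction m c s f k := by
  funext k
  have h : weighted m (s - 1) (fun k => a * f k) = fun k => a * weighted m (s - 1) f k := by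
    funext k
    simp only [weighted]
    ring
  rw [interaction, interaction, h, offDiag_smul]
  ring

theorem interaction_add {M n : ℕ} {m : ℝ} (hm : 0 < m) (c : ℝ) {s : ℝ} (hs : s ≤ 1 / 4)
    {f g : Conf M n → ℂ} (hf : Measurable f) (hg : Measurable g)
    (hfin : ∫⁻ k, ‖f k‖ₑ ^ 2 ≠ ∞) (hgin : ∫⁻ k, ‖g k‖ₑ ^ 2 ≠ ∞) :
    interaction m c s (fun k => f k + g k) =ᵐ[volume]
      fun k => interaction m c s f k + interaction m c s g k := by
  have h : weighted m (s - 1) (fun k => f k + g k) =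
      fun k => weighted m (s - 1) f k + weighted m (s - 1) g k := by
    funext k
    simp only [weighted, mul_add]
  filter_upwards [offDiag_add hm (measurable_weighted m (s - 1) hf)
    (measurable_weighted m (s - 1) hg)
    (ne_top_of_le_ne_top hfin (lintegral_weighted_le hm hs f))
    (ne_top_of_le_ne_top hgin (lintegral_weighted_le hm hs g))] with k hk
  rw [interaction, interaction, interaction, h, hk]
  ring

theorem exists_lintegral_interaction_sq_le (M : ℕ) {m : ℝ} (hm : 0 < m) (c : ℝ) {s : ℝ}
    (hs : s ≤ 1 / 4) :
    ∃ C : ℝ, ∀ (n : ℕ) (f : Conf M n → ℂ), Measurable f →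
      ∫⁻ k, ‖interaction m c s f k‖ₑ ^ 2 ≤ ENNReal.ofReal C * ∫⁻ k, ‖f k‖ₑ ^ 2 := by
  obtain ⟨C, hC, hoff⟩ := exists_lintegral_offDiagAbs_sq_le M hm
  obtain ⟨D, hD⟩ : ∃ D, D = 1 / (4 * Real.pi) * (2 * m / (2 * m + 1)) ^ (3 / 2 : ℝ) * M + |c| :=
    ⟨_, rfl⟩
  have htop : 2 * (ENNReal.ofReal D ^ 2 + C) ≠ ∞ := by finiteness
  refine ⟨(2 * (ENNReal.ofReal D ^ 2 + C)).toReal, fun n f hf => ?_⟩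
  have hdiag : ∀ k, ‖((diagSymbol m k + c : ℝ) : ℂ) * weighted m (s - 1) f k‖ₑ ^ 2 ≤
      ENNReal.ofReal D ^ 2 * ‖f k‖ₑ ^ 2 := fun k => by
    rw [← mul_pow]
    refine pow_le_pow_left₀ (by positivity) ?_ 2
    rw [weighted, ← mul_assoc, enorm_mul, ← Complex.ofReal_mul, ← ofReal_norm,
      Complex.norm_real, Real.norm_eq_abs, abs_mul,
      abs_of_nonneg (Real.rpow_nonneg (energy_pos hm k).le _)]
    gcongr
    rw [hD]
    exact abs_diagSymbol_add_mul_le hm (by linarith) c k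
  rw [ENNReal.ofReal_toReal htop]
  calc _ ≤ ∫⁻ k, 2 * (ENNReal.ofReal D ^ 2 * ‖f k‖ₑ ^ 2 +
        offDiagAbs m (weighted m (s - 1) f) k ^ 2) := by
        refine lintegral_mono fun k => (enorm_add_sq_le _ _).trans ?_
        gcongr
        · exact hdiag k
        · exact enorm_offDiag_le hm _ k
    _ = 2 * (ENNReal.ofReal D ^ 2 * (∫⁻ k, ‖f k‖ₑ ^ 2) +
        ∫⁻ k, offDiagAbs m (weighted m (s - 1) f) k ^ 2) := by
        rw [lintegral_const_mul' _ _ (by simp), lintegral_add_left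
          ((hf.enorm.pow_const 2).const_mul _), lintegral_const_mul' _ _ (by finiteness)]
    _ ≤ 2 * (ENNReal.ofReal D ^ 2 * (∫⁻ k, ‖f k‖ₑ ^ 2) + C * ∫⁻ k, ‖f k‖ₑ ^ 2) := by
        refine mul_le_mul_right (add_le_add le_rfl ?_) _
        exact (hoff n _ (measurable_weighted m _ hf)).trans
          (mul_le_mul_right (lintegral_weighted_le hm hs _) _)
    _ = _ := by ring

theorem lintegral_hat_sq_ne_top {M n : ℕ} (ψ : Sector M n) : ∫⁻ k, ‖hat ψ k‖ₑ ^ 2 ≠ ∞ := by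
  rw [lintegral_hat_sq]
  simp

/-- The operator `(T + c) (L + 1)^{s - 1}` is bounded for `s ≤ 1/4`. -/
theorem exists_interaction (M : ℕ) {m : ℝ} (hm : 0 < m) (c : ℝ) {s : ℝ} (hs : s ≤ 1 / 4) :
    ∃ X : Hilb M →L[ℂ] Hilb M, ∀ ψ n,
      hat (X ψ n) =ᵐ[volume] interaction m c s (hat (ψ n)) := by
  obtain ⟨C, hC⟩ := exists_lintegral_interaction_sq_le M hm c hs
  refine exists_operator (fun ψ n => interaction m c s (hat (ψ n))) C ?_ ?_ ?_ ?_ ?_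
  · exact fun ψ n => (measurable_interaction m c s (measurable_hat (ψ n))).aestronglyMeasurable
  · exact fun ψ n σ => interaction_perm m c s σ (hat_perm (ψ n) σ)
  · exact fun φ ψ n => (interaction_congr m c s (hat_hilb_add φ ψ n)).trans
      (interaction_add hm c hs (measurable_hat _) (measurable_hat _)
        (lintegral_hat_sq_ne_top _) (lintegral_hat_sq_ne_top _))
  · intro a ψ n
    have h := interaction_congr m c s (hat_hilb_smul a ψ n)
    rwa [interaction_smul] at h
  · intro ψ
    have h := ENNReal.tsum_le_tsum fun n => hC n (hat (ψ n)) (measurable_hat (ψ n))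
    rw [ENNReal.tsum_mul_left, tsum_lintegral_hat_sq] at h
    exact h

theorem enorm_ofReal_smul_sq {E : Type*} [NormedAddCommGroup E] [NormedSpace ℂ E] {r : ℝ}
    (hr : 0 ≤ r) (v : E) : ‖(r : ℂ) • v‖ₑ ^ 2 = ENNReal.ofReal (r ^ 2) * ‖v‖ₑ ^ 2 := by
  rw [enorm_smul, mul_pow, ← ofReal_norm (r : ℂ), Complex.norm_real, Real.norm_of_nonneg hr,
    ENNReal.ofReal_pow hr]

theorem norm_le_of_enorm_sq_le {E F : Type*} [NormedAddCommGroup E] [NormedAddCommGroup F]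
    {C : ℝ} (hC : 0 ≤ C) {v : E} {w : F} (h : ‖v‖ₑ ^ 2 ≤ ENNReal.ofReal C * ‖w‖ₑ ^ 2) :
    ‖v‖ ≤ Real.sqrt C * ‖w‖ := by
  rw [← ofReal_norm, ← ofReal_norm, ← ENNReal.ofReal_pow (norm_nonneg _),
    ← ENNReal.ofReal_pow (norm_nonneg _), ← ENNReal.ofReal_mul hC] at h
  refine le_of_sq_le_sq ?_ (by positivity)
  rw [mul_pow, Real.sq_sqrt hC]
  exact (ENNReal.ofReal_le_ofReal_iff (by positivity)).1 h

theorem norm_ofReal_smul {E : Type*} [NormedAddCommGroup E] [NormedSpace ℂ E] {r : ℝ}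
    (hr : 0 ≤ r) (v : E) : ‖(r : ℂ) • v‖ = r * ‖v‖ := by
  rw [norm_smul, Complex.norm_real, Real.norm_of_nonneg hr]

theorem enorm_numberPow_sq_le {M : ℕ} {a : ℝ} (ha : a ≤ 0) (ψ : Hilb M) :
    ‖numberPow a ha ψ‖ₑ ^ 2 ≤ ‖ψ‖ₑ ^ 2 := by
  rw [← tsum_enorm_sq, ← tsum_enorm_sq]
  refine ENNReal.tsum_le_tsum fun n => ?_
  have hr : (0 : ℝ) ≤ ((n : ℝ) + 1) ^ a := by positivity
  refine (le_of_eq (enorm_ofReal_smul_sq hr (ψ n))).trans (mul_le_of_le_one_left zero_le ?_)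
  rw [← ENNReal.ofReal_one]
  exact ENNReal.ofReal_le_ofReal (pow_le_one₀ hr
    (Real.rpow_le_one_of_one_le_of_nonpos (by simp) ha))

theorem lintegral_sq_of_hat_eq {M n : ℕ} {ψ : Sector M n} {f : Conf M n → ℂ}
    (h : hat ψ =ᵐ[volume] f) : ∫⁻ k, ‖f k‖ₑ ^ 2 = ‖ψ‖ₑ ^ 2 := by
  rw [← lintegral_hat_sq]
  refine lintegral_congr_ae ?_
  filter_upwards [h] with k hk
  rw [hk]

/-- The Fourier transform of `-∑_μ (L + 1)^{s - 1} a*(δ_{x_μ}) ψ`. -/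
noncomputable def createdHat {M : ℕ} (m s : ℝ) (ψ : Hilb M) (n : ℕ) (k : Conf M n) : ℂ :=
  weighted m (s - 1) (fun k => -creationHat ψ n k) k

theorem enorm_createdHat {M : ℕ} {m : ℝ} (hm : 0 < m) (s : ℝ) (ψ : Hilb M) (n : ℕ)
    (k : Conf M n) : ‖createdHat m s ψ n k‖ₑ =
      ENNReal.ofReal (energy m k ^ (s - 1)) * ‖creationHat ψ n k‖ₑ := by
  rw [createdHat, weighted, enorm_mul, enorm_neg, ← ofReal_norm, Complex.norm_real,
    Real.norm_of_nonneg (Real.rpow_nonneg (energy_pos hm k).le _)]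

theorem createdHat_zero {M : ℕ} (m s : ℝ) (ψ : Hilb M) (k : Conf M 0) :
    createdHat m s ψ 0 k = 0 := by
  simp [createdHat, weighted, creationHat]

theorem exists_lintegral_createdHat_le (M : ℕ) {m : ℝ} (hm : 0 < m) {s : ℝ} (hs : s < 1 / 4) :
    ∃ C : ℝ, 0 ≤ C ∧ ∀ (ψ : Hilb M) (n : ℕ),
      ∫⁻ k, ‖createdHat m s ψ (n + 1) k‖ₑ ^ 2 ≤
        ENNReal.ofReal C * ‖((((n : ℝ) + 1) ^ (s - 1 / 4) : ℝ) : ℂ) • ψ n‖ₑ ^ 2 := by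
  obtain ⟨C, hC, h⟩ := exists_lintegral_creationHat_le M hm hs
  refine ⟨C, hC, fun ψ n => ?_⟩
  have hn : (0 : ℝ) ≤ (n : ℝ) + 1 := by positivity
  have hr : (0 : ℝ) ≤ ((n : ℝ) + 1) ^ (s - 1 / 4) := by positivity
  have h1 : (((n : ℝ) + 1) ^ (s - 1 / 4)) ^ 2 = ((n : ℝ) + 1) ^ (2 * s - 1 / 2) := by
    rw [← Real.rpow_natCast, ← Real.rpow_mul hn]
    congr 1
    push_cast
    ring
  have h2 := enorm_ofReal_smul_sq hr (ψ n)
  rw [h1] at h2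
  have h3 := congrArg (ENNReal.ofReal C * ·) h2
  simp only [← mul_assoc, ← ENNReal.ofReal_mul hC] at h3
  refine le_trans (le_of_eq (lintegral_congr fun k => ?_)) ((h n ψ).trans h3.ge)
  rw [enorm_createdHat hm]

theorem tsum_lintegral_createdHat_le {M : ℕ} {m s C : ℝ} (ha : s - 1 / 4 ≤ 0) (ψ : Hilb M)
    (h : ∀ n : ℕ, ∫⁻ k, ‖createdHat m s ψ (n + 1) k‖ₑ ^ 2 ≤
        ENNReal.ofReal C * ‖((((n : ℝ) + 1) ^ (s - 1 / 4) : ℝ) : ℂ) • ψ n‖ₑ ^ 2) :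
    ∑' n, ∫⁻ k, ‖createdHat m s ψ n k‖ₑ ^ 2 ≤
      ENNReal.ofReal C * ‖numberPow (s - 1 / 4) ha ψ‖ₑ ^ 2 := by
  have h0 : ∫⁻ k, ‖createdHat m s ψ 0 k‖ₑ ^ 2 = 0 := by
    simp only [createdHat_zero]
    simp
  rw [tsum_eq_zero_add' ENNReal.summable, h0, zero_add, ← tsum_enorm_sq, ← ENNReal.tsum_mul_left]
  exact ENNReal.tsum_le_tsum h

theorem createdHat_weighted {M : ℕ} {m : ℝ} (hm : 0 < m) (s : ℝ) (ψ : Hilb M) (n : ℕ) :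
    weighted m (-s) (createdHat m s ψ n) = createdHat m 0 ψ n := by
  have h : ∀ s, createdHat m s ψ n = weighted m (s - 1) (fun k => -creationHat ψ n k) :=
    fun s => rfl
  rw [h, h, weighted_add_exponent hm, show -s + (s - 1) = 0 - 1 by ring]

/-- The operator `-∑_μ (L + 1)^{s - 1} a*(δ_{x_μ})` is bounded for `s < 1/4`, and gains the power
`s - 1/4` of the particle number. -/
theorem exists_creation (M : ℕ) {m : ℝ} (hm : 0 < m) {s : ℝ} (hs : s < 1 / 4) :
    ∃ (G : Hilb M →L[ℂ] Hilb M) (C : ℝ), 0 ≤ C ∧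
      (∀ ψ n, hat (G ψ n) =ᵐ[volume] createdHat m s ψ n) ∧
      (∀ ψ n, ‖G ψ (n + 1)‖ ≤ C * (((n : ℝ) + 1) ^ (s - 1 / 4) * ‖ψ n‖)) ∧
      ∀ ψ, ‖G ψ‖ ≤ C * ‖numberPow (s - 1 / 4) (by linarith) ψ‖ := by
  obtain ⟨C, hC, hsec⟩ := exists_lintegral_createdHat_le M hm hs
  have ha : s - 1 / 4 ≤ 0 := by linarith
  have htot := fun ψ => tsum_lintegral_createdHat_le ha ψ (hsec ψ)
  have hop : ∃ G : Hilb M →L[ℂ] Hilb M, ∀ ψ n, hat (G ψ n) =ᵐ[volume] createdHat m s ψ n := by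
    refine exists_operator (createdHat m s) C ?_ ?_ ?_ ?_ ?_
    · exact fun ψ n =>
        (measurable_weighted m _ (measurable_creationHat ψ n).neg).aestronglyMeasurable
    · intro ψ n σ
      filter_upwards [creationHat_perm ψ n σ] with k hk
      rw [createdHat, createdHat, weighted, weighted, hk, energy_perm]
    · intro φ ψ n
      filter_upwards [creationHat_add φ ψ n] with k hk
      simp only [createdHat, weighted, hk]
      ring
    · intro c ψ n
      filter_upwards [creationHat_smul c ψ n] with k hk
      simp only [createdHat, weighted, hk]
      ring
    · exact fun ψ => (htot ψ).trans (mul_le_mul_right (enorm_numberPow_sq_le ha ψ) _)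
  obtain ⟨G, hG⟩ := hop
  refine ⟨G, Real.sqrt C, Real.sqrt_nonneg _, hG, fun ψ n => ?_, fun ψ => ?_⟩
  · have h1 := (hsec ψ n).trans_eq' (lintegral_sq_of_hat_eq (hG ψ (n + 1)))
    have hr : (0 : ℝ) ≤ ((n : ℝ) + 1) ^ (s - 1 / 4) := by positivity
    exact (norm_le_of_enorm_sq_le hC h1).trans_eq (congrArg _ (norm_ofReal_smul hr (ψ n)))
  · exact norm_le_of_enorm_sq_le hC ((htot ψ).trans_eq'
      ((tsum_congr fun n => lintegral_sq_of_hat_eq (hG ψ n)).trans (tsum_enorm_sq _)))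

/-! ### The resolvent of `K` and its dual -/

section

variable {H : Type*} [NormedAddCommGroup H] [InnerProductSpace ℂ H] [CompleteSpace H]

theorem inner_adjoint_symm (Y : H ≃L[ℂ] H) (v g : H) :
    inner ℂ (Y v) (ContinuousLinearMap.adjoint (Y.symm : H →L[ℂ] H) g) = inner ℂ v g := by
  rw [ContinuousLinearMap.adjoint_inner_right]
  simp

theorem eq_adjoint_symm (Y : H ≃L[ℂ] H) {g η : H}
    (h : ∀ v, inner ℂ (Y v) η = inner ℂ v g) :
    η = ContinuousLinearMap.adjoint (Y.symm : H →L[ℂ] H) g := by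
  refine ext_inner_left ℂ fun w => ?_
  have h1 := (h (Y.symm w)).trans (inner_adjoint_symm Y (Y.symm w) g).symm
  rwa [Y.apply_symm_apply] at h1

/-- The equation satisfied by the dual of `(1 + X J)⁻¹` exhibits its values as elements of the
range of `J`. -/
theorem adjoint_symm_eq (Y : H ≃L[ℂ] H) (X J : H →L[ℂ] H) (hY : ∀ v, Y v = v + X (J v))
    (hJ : ∀ v w, inner ℂ (J v) w = inner ℂ v (J w)) (g : H) :
    ContinuousLinearMap.adjoint (Y.symm : H →L[ℂ] H) (J g) =
      J (g - ContinuousLinearMap.adjoint X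
        (ContinuousLinearMap.adjoint (Y.symm : H →L[ℂ] H) (J g))) := by
  refine ext_inner_left ℂ fun v => ?_
  have h := inner_adjoint_symm Y v (J g)
  rw [hY, inner_add_left] at h
  rw [map_sub, inner_sub_right, ← h, ← hJ v, ContinuousLinearMap.adjoint_inner_right X,
    add_sub_cancel_right]

theorem exists_norm_sub_adjoint_le (B X J Q : H →L[ℂ] H) :
    ∃ C : ℝ, 0 ≤ C ∧ ∀ g, ‖Q (g - ContinuousLinearMap.adjoint X (B (J g)))‖ ≤ C * ‖g‖ :=
  ⟨‖Q ∘L (ContinuousLinearMap.id ℂ H - ContinuousLinearMap.adjoint X ∘L (B ∘L J))‖,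
    norm_nonneg _, fun g => ContinuousLinearMap.le_opNorm
      (Q ∘L (ContinuousLinearMap.id ℂ H - ContinuousLinearMap.adjoint X ∘L (B ∘L J))) g⟩

end

theorem add_neg_smul_add_smul {V : Type*} [AddCommGroup V] [Module ℂ V] (c : ℝ) (v w : V) :
    v + ((-c : ℝ) : ℂ) • w + (c : ℂ) • w = v := by
  rw [Complex.ofReal_neg, neg_smul, neg_add_cancel_right]

theorem hasSum_of_eq_neg_inner {E : ℕ → Type*} [∀ n, NormedAddCommGroup (E n)]
    [∀ n, InnerProductSpace ℂ (E n)] (v w : lp E 2) {f : ℕ → ℂ}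
    (h : ∀ n, f n = -(inner ℂ (v n) (w n))) : HasSum f (-(inner ℂ v w)) := by
  rw [funext h]
  exact (lp.hasSum_inner (𝕜 := ℂ) v w).neg

theorem memLp_hat {M n : ℕ} (ψ : Sector M n) : MemLp (hat ψ) 2 volume :=
  memLp_two_of_lintegral (measurable_hat ψ).aestronglyMeasurable (lintegral_hat_sq_ne_top ψ)

theorem integrable_conj_hat_mul_hat {M n : ℕ} (φ ψ : Sector M n) :
    Integrable fun k => conj (hat φ k) * hat ψ k := by
  have h := (memLp_hat φ).star.integrable_mul (memLp_hat ψ)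
  exact h

theorem inner_eq_of_hat_eq {M n : ℕ} {w : Conf M n → ℝ} {φ ψ φ' ψ' : Sector M n}
    (hφ : hat φ' =ᵐ[volume] fun k => (w k : ℂ) * hat φ k)
    (hψ : hat ψ' =ᵐ[volume] fun k => (w k : ℂ) * hat ψ k) :
    (inner ℂ φ' ψ : ℂ) = inner ℂ φ ψ' := by
  rw [← integral_conj_hat_mul_hat, ← integral_conj_hat_mul_hat]
  refine integral_congr_ae ?_
  filter_upwards [hφ, hψ] with k h1 h2
  rw [h1, h2, map_mul, Complex.conj_ofReal]
  ring

/-- Multiplication by a real function in Fourier variables is symmetric. -/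
theorem inner_multiplier {M : ℕ} {w : (n : ℕ) → Conf M n → ℝ} {T : Hilb M →L[ℂ] Hilb M}
    (hT : ∀ ψ n, hat (T ψ n) =ᵐ[volume] fun k => (w n k : ℂ) * hat (ψ n) k) (φ ψ : Hilb M) :
    (inner ℂ (T φ) ψ : ℂ) = inner ℂ φ (T ψ) := by
  rw [lp.inner_eq_tsum, lp.inner_eq_tsum]
  exact tsum_congr fun n => inner_eq_of_hat_eq (hT φ n) (hT ψ n)

theorem isK_unique {M : ℕ} {m : ℝ} {φ χ χ' : Hilb M} (h : IsK m φ χ) (h' : IsK m φ χ') :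
    χ = χ' :=
  hilb_ext fun n => (h.2 n).trans (h'.2 n).symm

section

variable {M : ℕ} {m c₀ : ℝ} {J X : Hilb M →L[ℂ] Hilb M}

theorem interaction_zero {n : ℕ} (m c : ℝ) (f : Conf M n → ℂ) (k : Conf M n) :
    interaction m c 0 f k = ((diagSymbol m k : ℂ) + c) * weighted m (-1) f k +
      offDiag m (weighted m (-1) f) k := by
  rw [interaction, zero_sub, Complex.ofReal_add]

theorem energy_eq_add_one {n : ℕ} (m : ℝ) (k : Conf M n) :
    ((energy m k : ℝ) : ℂ) = (freeSymbol m k : ℂ) + 1 := by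
  unfold energy
  push_cast
  rfl

theorem energy_mul_weighted {n : ℕ} (hm : 0 < m) (f : Conf M n → ℂ) (k : Conf M n) :
    (energy m k : ℂ) * weighted m (-1) f k = f k := by
  rw [weighted, Real.rpow_neg_one, Complex.ofReal_inv,
    mul_inv_cancel_left₀ (Complex.ofReal_ne_zero.2 (energy_pos hm k).ne')]

/-- On the range of `(L + 1)^{-1}`, the domain of `K`, one has
`(K + c₀) (L + 1)^{-1} = 1 + (T + c₀ - 1) (L + 1)^{-1}`. -/
theorem isK_of_hat_eq (hm : 0 < m)
    (hJ : ∀ ψ n, hat (J ψ n) =ᵐ[volume] weighted m (-1) (hat (ψ n)))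
    (hX : ∀ ψ n, hat (X ψ n) =ᵐ[volume] interaction m (c₀ - 1) 0 (hat (ψ n))) (v : Hilb M) :
    IsK m (J v) (v + X v - (c₀ : ℂ) • J v) := by
  have hE : ∀ n (k : Conf M n), hat (v n) k =
      ((freeSymbol m k : ℂ) + 1) * weighted m (-1) (hat (v n)) k := fun n k => by
    rw [← energy_eq_add_one, energy_mul_weighted hm]
  refine ⟨⟨v - J v, fun n => ?_⟩, fun n => ?_⟩
  · filter_upwards [hat_hilb_sub v (J v) n, hJ v n] with k h1 h2
    rw [Real.rpow_one]
    linear_combination h1 + hE n k - (1 + (freeSymbol m k : ℂ)) * h2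
  · filter_upwards [hat_hilb_sub (v + X v) ((c₀ : ℂ) • J v) n, hat_hilb_add v (X v) n,
      hat_hilb_smul (c₀ : ℂ) (J v) n, hJ v n, hX v n, offDiag_congr m (hJ v n)]
      with k h1 h2 h3 h4 h5 h6
    have h7 := h5.trans (interaction_zero m (c₀ - 1) _ k)
    rw [Complex.ofReal_sub, Complex.ofReal_one] at h7
    linear_combination h1 + h2 - h3 + h7 - h6 + hE n k -
      ((freeSymbol m k : ℂ) + (diagSymbol m k : ℂ) + (c₀ : ℂ)) * h4

/-- Conversely, every element of the graph of `K` arises from some `v`, namely from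
`v = (L + 1) φ`. -/
theorem exists_of_isK (hm : 0 < m)
    (hJ : ∀ ψ n, hat (J ψ n) =ᵐ[volume] weighted m (-1) (hat (ψ n)))
    (hX : ∀ ψ n, hat (X ψ n) =ᵐ[volume] interaction m (c₀ - 1) 0 (hat (ψ n))) {φ χ : Hilb M}
    (h : IsK m φ χ) : ∃ v, J v = φ ∧ v + X v = χ + (c₀ : ℂ) • φ := by
  obtain ⟨ψ, hψ⟩ := h.1
  have hJv : J (ψ + φ) = φ := hilb_ext fun n => by
    filter_upwards [hJ (ψ + φ) n, hat_hilb_add ψ φ n, hψ n] with k h1 h2 h3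
    have h0 : (energy m k : ℂ) ≠ 0 := Complex.ofReal_ne_zero.2 (energy_pos hm k).ne'
    have h4 := energy_mul_weighted hm (hat ((ψ + φ) n)) k
    rw [Real.rpow_one] at h3
    refine mul_left_cancel₀ h0 ?_
    linear_combination (energy m k : ℂ) * h1 + h4 + h2 + h3 -
      hat (φ n) k * energy_eq_add_one m k
  have h1 := isK_of_hat_eq hm hJ hX (ψ + φ)
  rw [hJv] at h1
  exact ⟨ψ + φ, hJv, eq_add_of_sub_eq (isK_unique h1 h)⟩

/-- A bounded resolvent of `K` at `-c₀` makes `1 + (T + c₀ - 1) (L + 1)^{-1}` bijective. -/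
theorem bijective_of_resolvent (hm : 0 < m)
    (hJ : ∀ ψ n, hat (J ψ n) =ᵐ[volume] weighted m (-1) (hat (ψ n)))
    (hX : ∀ ψ n, hat (X ψ n) =ᵐ[volume] interaction m (c₀ - 1) 0 (hat (ψ n)))
    {R : Hilb M →L[ℂ] Hilb M} (hR : ∀ ψ : Hilb M, IsK m (R ψ) (ψ + ((-c₀ : ℝ) : ℂ) • R ψ))
    (hR' : ∀ φ χ : Hilb M, IsK m φ χ → R (χ - ((-c₀ : ℝ) : ℂ) • φ) = φ) :
    Function.Bijective fun v => v + X v := by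
  have hRY : ∀ v, R (v + X v) = J v := fun v => by
    have h := hR' _ _ (isK_of_hat_eq hm hJ hX v)
    rwa [Complex.ofReal_neg, neg_smul, sub_neg_eq_add, sub_add_cancel] at h
  refine ⟨fun v w hvw => ?_, fun ψ => ?_⟩
  · have h1 : J v = J w := (hRY v).symm.trans ((congrArg R hvw).trans (hRY w))
    refine hilb_ext fun n => ?_
    have h2 : ∀ u, u = J w → hat (u n) =ᵐ[volume] weighted m (-1) (hat (w n)) := by
      rintro _ rfl
      exact hJ w n
    filter_upwards [hJ v n, h2 _ h1] with k h3 h4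
    refine mul_left_cancel₀ (Complex.ofReal_ne_zero.2 ?_) (h3.symm.trans h4)
    exact (Real.rpow_pos_of_pos (energy_pos hm k) _).ne'
  · obtain ⟨v, -, hv⟩ := exists_of_isK hm hJ hX (hR ψ)
    refine ⟨v, hv.trans ?_⟩
    exact add_neg_smul_add_smul c₀ ψ (R ψ)

variable {G : Hilb M →L[ℂ] Hilb M}

theorem conj_hat_mul_creationHat
    (hJ : ∀ ψ n, hat (J ψ n) =ᵐ[volume] weighted m (-1) (hat (ψ n)))
    (hG : ∀ ψ n, hat (G ψ n) =ᵐ[volume] createdHat m 0 ψ n) (v ψ : Hilb M) (n : ℕ) :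
    (fun k => conj (hat (J v n) k) * creationHat ψ n k) =ᵐ[volume]
      fun k => -(conj (hat (v n) k) * hat (G ψ n) k) := by
  filter_upwards [hJ v n, hG ψ n] with k h1 h2
  have h3 : conj (hat (J v n) k) = ((energy m k ^ (-1 : ℝ) : ℝ) : ℂ) * conj (hat (v n) k) := by
    refine (congrArg conj h1).trans ?_
    rw [weighted, map_mul, Complex.conj_ofReal]
  rw [createdHat, weighted, zero_sub] at h2
  linear_combination creationHat ψ n k * h3 + conj (hat (v n) k) * h2

theorem integrable_pairing
    (hJ : ∀ ψ n, hat (J ψ n) =ᵐ[volume] weighted m (-1) (hat (ψ n)))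
    (hG : ∀ ψ n, hat (G ψ n) =ᵐ[volume] createdHat m 0 ψ n) (v ψ : Hilb M) (n : ℕ) :
    Integrable fun k => conj (hat (J v n) k) * creationHat ψ n k :=
  (integrable_conj_hat_mul_hat (v n) (G ψ n)).neg.congr (conj_hat_mul_creationHat hJ hG v ψ n).symm

/-- The `L²`-pairing of `(L + 1)^{-1} v` with `∑_μ a*(δ_{x_μ}) ψ`, sector by sector. -/
theorem integral_pairing
    (hJ : ∀ ψ n, hat (J ψ n) =ᵐ[volume] weighted m (-1) (hat (ψ n)))
    (hG : ∀ ψ n, hat (G ψ n) =ᵐ[volume] createdHat m 0 ψ n) (v ψ : Hilb M) (n : ℕ) :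
    ∫ k, conj (hat (J v n) k) * creationHat ψ n k = -(inner ℂ (v n) (G ψ n)) := by
  refine (integral_congr_ae (conj_hat_mul_creationHat hJ hG v ψ n)).trans ?_
  refine (integral_neg _).trans ?_
  exact congrArg Neg.neg (integral_conj_hat_mul_hat (v n) (G ψ n))

theorem hasSum_pairing
    (hJ : ∀ ψ n, hat (J ψ n) =ᵐ[volume] weighted m (-1) (hat (ψ n)))
    (hG : ∀ ψ n, hat (G ψ n) =ᵐ[volume] createdHat m 0 ψ n) (v ψ : Hilb M) :
    HasSum (fun n => ∫ k, conj (hat (J v n) k) * creationHat ψ n k) (-(inner ℂ v (G ψ))) := by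
  exact hasSum_of_eq_neg_inner v (G ψ) (integral_pairing hJ hG v ψ)

/-- `G_T` is the dual of `(1 + (T + c₀ - 1) (L + 1)^{-1})⁻¹` applied to
`-∑_μ (L + 1)^{-1} a*(δ_{x_μ}) ψ`. -/
theorem isGT_iff (hm : 0 < m)
    (hJ : ∀ ψ n, hat (J ψ n) =ᵐ[volume] weighted m (-1) (hat (ψ n)))
    (hX : ∀ ψ n, hat (X ψ n) =ᵐ[volume] interaction m (c₀ - 1) 0 (hat (ψ n)))
    (hG : ∀ ψ n, hat (G ψ n) =ᵐ[volume] createdHat m 0 ψ n)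
    (Y : Hilb M ≃L[ℂ] Hilb M) (hY : ∀ v, Y v = v + X v) (ψ η : Hilb M) :
    IsGT m c₀ ψ η ↔
      η = ContinuousLinearMap.adjoint (Y.symm : Hilb M →L[ℂ] Hilb M) (G ψ) := by
  constructor
  · intro h
    refine eq_adjoint_symm Y fun v => ?_
    have h1 := (h _ _ (isK_of_hat_eq hm hJ hX v)).2
    rw [sub_add_cancel, ← hY] at h1
    exact neg_injective (h1.unique (hasSum_pairing hJ hG v ψ))
  · rintro rfl φ χ hφχ
    obtain ⟨v, rfl, hv⟩ := exists_of_isK hm hJ hX hφχ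
    refine ⟨integrable_pairing hJ hG v ψ, ?_⟩
    have h1 := inner_adjoint_symm Y v (G ψ)
    rw [hY, hv] at h1
    rw [h1]
    exact hasSum_pairing hJ hG v ψ

end

/-! ### Properties of `G_T` -/

theorem exists_equiv_one_add {H : Type*} [NormedAddCommGroup H] [InnerProductSpace ℂ H]
    [CompleteSpace H] (X : H →L[ℂ] H) (h : Function.Bijective fun v => v + X v) :
    ∃ Y : H ≃L[ℂ] H, ∀ v, Y v = v + X v := by
  have h1 : Function.Bijective (ContinuousLinearMap.id ℂ H + X) := h
  exact ⟨ContinuousLinearEquiv.ofBijective (ContinuousLinearMap.id ℂ H + X)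
    (LinearMap.ker_eq_bot.2 h1.1) (LinearMap.range_eq_top.2 h1.2), fun v => rfl⟩

/-- Composing with the adjoint of the inverse of an operator that acts sector by sector keeps the
decay in the particle number. -/
theorem raisesWithDecay_adjoint_symm_comp {E : ℕ → Type*} [∀ n, NormedAddCommGroup (E n)]
    [∀ n, InnerProductSpace ℂ (E n)] [∀ n, CompleteSpace (E n)] (Y : lp E 2 ≃L[ℂ] lp E 2)
    (hY : ∀ v w n, v n = w n → Y v n = Y w n) {G : lp E 2 →L[ℂ] lp E 2} {C : ℝ}
    (h0 : ∀ ψ, G ψ 0 = 0)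
    (h : ∀ ψ (n : ℕ), ‖G ψ (n + 1)‖ ≤ C * (((n : ℝ) + 1) ^ (0 - 1 / 4 : ℝ) * ‖ψ n‖)) :
    RaisesWithDecay (‖(Y.symm : lp E 2 →L[ℂ] lp E 2)‖ * C)
      (ContinuousLinearMap.adjoint (Y.symm : lp E 2 →L[ℂ] lp E 2) ∘L G) := by
  refine fun ψ => ⟨?_, fun n => ?_⟩
  · have h1 := norm_adjoint_symm_apply_le Y hY (G ψ) 0
    rw [h0, norm_zero, mul_zero] at h1
    exact norm_le_zero_iff.1 h1
  · refine (norm_adjoint_symm_apply_le Y hY (G ψ) (n + 1)).trans ?_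
    refine (mul_le_mul_of_nonneg_left (h ψ n) (norm_nonneg _)).trans_eq ?_
    rw [zero_sub]
    ring

theorem RaisesWithDecay.exists_inverse {E : ℕ → Type*} [∀ n, NormedAddCommGroup (E n)]
    [∀ n, InnerProductSpace ℂ (E n)] [∀ n, CompleteSpace (E n)] {T : lp E 2 →L[ℂ] lp E 2} {C : ℝ}
    (h : RaisesWithDecay C T) (hC : 0 ≤ C) :
    ∃ R : lp E 2 →L[ℂ] lp E 2, (∀ ψ, R (ψ - T ψ) = ψ) ∧ (∀ ψ, R ψ - T (R ψ) = ψ) ∧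
      (∀ ψ : lp E 2, Memℓp (fun n : ℕ => (n : ℂ) • ψ n) 2 →
        Memℓp (fun n : ℕ => (n : ℂ) • (ψ - T ψ) n) 2) ∧
      ∀ ψ : lp E 2, Memℓp (fun n : ℕ => (n : ℂ) • ψ n) 2 →
        Memℓp (fun n : ℕ => (n : ℂ) • R ψ n) 2 := by
  obtain ⟨u, hu⟩ := h.isUnit_one_sub hC
  have h1 : ∀ ψ, (u⁻¹ : (lp E 2 →L[ℂ] lp E 2)ˣ).1 (ψ - T ψ) = ψ := fun ψ => by
    have := congrArg (fun A : lp E 2 →L[ℂ] lp E 2 => A ψ) u.inv_mul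
    rwa [hu] at this
  have h2 : ∀ ψ, (u⁻¹ : (lp E 2 →L[ℂ] lp E 2)ˣ).1 ψ - T ((u⁻¹ : (lp E 2 →L[ℂ] lp E 2)ˣ).1 ψ) = ψ :=
    fun ψ => by
      have := congrArg (fun A : lp E 2 →L[ℂ] lp E 2 => A ψ) u.mul_inv
      rwa [hu] at this
  exact ⟨_, h1, h2, fun ψ hψ => h.memℓp_sub hψ, fun ψ hψ => h.memℓp_of_sub (h2 ψ) hψ⟩

/-- The operator `1 + (T + c) (L + 1)^{-1}` acts sector by sector. -/
theorem add_apply_eq_of_apply_eq {M : ℕ} {m c : ℝ} {X : Hilb M →L[ℂ] Hilb M}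
    (hX : ∀ ψ n, hat (X ψ n) =ᵐ[volume] interaction m c 0 (hat (ψ n))) {v w : Hilb M} {n : ℕ}
    (h : v n = w n) : v n + X v n = w n + X w n := by
  have h1 := hX v n
  rw [h] at h1 ⊢
  rw [sector_ext (h1.trans (hX w n).symm)]

set_option maxHeartbeats 600000 in
/-- `G_T ψ` has the form `(L + 1)^{-s} w` and hence belongs to `D(L^s)`; the norm of `w` is bounded
by that of `(N + 1)^{s - 1/4} ψ`. -/
theorem exists_isFreePow_le {M : ℕ} {m : ℝ} (hm : 0 < m) {s : ℝ} (hs0 : 0 ≤ s) (hs : s < 1 / 4)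
    {c : ℝ} {X G : Hilb M →L[ℂ] Hilb M}
    (hX : ∀ ψ n, hat (X ψ n) =ᵐ[volume] interaction m c 0 (hat (ψ n)))
    (hG : ∀ ψ n, hat (G ψ n) =ᵐ[volume] createdHat m 0 ψ n)
    (Y : Hilb M ≃L[ℂ] Hilb M) (hY : ∀ v, Y v = v + X v) :
    ∃ C : ℝ, ∀ ψ, ∃ χ,
      IsFreePow m s (ContinuousLinearMap.adjoint (Y.symm : Hilb M →L[ℂ] Hilb M) (G ψ)) χ ∧
        ‖χ‖ ≤ C * ‖numberPow (s - 1 / 4) (by linarith) ψ‖ := by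
  obtain ⟨J, hJ⟩ := exists_energyPow (M := M) hm hs0
  obtain ⟨Q, hQ⟩ := exists_freePow_mul_energyPow (M := M) hm hs0
  obtain ⟨Xs, hXs⟩ := exists_interaction M hm c hs.le
  obtain ⟨Gs, D, hD, hGs, -, hGb⟩ := exists_creation M hm hs
  obtain ⟨C, hC, hCb⟩ := exists_norm_sub_adjoint_le
    (ContinuousLinearMap.adjoint (Y.symm : Hilb M →L[ℂ] Hilb M)) Xs J Q
  have hXJ : ∀ v, X v = Xs (J v) := fun v => hilb_ext fun n => by
    have h1 := (hXs (J v) n).trans (interaction_congr m c s (hJ v n))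
    refine (hX v n).trans (Filter.EventuallyEq.symm (h1.trans ?_))
    exact Filter.EventuallyEq.of_eq (interaction_weighted hm c s (hat (v n)))
  have hGJ : ∀ ψ, G ψ = J (Gs ψ) := fun ψ => hilb_ext fun n => by
    have h1 := (hJ (Gs ψ) n).trans (weighted_congr m (-s) (hGs ψ n))
    refine (hG ψ n).trans (Filter.EventuallyEq.symm (h1.trans ?_))
    exact Filter.EventuallyEq.of_eq (createdHat_weighted hm s ψ n)
  have hYJ : ∀ v, Y v = v + Xs (J v) := fun v => (hY v).trans (congrArg (v + ·) (hXJ v))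
  refine ⟨C * D, fun ψ => ⟨_, fun n => ?_, ((hCb (Gs ψ)).trans
    (mul_le_mul_of_nonneg_left (hGb ψ) hC)).trans_eq (mul_assoc _ _ _).symm⟩⟩
  have h1 := adjoint_symm_eq Y Xs J hYJ (inner_multiplier hJ) (Gs ψ)
  rw [← hGJ] at h1 ⊢
  generalize Gs ψ - ContinuousLinearMap.adjoint Xs
    (ContinuousLinearMap.adjoint (Y.symm : Hilb M →L[ℂ] Hilb M) (G ψ)) = w at h1 ⊢
  rw [h1]
  filter_upwards [hQ w n, hJ w n] with k h2 h3
  rw [Complex.ofReal_mul] at h2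
  linear_combination h2 - ((freeSymbol m k ^ s : ℝ) : ℂ) * h3

end PointInteraction

set_option maxHeartbeats 600000 in
theorem proposition3p7 (M : ℕ) (m : ℝ) (hm : 0 < m) (c₀ : ℝ)
    (hc₀ : ∀ r : ℝ, (r : ℂ) ∈ PointInteraction.spectrumK M m → -c₀ < r) :
    ∃ G_T : PointInteraction.Hilb M →L[ℂ] PointInteraction.Hilb M,
      (∀ ψ η : PointInteraction.Hilb M, PointInteraction.IsGT m c₀ ψ η ↔ η = G_T ψ) ∧
      (∀ (s : ℝ) (_ : 0 ≤ s) (hs : s < 1 / 4), ∃ C : ℝ, ∀ ψ : PointInteraction.Hilb M,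
        ∃ χ : PointInteraction.Hilb M, PointInteraction.IsFreePow m s (G_T ψ) χ ∧
          ‖χ‖ ≤ C * ‖PointInteraction.numberPow (s - 1 / 4) (by linarith) ψ‖) ∧
      (∃ R : PointInteraction.Hilb M →L[ℂ] PointInteraction.Hilb M,
        (∀ ψ, R (ψ - G_T ψ) = ψ) ∧ (∀ ψ, R ψ - G_T (R ψ) = ψ) ∧
        (∀ ψ ∈ PointInteraction.numberDomain M, ψ - G_T ψ ∈ PointInteraction.numberDomain M) ∧
        (∀ ψ ∈ PointInteraction.numberDomain M, R ψ ∈ PointInteraction.numberDomain M)) := by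
  open PointInteraction in
  obtain ⟨J, hJ⟩ := exists_energyPow (M := M) hm zero_le_one
  obtain ⟨X, hX⟩ := exists_interaction M hm (c₀ - 1) (s := 0) (by norm_num)
  obtain ⟨G, C, hC, hG, hGn, -⟩ := exists_creation M hm (s := 0) (by norm_num)
  -- `-c₀` lies below the spectrum, so `K + c₀` has a bounded inverse.
  obtain ⟨R, hR, hR'⟩ := not_not.1 fun h => lt_irrefl _ (hc₀ (-c₀) h)
  obtain ⟨Y, hY⟩ := exists_equiv_one_add X (bijective_of_resolvent hm hJ hX hR hR')
  have hYn : ∀ v w : Hilb M, ∀ n, v n = w n → Y v n = Y w n := fun v w n h => by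
    rw [hY, hY]
    exact add_apply_eq_of_apply_eq hX h
  have hG0 : ∀ ψ, G ψ 0 = 0 := fun ψ => by
    have h1 := lintegral_sq_of_hat_eq (hG ψ 0)
    simp only [createdHat_zero, enorm_zero] at h1
    rw [← enorm_eq_zero, ← pow_eq_zero_iff two_ne_zero, ← h1]
    simp
  have hdecay := raisesWithDecay_adjoint_symm_comp Y hYn hG0 hGn
  refine ⟨ContinuousLinearMap.adjoint (Y.symm : Hilb M →L[ℂ] Hilb M) ∘L G,
    fun ψ η => isGT_iff hm hJ hX hG Y hY ψ η,
    fun s hs0 hs => exists_isFreePow_le hm hs0 hs hX hG Y hY,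
    hdecay.exists_inverse (by positivity)⟩
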